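/- **Setting.** Let $N_t,N_r\ge 1$, $n=\min(N_t,N_r)$, and let $\mathbf H\in\mathbb C^{N_r\times N_t}$ have i.i.d. $\mathcal{CN}(0,1)$ entries. Let $\lambda_1\ge\dots\ge\lambda_n\ge 0$ be the ordered eigenvalues of $\mathbf H\mathbf H^H$ (if $N_r<N_t$) or of $\mathbf H^H\mathbf H$ (if $N_r\ge N_t$), and $\boldsymbol\Lambda=\mathrm{diag}(\lambda_1,\dots,\lambda_n)$. On $\mathcal D_{ord}=\{\lambda_1\ge\dots\ge\lambda_n\ge0\}$ put $$p(\boldsymbol\lambda)=\frac1C\prod_{m}e^{-\lambda_m}\lambda_m^{|N_t-N_r|}\prod_{m'<m}(\lambda_m-\lambda_{m'})^2=\frac1C\sum_{p=1}^{P}\alpha_p\prod_m e^{-\lambda_m}\lambda_m^{\beta_{p,m}},$$ where $C=C_{N_t,N_r}$ is the constant making $\int_{\mathcal D_{ord}}p=1$ and the second form is the expansion of the polynomial factor into monomials. Write $(x)_k=x(x+1)\cdots(x+k-1)$. For $\mathbf a\in[0,\infty)^n$ and $c_k=k+a_1+\dots+a_k$, let $$J_p(\mathbf a)=\frac{(1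)_{\beta_{p,1}}}{c_1^{\beta_{p,1}+1}}\sum_{i_1=0}^{\beta_{p,1}}\frac{(i_1+1)_{\beta_{p,2}}\,c_1^{i_1}}{c_2^{\beta_{p,2}+i_1+1}}\sum_{i_2=0}^{\beta_{p,2}+i_1}\frac{(i_2+1)_{\beta_{p,3}}\,c_2^{i_2}}{c_3^{\beta_{p,3}+i_2+1}}\cdots\sum_{i_{n-1}=0}^{\beta_{p,n-1}+i_{n-2}}\frac{(i_{n-1}+1)_{\beta_{p,n}}\,c_{n-1}^{i_{n-1}}}{c_n^{\beta_{p,n}+i_{n-1}+1}}$$ ($n-1$ nested sums). The SL-MIMO system has $L$ layers; layer $l$ has a codebook of $M$ codewords in $\mathbb C^n$, supported on a fixed set of coordinates $\mathcal N_l$. A message picks one codeword $\mathbf s_l$ per layer, all $M^L=2^\eta$ choices ($\eta=L\log_2M$) being equally likely; the data symbol vector is $\mathbf s=\sum_l\mathbf s_l$, distinct messages give distinct $\mathbf s$, and $\mathcal S$ is the set of all $M^L$ data symbol vectors. With a singular value decomposition $\mathbf H=\mathbf U\boldsymbol\Sigma\mathbf V^H$ (singular values $\sqrt{\lambda_m}$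 in decreasing order), and with $\bar{\mathbf U},\bar{\mathbf V}$ the first $n$ columns of $\mathbf U,\mathbf V$, the receiver forms $\mathbf z=\bar{\mathbf U}^H(\mathbf H\bar{\mathbf V}\mathbf s+\mathbf n)$, where $\mathbf n\sim\mathcal{CN}(0,N_0\mathbf I)$ is independent of $(\mathbf H,\mathbf U,\mathbf V)$ and the message is independent of $(\mathbf H,\mathbf U,\mathbf V,\mathbf n)$. The ML detector returns $\hat{\mathbf s}\in\arg\min_{\mathbf s'\in\mathcal S}\|\mathbf z-\boldsymbol\Lambda^{1/2}\mathbf s'\|^2$ (ties broken arbitrarily), and $\mathrm{AWEP}=\Pr(\hat{\mathbf s}\ne\mathbf s)$. For $\boldsymbol\psi=\mathbf s-\hat{\mathbf s}$ put $a_m=|\psi_m|^2/(4N_0)$ and $b_m=|\psi_m|^2/(3N_0)$. **Claim.** 1. For all $\mathbf a\in[0,\infty)^n$, the joint moment generating function of the ordered eigenvalues at $-\mathbf a$ is $$\mathbb E\Big[\prod_m e^{-a_m\lambda_m}\Big]=\int_{\mathcal D_{ord}}\prod_m e^{-a_m\lambda_m}\,p(\boldsymbol\lambda)\,d\boldsymbol\lambda=\frac1C\sum_{p=1}^P\alpha_pJ_p(\mathbf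 a).$$ 2. For every $N_0>0$, $$\mathrm{AWEP}\le\frac1{2^{\eta}C}\sum_{\mathbf s\in\mathcal S}\ \sum_{\hat{\mathbf s}\in\mathcal S}\ \sum_{p=1}^P\alpha_p\Big[\tfrac1{12}J_p(\mathbf a)+\tfrac14J_p(\mathbf b)\Big].$$ 3. For every fixed choice of $N_t,N_r$ and of the codebooks there is $N_1>0$ such that for all $0<N_0<N_1$ (that is, at sufficiently high signal-to-noise ratio) the bound in 2 holds even with the terms $\hat{\mathbf s}=\mathbf s$ omitted from the double sum. -/

import Mathlib

open MeasureTheory ProbabilityTheory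
open scoped Matrix NNReal ENNReal

universe u

namespace SLMIMO

noncomputable section

/-! ### Gaussian channel, ordered eigenvalues, singular value decomposition -/

/-- The circularly symmetric complex Gaussian law `CN(0, v)`: real and imaginary parts are
independent `N(0, v / 2)`. -/
def complexGaussian (v : ℝ) : Measure ℂ :=
  ((gaussianReal 0 (v / 2).toNNReal).prod (gaussianReal 0 (v / 2).toNNReal)).map
    (fun p : ℝ × ℝ => (⟨p.1, p.2⟩ : ℂ))

/-- The random matrix `H` has i.i.d. `CN(0, 1)` entries. -/
structure IsGaussianChannel {Nt Nr : ℕ} {Ω : Type*} [MeasurableSpace Ω]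
    (H : Ω → Matrix (Fin Nr) (Fin Nt) ℂ) (μ : Measure Ω) : Prop where
  indep : iIndepFun (fun (ij : Fin Nr × Fin Nt) ω => H ω ij.1 ij.2) μ
  law : ∀ i j, HasLaw (fun ω => H ω i j) (complexGaussian 1) μ

/-- The eigenvalues `λ₁ ≥ λ₂ ≥ … ≥ λₙ`, `n = min Nt Nr`, of `H Hᴴ` if `Nr < Nt`, and of `Hᴴ H` if
`Nr ≥ Nt`, with multiplicity and in decreasing order (`eigenvalues₀` is antitone). -/
def orderedEigenvalues {Nt Nr : ℕ} (H : Matrix (Fin Nr) (Fin Nt) ℂ) : Fin (min Nt Nr) → ℝ :=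
  fun m =>
    if Nr < Nt then
      (Matrix.isHermitian_mul_conjTranspose_self H).eigenvalues₀
        (Fin.castLE (by simp) m)
    else
      (Matrix.isHermitian_conjTranspose_mul_self H).eigenvalues₀
        (Fin.castLE (by simp) m)

/-- The `Nr × Nt` matrix `Σ` with `√λ₁, …, √λₙ` on its main diagonal and zeros elsewhere. -/
def singularMatrix (Nt Nr : ℕ) (lam : Fin (min Nt Nr) → ℝ) : Matrix (Fin Nr) (Fin Nt) ℂ :=
  fun i j =>
    if h : i.val = j.val then
      ((Real.sqrt (lam ⟨i.val, lt_min (h ▸ j.isLt) i.isLt⟩) : ℝ) : ℂ)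
    else 0

/-- `H = U Σ Vᴴ` with `U`, `V` unitary, the singular values being in decreasing order. -/
def IsOrderedSVD {Nt Nr : ℕ} (H : Matrix (Fin Nr) (Fin Nt) ℂ)
    (U : Matrix (Fin Nr) (Fin Nr) ℂ) (V : Matrix (Fin Nt) (Fin Nt) ℂ) : Prop :=
  U ∈ Matrix.unitaryGroup (Fin Nr) ℂ ∧ V ∈ Matrix.unitaryGroup (Fin Nt) ℂ ∧
    H = U * singularMatrix Nt Nr (orderedEigenvalues H) * Vᴴ

/-- The first `n = min Nt Nr` columns of `U`. -/
def leftPart {Nt Nr : ℕ} (U : Matrix (Fin Nr) (Fin Nr) ℂ) :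
    Matrix (Fin Nr) (Fin (min Nt Nr)) ℂ :=
  U.submatrix id (Fin.castLE (min_le_right Nt Nr))

/-- The first `n = min Nt Nr` columns of `V`. -/
def rightPart {Nt Nr : ℕ} (V : Matrix (Fin Nt) (Fin Nt) ℂ) :
    Matrix (Fin Nt) (Fin (min Nt Nr)) ℂ :=
  V.submatrix id (Fin.castLE (min_le_left Nt Nr))

/-! ### The layered code, transmission and maximum likelihood detection -/

/-- `L` sparse codebooks of size `M` on `n` eigen-channels: layer `l` uses the eigen-channels in
`support l`, and its codewords vanish elsewhere. Different choices of codewords give different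
data symbol vectors, so that there are `M ^ L` data symbol vectors. -/
structure LayeredCode (n L M : ℕ) where
  support : Fin L → Finset (Fin n)
  codeword : Fin L → Fin M → Fin n → ℂ
  codeword_eq_zero : ∀ l j m, m ∉ support l → codeword l j m = 0
  superposition_injective :
    Function.Injective (fun w : Fin L → Fin M => ∑ l, codeword l (w l))

/-- The data symbol vector `s = ∑ₗ sₗ`, where layer `l` sends its codeword number `w l`. -/
def LayeredCode.symbol {n L M : ℕ} (code : LayeredCode n L M) (w : Fin L → Fin M) : Fin n → ℂ :=
  ∑ l, code.codeword l (w l)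

open Classical in
/-- The set `𝒮` of all data symbol vectors. -/
def LayeredCode.symbols {n L M : ℕ} (code : LayeredCode n L M) : Finset (Fin n → ℂ) :=
  Finset.univ.image code.symbol

/-- The number of bits per channel use, `η = L log₂ M`. -/
def spectralEfficiency (L M : ℕ) : ℝ := L * Real.logb 2 M

/-- The random quantities of one channel use: the channel `H` with the factors `U`, `V` of its
singular value decomposition, the receiver noise, the message (one codeword index per layer) and
the vector `sHat` chosen by the detector. -/
structure Transmission (Nt Nr L M : ℕ) (Ω : Type*) where
  H : Ω → Matrix (Fin Nr) (Fin Nt) ℂ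
  U : Ω → Matrix (Fin Nr) (Fin Nr) ℂ
  V : Ω → Matrix (Fin Nt) (Fin Nt) ℂ
  noise : Ω → Fin Nr → ℂ
  msg : Ω → Fin L → Fin M
  sHat : Ω → Fin (min Nt Nr) → ℂ

namespace Transmission

variable {Nt Nr L M : ℕ} {Ω : Type*}

/-- The data symbol vector `s`. -/
def sent (T : Transmission Nt Nr L M Ω) (code : LayeredCode (min Nt Nr) L M) (ω : Ω) :
    Fin (min Nt Nr) → ℂ :=
  code.symbol (T.msg ω)

/-- The received vector `y = H x + noise`, where `x = V̄ s`. -/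
def received (T : Transmission Nt Nr L M Ω) (code : LayeredCode (min Nt Nr) L M) (ω : Ω) :
    Fin Nr → ℂ :=
  T.H ω *ᵥ (rightPart (T.V ω) *ᵥ T.sent code ω) + T.noise ω

/-- The post-processed received vector `z = Ūᴴ y`. -/
def processed (T : Transmission Nt Nr L M Ω) (code : LayeredCode (min Nt Nr) L M) (ω : Ω) :
    Fin (min Nt Nr) → ℂ :=
  (leftPart (T.U ω))ᴴ *ᵥ T.received code ω

/-- The squared Euclidean distance `‖z - Λ^(1/2) s‖²`. -/
def mlMetric (T : Transmission Nt Nr L M Ω) (code : LayeredCode (min Nt Nr) L M) (ω : Ω)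
    (s : Fin (min Nt Nr) → ℂ) : ℝ :=
  ∑ m, ‖T.processed code ω m - (Real.sqrt (orderedEigenvalues (T.H ω) m) : ℂ) * s m‖ ^ 2

/-- The SL-MIMO system with noise level `N₀` and maximum likelihood detection: `H` is Gaussian, `U`
and `V` come from its singular value decomposition, the noise is `CN(0, N₀ I)` and independent
of the channel, the messages are equiprobable and independent of channel and noise, and `sHat`
minimises `‖z - Λ^(1/2) s‖²` over `s ∈ 𝒮` (ties being broken arbitrarily). -/
structure IsMLSystem [MeasurableSpace Ω] (T : Transmission Nt Nr L M Ω)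
    (code : LayeredCode (min Nt Nr) L M) (N₀ : ℝ) (μ : Measure Ω) : Prop where
  channel : IsGaussianChannel T.H μ
  measurable_U : ∀ i j, Measurable fun ω => T.U ω i j
  measurable_V : ∀ i j, Measurable fun ω => T.V ω i j
  svd : ∀ᵐ ω ∂μ, IsOrderedSVD (T.H ω) (T.U ω) (T.V ω)
  noise_iid : iIndepFun (fun i ω => T.noise ω i) μ
  noise_law : ∀ i, HasLaw (fun ω => T.noise ω i) (complexGaussian N₀) μ
  noise_indep :
    IndepFun (fun ω => ((fun i j => T.H ω i j, fun i j => T.U ω i j, fun i j => T.V ω i j) :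
        (Fin Nr → Fin Nt → ℂ) × (Fin Nr → Fin Nr → ℂ) × (Fin Nt → Fin Nt → ℂ)))
      T.noise μ
  msg_law : HasLaw T.msg (uniformOn Set.univ) μ
  msg_indep :
    IndepFun T.msg
      (fun ω => ((fun i j => T.H ω i j, fun i j => T.U ω i j, fun i j => T.V ω i j, T.noise ω) :
        (Fin Nr → Fin Nt → ℂ) × (Fin Nr → Fin Nr → ℂ) × (Fin Nt → Fin Nt → ℂ) × (Fin Nr → ℂ))) μ
  detect_mem : ∀ᵐ ω ∂μ, T.sHat ω ∈ code.symbols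
  detect_min : ∀ᵐ ω ∂μ, ∀ s ∈ code.symbols, T.mlMetric code ω (T.sHat ω) ≤ T.mlMetric code ω s

/-- The average word error probability `P(ŝ ≠ s)`. -/
def awep [MeasurableSpace Ω] (T : Transmission Nt Nr L M Ω)
    (code : LayeredCode (min Nt Nr) L M) (μ : Measure Ω) : ℝ :=
  μ.real {ω | T.sHat ω ≠ T.sent code ω}

end Transmission

/-! ### The joint density of the ordered eigenvalues and its expansion into monomials -/

/-- The domain `λ₁ ≥ λ₂ ≥ … ≥ λₙ ≥ 0`. -/
def orderedDomain (n : ℕ) : Set (Fin n → ℝ) :=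
  {x | Antitone x ∧ ∀ m, 0 ≤ x m}

/-- The polynomial `∏ₘ Xₘ^|Nt - Nr| · ∏_{m' < m} (Xₘ - Xₘ')²`. Its coefficients are the `αₚ`, and
the exponents of its monomials are the `βₚ`. -/
def densityPoly (Nt Nr : ℕ) : MvPolynomial (Fin (min Nt Nr)) ℝ :=
  (∏ m, MvPolynomial.X m ^ ((Nt : ℤ) - (Nr : ℤ)).natAbs) *
    ∏ m, ∏ m' ∈ Finset.Iio m, (MvPolynomial.X m - MvPolynomial.X m') ^ 2

/-- The normalizing factor `C` of the joint density of the ordered eigenvalues. -/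
def normConst (Nt Nr : ℕ) : ℝ :=
  ∫ x in orderedDomain (min Nt Nr), (∏ m, Real.exp (-x m)) * MvPolynomial.eval x (densityPoly Nt Nr)

/-- The joint density
`p(λ) = C⁻¹ ∏ₘ e^(-λₘ) λₘ^|Nt - Nr| ∏_{m' < m} (λₘ - λₘ')²` on `λ₁ ≥ … ≥ λₙ ≥ 0`. -/
def eigenvalueDensity (Nt Nr : ℕ) (x : Fin (min Nt Nr) → ℝ) : ℝ :=
  1 / normConst Nt Nr *
    ((∏ m, Real.exp (-x m) * x m ^ ((Nt : ℤ) - (Nr : ℤ)).natAbs) *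
      ∏ m, ∏ m' ∈ Finset.Iio m, (x m - x m') ^ 2)

/-! ### The closed form -/

/-- The nested sum attached to one monomial with exponents `β₁, …, βₙ`. `nestedSum n 0 0 a β` is
`(1)_{β₁} / (1 + a₁)^(β₁ + 1)`
` * ∑_{i₁ ≤ β₁} (i₁ + 1)_{β₂} (1 + a₁)^i₁ / (2 + a₁ + a₂)^(β₂ + i₁ + 1)`
` * ∑_{i₂ ≤ β₂ + i₁} (i₂ + 1)_{β₃} (2 + a₁ + a₂)^i₂ / (3 + a₁ + a₂ + a₃)^(β₃ + i₂ + 1) * …`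
` * ∑_{i_{n-1} ≤ β_{n-1} + i_{n-2}} (i_{n-1} + 1)_{βₙ}`
`     (n - 1 + a₁ + … + a_{n-1})^i_{n-1} / (n + a₁ + … + aₙ)^(βₙ + i_{n-1} + 1)`.
In the recursion, at the stage of the variable number `k`, the argument `c` is
`k - 1 + a₁ + … + a_{k-1}` and `i` is `i_{k-1}` (with `i₀ = 0`); `a` and `β` hold the entries
from `k` on. Here `(x)_k` is the rising factorial. -/
def nestedSum : (n : ℕ) → ℝ → ℕ → (Fin n → ℝ) → (Fin n → ℕ) → ℝ
  | 0, _, _, _, _ => 1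
  | 1, c, i, a, β => ((i + 1).ascFactorial (β 0) : ℝ) * c ^ i / (c + (1 + a 0)) ^ (β 0 + i + 1)
  | n + 2, c, i, a, β =>
      ((i + 1).ascFactorial (β 0) : ℝ) * c ^ i / (c + (1 + a 0)) ^ (β 0 + i + 1) *
        ∑ j ∈ Finset.range (β 0 + i + 1),
          nestedSum (n + 1) (c + (1 + a 0)) j (Fin.tail a) (Fin.tail β)

/-- `C⁻¹ ∑ₚ αₚ · (nested sum of βₚ)`, the closed form of the joint moment generating function. -/
def mgfClosedForm (Nt Nr : ℕ) (a : Fin (min Nt Nr) → ℝ) : ℝ :=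
  1 / normConst Nt Nr *
    ∑ β ∈ (densityPoly Nt Nr).support,
      (densityPoly Nt Nr).coeff β * nestedSum (min Nt Nr) 0 0 a β

/-- The vector `aₘ = |ψₘ|² / (4 N₀)` of a difference vector `ψ`. -/
def aVec {n : ℕ} (N₀ : ℝ) (ψ : Fin n → ℂ) : Fin n → ℝ := fun m => ‖ψ m‖ ^ 2 / (4 * N₀)

/-- The vector `bₘ = |ψₘ|² / (3 N₀)` of a difference vector `ψ`. -/
def bVec {n : ℕ} (N₀ : ℝ) (ψ : Fin n → ℂ) : Fin n → ℝ := fun m => ‖ψ m‖ ^ 2 / (3 * N₀)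

/-- The contribution `∑ₚ αₚ [1/12 · (nested sum in a) + 1/4 · (nested sum in b)]` of one pair
`(s, ŝ)` with difference vector `ψ = s - ŝ`. -/
def pairTerm (Nt Nr : ℕ) (N₀ : ℝ) (ψ : Fin (min Nt Nr) → ℂ) : ℝ :=
  ∑ β ∈ (densityPoly Nt Nr).support,
    (densityPoly Nt Nr).coeff β *
      (1 / 12 * nestedSum (min Nt Nr) 0 0 (aVec N₀ ψ) β +
        1 / 4 * nestedSum (min Nt Nr) 0 0 (bVec N₀ ψ) β)

end

end SLMIMO

/-! The eigenvalue law comes from an induction on the rows of the channel matrix, transposed if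
necessary so that it has at most as many rows as columns. A new row adds a rank-one term to `Hᴴ *
H`. In an eigenbasis the problem becomes `diag l + v vᴴ`, with `v` again standard Gaussian by
unitary invariance. The new eigenvalues depend only on the `|v i|²` at the old eigenvalues and on
the total weight at the eigenvalue zero, which are independent Erlang variables. Passing from
weights to roots of the secular equation is a bijection onto the interlacing tuples with Jacobian
`Δ(μ) / Δ(l)`. After exchanging the integrals, the old eigenvalues are integrated out of one
remaining Vandermonde factor, which leaves the new one (`lintegral_laguerre_succ`,
`lintegral_eigs_gaussMat`). No constant is tracked: total mass one fixes the normalisation in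
`laguerreLaw_spec`. The closed form follows by integrating the largest eigenvalue first; each tail
integral of a power times an exponential is a finite sum of terms of the same shape
(`lintegral_nestedSum`).

For the error probability, the noise is integrated out with the channel fixed. Each pairwise error
has probability `craig y`, where `y` is the received squared distance over `4 * N₀`, and the union
bound may be capped at one. The function `expBound` is not a pointwise upper bound for `craig`: at
`y = 0` the values are `1/3` and `1/2`. What is true is `craig ≤ 3/2 * expBound` (`craig_le`), and
this gives `min 1 (∑ craig) ≤ 1/3 + ∑ expBound` (`min_one_sum_craig_le`). The extra `1/3` is exactly
what a diagonal pair `ŝ = s` contributes (`pairTerm_zero`), so the full double sum is a bound at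
every noise level.

Without the diagonal terms the comparison is made after averaging. The Laplace transform of the
received squared distance is a positive rational function of the signal-to-noise ratio `s` that
tends to zero, hence behaves like `c / s ^ D` with `D ≥ 1`. Under Craig's integral the mean tail is
then asymptotically `wallis D / 2` times this, while the exponential bound gives `1/12 + 1/4 * (3/4)
^ D` times this. The second factor is strictly larger for every `D ≥ 1` (`wallis_lt`), which settles
each pair at high signal-to-noise ratio (`eventually_integral_craig_le`); there are finitely many
pairs. -/

namespace SLMIMO

noncomputable section

/-! ### Ordered eigenvalues of Hermitian matrices -/

open Polynomial in
/-- A decreasing tuple is determined by infinitely many values of its monic polynomial. -/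
theorem antitone_eq_of_prod_eq {n : ℕ} {x y : Fin n → ℝ} (hx : Antitone x) (hy : Antitone y)
    {S : Set ℝ} (hS : S.Infinite)
    (h : ∀ t ∈ S, ∏ i, (t - x i) = ∏ i, (t - y i)) : x = y := by
  have hP : (∏ i, (X - C (x i)) : ℝ[X]) = ∏ i, (X - C (y i)) := by
    refine eq_of_infinite_eval_eq _ _ (hS.mono fun t ht => ?_)
    simpa [eval_prod] using h t ht
  have hr := congrArg Polynomial.roots hP
  rw [roots_prod _ _ (by simp [Finset.prod_ne_zero_iff, X_sub_C_ne_zero]),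
    roots_prod _ _ (by simp [Finset.prod_ne_zero_iff, X_sub_C_ne_zero])] at hr
  simp only [roots_X_sub_C, Multiset.bind_singleton, Fin.univ_val_map] at hr
  exact List.ofFn_injective (List.Perm.eq_of_sortedGE hx.sortedGE_ofFn hy.sortedGE_ofFn
    (Multiset.coe_eq_coe.1 hr))

open Classical in
/-- The eigenvalues of a Hermitian matrix in decreasing order (zero for other matrices). -/
def eigs {n : ℕ} (A : Matrix (Fin n) (Fin n) ℂ) : Fin n → ℝ :=
  if h : A.IsHermitian then fun i => h.eigenvalues₀ (Fin.cast (Fintype.card_fin n).symm i) else 0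

theorem eigs_antitone {n : ℕ} (A : Matrix (Fin n) (Fin n) ℂ) : Antitone (eigs A) := by
  unfold eigs
  split_ifs with h
  · exact fun i j hij => h.eigenvalues₀_antitone (by simpa using hij)
  · exact fun _ _ _ => le_rfl

theorem eval_charpoly_eq_prod_eigs {n : ℕ} {A : Matrix (Fin n) (Fin n) ℂ} (hA : A.IsHermitian)
    (t : ℝ) : A.charpoly.eval (t : ℂ) = ((∏ i, (t - eigs A i) : ℝ) : ℂ) := by
  rw [hA.charpoly_eq, Polynomial.eval_prod]
  push_cast
  have : eigs A = fun i => hA.eigenvalues₀ (Fin.cast (Fintype.card_fin n).symm i) := by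
    unfold eigs; rw [dif_pos hA]
  rw [this]
  -- Mathlib's `eigenvalues` is `eigenvalues₀` read through a chosen equivalence of index types, so
  -- the two products differ by a permutation of the factors.
  let e : Fin n ≃ Fin n := ((finCongr (Fintype.card_fin n).symm).trans
    (Fintype.equivOfCardEq (Fintype.card_fin _)))
  rw [← Equiv.prod_comp e]
  refine Finset.prod_congr rfl fun i _ => ?_
  simp [Matrix.IsHermitian.eigenvalues, e]

theorem eigs_eq {n : ℕ} {A : Matrix (Fin n) (Fin n) ℂ} (hA : A.IsHermitian) {x : Fin n → ℝ}
    (hx : Antitone x) {S : Set ℝ} (hS : S.Infinite)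
    (h : ∀ t ∈ S, A.charpoly.eval (t : ℂ) = ((∏ i, (t - x i) : ℝ) : ℂ)) :
    eigs A = x :=
  antitone_eq_of_prod_eq (eigs_antitone A) hx hS fun t ht => by
    exact_mod_cast (eval_charpoly_eq_prod_eigs hA t).symm.trans (h t ht)

open scoped ComplexOrder in
theorem eigs_nonneg {n m : ℕ} (H : Matrix (Fin n) (Fin m) ℂ) (i : Fin n) :
    0 ≤ eigs (H * Hᴴ) i := by
  have h := Matrix.isHermitian_mul_conjTranspose_self H
  have hp := (Matrix.posSemidef_self_mul_conjTranspose H).eigenvalues_nonneg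
  unfold eigs
  rw [dif_pos h]
  have := hp (Fintype.equivOfCardEq (Fintype.card_fin _) (Fin.cast (Fintype.card_fin n).symm i))
  simpa [Matrix.IsHermitian.eigenvalues] using this

/-- An injective measurable map between standard Borel spaces is a measurable embedding. It reduces
measurability of ordered eigenvalues to that of characteristic polynomial values at natural numbers,
with no continuity argument for roots. -/
theorem measurableEmbedding_antitone_prod (n : ℕ) :
    MeasurableEmbedding (fun (x : {x : Fin n → ℝ // Antitone x}) (t : ℕ) =>
      ∏ i, ((t : ℝ) - x.1 i)) := by
  have hcl : IsClosed {x : Fin n → ℝ | Antitone x} := by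
    simp only [Antitone, Set.ofPred_forall]
    exact isClosed_iInter fun i => isClosed_iInter fun j => isClosed_iInter fun _ =>
      isClosed_le (continuous_apply j) (continuous_apply i)
  have : StandardBorelSpace {x : Fin n → ℝ // Antitone x} :=
    hcl.measurableSet.standardBorel
  refine Measurable.measurableEmbedding ?_ ?_
  · refine measurable_pi_lambda _ fun t => Finset.measurable_prod _ fun i _ => ?_
    exact measurable_const.sub ((measurable_pi_apply i).comp measurable_subtype_coe)
  · intro x y hxy
    exact Subtype.ext (antitone_eq_of_prod_eq x.2 y.2
      (Set.infinite_range_of_injective (Nat.cast_injective (R := ℝ))) (by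
        rintro _ ⟨t, rfl⟩; exact congrFun hxy t))

theorem measurable_eval_charpoly {n : ℕ} {X : Type*} [MeasurableSpace X]
    {f : X → Matrix (Fin n) (Fin n) ℂ} (hf : ∀ i j, Measurable fun x => f x i j) (t : ℂ) :
    Measurable fun x => (f x).charpoly.eval t := by
  simp only [Matrix.eval_charpoly, Matrix.det_apply]
  refine Finset.measurable_sum _ fun σ _ => ?_
  refine Measurable.const_smul ?_ _
  refine Finset.measurable_prod _ fun i _ => ?_
  simp only [Matrix.sub_apply]
  exact measurable_const.sub (hf _ _)

/-- Ordered eigenvalues depend measurably on the matrix. -/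
theorem measurable_eigs {n : ℕ} {X : Type*} [MeasurableSpace X]
    {f : X → Matrix (Fin n) (Fin n) ℂ} (hf : ∀ i j, Measurable fun x => f x i j)
    (hH : ∀ x, (f x).IsHermitian) : Measurable fun x => eigs (f x) := by
  have h1 : Measurable fun x => (⟨eigs (f x), eigs_antitone _⟩ : {x : Fin n → ℝ // Antitone x}) := by
    rw [← (measurableEmbedding_antitone_prod n).measurable_comp_iff]
    refine measurable_pi_lambda _ fun t => ?_
    have : (fun x => ∏ i, ((t : ℝ) - eigs (f x) i)) =
        fun x => ((f x).charpoly.eval ((t : ℝ) : ℂ)).re := by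
      funext x
      rw [eval_charpoly_eq_prod_eigs (hH x), Complex.ofReal_re]
    change Measurable (fun x => ∏ i, ((t : ℝ) - eigs (f x) i))
    rw [this]
    exact Complex.measurable_re.comp (measurable_eval_charpoly hf _)
  exact measurable_subtype_coe.comp h1

/-! ### Rank-one perturbations of diagonal matrices -/

/-- The characteristic polynomial of `diag l + v vᴴ` with `|v i|² = w i`, as a function. -/
def secular {ι : Type*} [Fintype ι] [DecidableEq ι] (l w : ι → ℝ) (t : ℝ) : ℝ :=
  ∏ i, (t - l i) - ∑ i, w i * ∏ j ∈ Finset.univ.erase i, (t - l j)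

/-- The matrix determinant lemma with the inverse of the diagonal multiplied out. -/
theorem det_diagonal_add_vecMulVec {ι : Type*} [Fintype ι] [DecidableEq ι] (d u v : ι → ℂ)
    (hd : ∀ i, d i ≠ 0) :
    (Matrix.diagonal d + Matrix.vecMulVec u v).det =
      ∏ i, d i + ∑ i, u i * v i * ∏ j ∈ Finset.univ.erase i, d j := by
  have hdet : (Matrix.diagonal d).det = ∏ i, d i := Matrix.det_diagonal
  have hu : IsUnit (Matrix.diagonal d).det := by
    rw [hdet, isUnit_iff_ne_zero]; exact Finset.prod_ne_zero_iff.2 fun i _ => hd i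
  have hinv : (Matrix.diagonal d)⁻¹ = Matrix.diagonal fun i => (d i)⁻¹ := by
    refine Matrix.inv_eq_right_inv ?_
    rw [Matrix.diagonal_mul_diagonal]
    simp [hd]
  rw [Matrix.vecMulVec_eq Unit, Matrix.det_add_replicateCol_mul_replicateRow hu, hdet, hinv,
    Matrix.det_unique, Matrix.add_apply, Matrix.one_apply_eq, mul_add, mul_one, Matrix.mul_apply,
    Finset.mul_sum]
  congr 1
  refine Finset.sum_congr rfl fun i _ => ?_
  rw [Matrix.mul_diagonal, ← Finset.mul_prod_erase _ d (Finset.mem_univ i)]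
  simp only [Matrix.replicateRow_apply, Matrix.replicateCol_apply]
  field_simp [hd i]

open Polynomial in
-- The determinant lemma applies only off the diagonal entries `l i`. These are finitely many, and
-- both sides are polynomials, so the identity extends to all points.
theorem eval_charpoly_diagonal_add_vecMulVec {ι : Type*} [Fintype ι] [DecidableEq ι]
    (l : ι → ℝ) (v : ι → ℂ) (t : ℝ) :
    (Matrix.diagonal (fun i => (l i : ℂ)) + Matrix.vecMulVec v (star v)).charpoly.eval (t : ℂ) =
      (secular l (fun i => ‖v i‖ ^ 2) t : ℂ) := by
  set A := Matrix.diagonal (fun i => (l i : ℂ)) + Matrix.vecMulVec v (star v) with hA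
  let P : ℂ[X] := ∏ i, (X - C (l i : ℂ)) - ∑ i, C ((‖v i‖ : ℂ) ^ 2) *
    ∏ j ∈ Finset.univ.erase i, (X - C (l j : ℂ))
  have hP : A.charpoly = P := by
    refine eq_of_infinite_eval_eq _ _ ?_
    have hfin : (Set.range fun i => (l i : ℂ))ᶜ.Infinite := (Set.finite_range _).infinite_compl
    refine hfin.mono fun z hz => ?_
    have hz' : ∀ i, z - l i ≠ 0 := fun i h => hz ⟨i, (sub_eq_zero.1 h).symm⟩
    have h1 := det_diagonal_add_vecMulVec (fun i => z - l i) (-v) (star v) hz'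
    change A.charpoly.eval z = P.eval z
    rw [Matrix.eval_charpoly]
    have h2 : Matrix.scalar ι z - A =
        Matrix.diagonal (fun i => z - (l i : ℂ)) + Matrix.vecMulVec (-v) (star v) := by
      rw [hA]
      ext i j
      by_cases hij : i = j
      · subst hij; simp [Matrix.vecMulVec_apply]; ring
      · simp [Matrix.vecMulVec_apply, hij]
    rw [h2, h1]
    simp only [P, eval_sub, eval_prod, eval_X, eval_C, eval_finsetSum, eval_mul]
    rw [sub_eq_add_neg, ← Finset.sum_neg_distrib]
    congr 1
    refine Finset.sum_congr rfl fun i _ => ?_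
    rw [Pi.neg_apply, Pi.star_apply, neg_mul, neg_mul]
    congr 2
    simp [Complex.mul_conj, Complex.normSq_eq_norm_sq]
  rw [hP]
  simp only [P, secular, eval_sub, eval_prod, eval_X, eval_C, eval_finsetSum, eval_mul]
  push_cast
  rfl

theorem isHermitian_diagonal_add_vecMulVec {ι : Type*} [DecidableEq ι]
    (l : ι → ℝ) (v : ι → ℂ) :
    (Matrix.diagonal (fun i => (l i : ℂ)) + Matrix.vecMulVec v (star v)).IsHermitian := by
  refine Matrix.IsHermitian.add ?_ ?_
  · exact Matrix.isHermitian_diagonal_of_self_adjoint _ (by ext i; simp)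
  · ext i j; simp [Matrix.vecMulVec_apply, mul_comm]

/-- The ordered eigenvalues of `diag l + v vᴴ` with `|v i|² = w i`. -/
def secularRoots {m : ℕ} (l w : Fin m → ℝ) : Fin m → ℝ :=
  eigs (Matrix.diagonal (fun i => (l i : ℂ)) +
    Matrix.vecMulVec (fun i => (Real.sqrt (w i) : ℂ)) (star fun i => (Real.sqrt (w i) : ℂ)))

theorem prod_secularRoots {m : ℕ} (l : Fin m → ℝ) {w : Fin m → ℝ} (hw : ∀ i, 0 ≤ w i) (t : ℝ) :
    ∏ i, (t - secularRoots l w i) = secular l w t := by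
  have h1 := eval_charpoly_eq_prod_eigs (isHermitian_diagonal_add_vecMulVec l
    (fun i => (Real.sqrt (w i) : ℂ))) t
  rw [eval_charpoly_diagonal_add_vecMulVec] at h1
  have h2 : (fun i => ‖(Real.sqrt (w i) : ℂ)‖ ^ 2) = w := by
    funext i
    simp [Real.sq_sqrt (hw i)]
  rw [h2] at h1
  exact_mod_cast h1.symm

theorem secularRoots_antitone {m : ℕ} (l w : Fin m → ℝ) : Antitone (secularRoots l w) :=
  eigs_antitone _

theorem secularRoots_eq {m : ℕ} {l w μ : Fin m → ℝ} (hw : ∀ i, 0 ≤ w i) (hμ : Antitone μ)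
    (h : ∀ t, secular l w t = ∏ i, (t - μ i)) : secularRoots l w = μ :=
  antitone_eq_of_prod_eq (secularRoots_antitone l w) hμ Set.infinite_univ fun t _ => by
    rw [prod_secularRoots l hw, h]

theorem measurable_secularRoots {m : ℕ} :
    Measurable fun p : (Fin m → ℝ) × (Fin m → ℝ) => secularRoots p.1 p.2 := by
  refine measurable_eigs (fun i j => ?_) fun _ => isHermitian_diagonal_add_vecMulVec _ _
  simp only [Matrix.add_apply, Matrix.vecMulVec_apply, Matrix.diagonal_apply]
  refine Measurable.add ?_ ?_
  · split_ifs
    · fun_prop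
    · fun_prop
  · simp only [Pi.star_apply, RCLike.star_def, Complex.conj_ofReal]
    fun_prop

attribute [irreducible] secularRoots

/-! ### Secular weights -/

/-- The weights `w` for which `diag l + v vᴴ`, `|v i|² = w i`, has eigenvalues `μ`. -/
def secularWeights {m : ℕ} (l μ : Fin m → ℝ) (i : Fin m) : ℝ :=
  -(∏ j, (l i - μ j)) / ∏ j ∈ Finset.univ.erase i, (l i - l j)

theorem prod_erase_sub_ne_zero {m : ℕ} {l : Fin m → ℝ} (hl : Function.Injective l) (i : Fin m) :
    ∏ j ∈ Finset.univ.erase i, (l i - l j) ≠ 0 :=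
  Finset.prod_ne_zero_iff.2 fun _ hj => sub_ne_zero.2 fun h =>
    (Finset.ne_of_mem_erase hj) (hl h).symm

theorem secular_apply_self {m : ℕ} (l w : Fin m → ℝ) (i : Fin m) :
    secular l w (l i) = -(w i * ∏ j ∈ Finset.univ.erase i, (l i - l j)) := by
  unfold secular
  rw [Finset.prod_eq_zero (Finset.mem_univ i) (sub_self _), Finset.sum_eq_single i, zero_sub]
  · intro k _ hk
    rw [Finset.prod_eq_zero (Finset.mem_erase.2 ⟨hk.symm, Finset.mem_univ i⟩) (sub_self _),
      mul_zero]
  · simp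

theorem secularWeights_of_secular {m : ℕ} {l w μ : Fin m → ℝ} (hl : Function.Injective l)
    (h : ∀ t, secular l w t = ∏ i, (t - μ i)) : secularWeights l μ = w := by
  funext i
  unfold secularWeights
  rw [← h, secular_apply_self, neg_neg, mul_div_assoc, div_self (prod_erase_sub_ne_zero hl i),
    mul_one]

open Polynomial in
-- Lagrange interpolation: the two monic products differ by a polynomial of degree below `m`, and so
-- is the weighted sum; the weights are chosen to make these agree at the `m` distinct nodes `l i`.
theorem secular_secularWeights {m : ℕ} {l : Fin m → ℝ} (hl : Function.Injective l)
    (μ : Fin m → ℝ) (t : ℝ) : secular l (secularWeights l μ) t = ∏ i, (t - μ i) := by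
  let P : ℝ[X] := ∏ i, (X - C (l i)) - ∏ i, (X - C (μ i))
  let Q : ℝ[X] := ∑ i, C (secularWeights l μ i) * ∏ j ∈ Finset.univ.erase i, (X - C (l j))
  have hmon : ∀ y : Fin m → ℝ, (∏ i, (X - C (y i))).Monic := fun y => monic_prod_X_sub_C y _
  have hdeg : ∀ y : Fin m → ℝ, (∏ i, (X - C (y i))).degree = (m : WithBot ℕ) := fun y => by
    rw [degree_prod]; simp
  have hP : P.degree < m := by
    have := degree_sub_lt_left (p := ∏ i, (X - C (l i))) (q := ∏ i, (X - C (μ i)))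
      ((hdeg l).trans (hdeg μ).symm) (hmon l).ne_zero
      ((hmon l).leadingCoeff.trans (hmon μ).leadingCoeff.symm)
    rwa [hdeg] at this
  have hQ : Q.degree < m := by
    refine (degree_sum_le _ _).trans_lt ?_
    refine (Finset.sup_lt_iff (WithBot.bot_lt_coe m)).2 fun i _ => ?_
    refine (degree_mul_le _ _).trans_lt ?_
    refine (add_le_add_left degree_C_le _).trans_lt ?_
    rw [degree_prod, zero_add]
    simp only [degree_X_sub_C, Finset.sum_const, Finset.card_erase_of_mem (Finset.mem_univ i),
      Finset.card_univ, Fintype.card_fin, nsmul_eq_mul, mul_one]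
    have := i.pos
    exact WithBot.coe_lt_coe.2 (Nat.sub_lt this one_pos)
  have hPQ : P = Q := by
    refine eq_of_degrees_lt_of_eval_index_eq (s := Finset.univ) (v := l) hl.injOn ?_ ?_ ?_
    · simpa using hP
    · simpa using hQ
    · intro i _
      have h1 : P.eval (l i) = - ∏ j, (l i - μ j) := by
        simp only [P, eval_sub, eval_prod, eval_X, eval_C]
        rw [Finset.prod_eq_zero (Finset.mem_univ i) (sub_self _), zero_sub]
      have h2 : Q.eval (l i) = -secular l (secularWeights l μ) (l i) := by
        simp only [Q, secular, eval_finsetSum, eval_mul, eval_prod, eval_sub, eval_X, eval_C]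
        rw [Finset.prod_eq_zero (Finset.mem_univ i) (sub_self _), zero_sub, neg_neg]
      rw [h1, h2, secular_apply_self, neg_neg, secularWeights,
        div_mul_cancel₀ _ (prod_erase_sub_ne_zero hl i)]
  have := congrArg (eval t) hPQ
  simp only [P, Q, eval_finsetSum, eval_mul, eval_prod, eval_sub, eval_X, eval_C] at this
  unfold secular
  linarith

/-- The tuples `μ` with `μ 0 > l 0 > μ 1 > l 1 > ⋯`. -/
def interlacing {m : ℕ} (l : Fin m → ℝ) : Set (Fin m → ℝ) :=
  {μ | ∀ i j, (j ≤ i → l i < μ j) ∧ (i < j → μ j < l i)}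

theorem interlacing_strictAnti {m : ℕ} {l μ : Fin m → ℝ} (h : μ ∈ interlacing l) :
    StrictAnti μ := fun i j hij => ((h i j).2 hij).trans ((h i i).1 le_rfl)

/-- In this form the sign can be read off factor by factor: for interlacing tuples every quotient is
positive. -/
theorem secularWeights_eq {m : ℕ} (l μ : Fin m → ℝ) (i : Fin m) :
    secularWeights l μ i =
      (μ i - l i) * ∏ j ∈ Finset.univ.erase i, ((l i - μ j) / (l i - l j)) := by
  unfold secularWeights
  rw [Finset.prod_div_distrib, ← Finset.mul_prod_erase _ _ (Finset.mem_univ i)]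
  ring

theorem secularWeights_pos {m : ℕ} {l μ : Fin m → ℝ} (hl : StrictAnti l)
    (h : μ ∈ interlacing l) (i : Fin m) : 0 < secularWeights l μ i := by
  rw [secularWeights_eq]
  refine mul_pos (sub_pos.2 ((h i i).1 le_rfl)) (Finset.prod_pos fun j hj => ?_)
  rcases lt_or_gt_of_ne (Finset.ne_of_mem_erase hj) with hji | hij
  · exact div_pos_of_neg_of_neg (sub_neg.2 ((h i j).1 hji.le)) (sub_neg.2 (hl hji))
  · exact div_pos (sub_pos.2 ((h i j).2 hij)) (sub_pos.2 (hl hij))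

/-- Both families of inequalities follow from the sign of a weight. If `μ i ≤ l i` for a first index
`i`, all quotients in the weight at `i` are nonnegative while its leading factor is not positive.
Once `l i < μ i` is known throughout, a failure of `μ j < l (j - 1)` at a last index `j` makes
exactly the quotient of index `j` in the weight at `j - 1` nonpositive, the others being
nonnegative. -/
theorem mem_interlacing {m : ℕ} {l μ : Fin m → ℝ} (hl : StrictAnti l) (hμ : Antitone μ)
    (h : ∀ i, 0 < secularWeights l μ i) : μ ∈ interlacing l := by
  have hA : ∀ i, l i < μ i := by
    intro i
    induction i using WellFoundedLT.induction with
    | _ i ih =>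
      by_contra! hc
      refine absurd (h i) (not_lt.2 ?_)
      rw [secularWeights_eq]
      refine mul_nonpos_of_nonpos_of_nonneg (sub_nonpos.2 hc) (Finset.prod_nonneg fun j hj => ?_)
      rcases lt_or_gt_of_ne (Finset.ne_of_mem_erase hj) with hji | hij
      · exact div_nonneg_of_nonpos (sub_nonpos.2 ((hl hji).trans (ih j hji)).le)
          (sub_nonpos.2 (hl hji).le)
      · exact div_nonneg (sub_nonneg.2 ((hμ hij.le).trans hc)) (sub_nonneg.2 (hl hij).le)
  have hA' : ∀ i j, j ≤ i → l i < μ j := fun i j hji => (hA i).trans_le (hμ hji)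
  have hB : ∀ j i, i < j → μ j < l i := by
    intro j
    induction j using WellFoundedGT.induction with
    | _ j ih =>
      intro i' hi'
      obtain ⟨k, hk⟩ : ∃ k : ℕ, j.val = k + 1 := ⟨j.val - 1, by have := Fin.lt_def.1 hi'; omega⟩
      -- Since `l` decreases, it suffices to treat the immediate predecessor of `j`.
      let i : Fin m := ⟨k, by omega⟩
      have hij : i < j := Fin.lt_def.2 (by simp [i]; omega)
      have hi'i : i' ≤ i := Fin.le_def.2 (by simp [i]; have := Fin.lt_def.1 hi'; omega)
      refine lt_of_lt_of_le ?_ (hl.antitone hi'i)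
      by_contra! hc
      refine absurd (h i) (not_lt.2 ?_)
      rw [secularWeights_eq]
      refine mul_nonpos_of_nonneg_of_nonpos (sub_nonneg.2 (hA i).le) ?_
      rw [← Finset.mul_prod_erase _ _ (Finset.mem_erase.2 ⟨hij.ne', Finset.mem_univ j⟩)]
      refine mul_nonpos_of_nonpos_of_nonneg
        (div_nonpos_of_nonpos_of_nonneg (sub_nonpos.2 hc) (sub_nonneg.2 (hl hij).le))
        (Finset.prod_nonneg fun q hq => ?_)
      have hqj := Finset.ne_of_mem_erase hq
      rcases lt_or_gt_of_ne (Finset.ne_of_mem_erase (Finset.mem_of_mem_erase hq)) with hqi | hiq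
      · exact div_nonneg_of_nonpos (sub_nonpos.2 (hA' i q hqi.le).le) (sub_nonpos.2 (hl hqi).le)
      · have hjq : j < q := lt_of_le_of_ne (Fin.le_def.2 (by
          have := Fin.lt_def.1 hiq; simp [i] at this; omega)) hqj.symm
        exact div_nonneg (sub_nonneg.2 (ih q hjq i hiq).le) (sub_nonneg.2 (hl hiq).le)
  exact fun i j => ⟨hA' i j, hB j i⟩

/-- A preimage of a positive `w` is the tuple of ordered eigenvalues of the perturbed matrix; its
weights are `w` again, and their positivity forces interlacing. -/
theorem image_secularWeights {m : ℕ} {l : Fin m → ℝ} (hl : StrictAnti l) :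
    secularWeights l '' interlacing l = {w | ∀ i, 0 < w i} := by
  ext w
  constructor
  · rintro ⟨μ, hμ, rfl⟩ i
    exact secularWeights_pos hl hμ i
  · intro hw
    have h1 : secularWeights l (secularRoots l w) = w :=
      secularWeights_of_secular hl.injective fun t =>
        (prod_secularRoots l (fun i => (hw i).le) t).symm
    refine ⟨secularRoots l w, mem_interlacing hl (secularRoots_antitone l w) ?_, h1⟩
    rw [h1]; exact hw

theorem secularRoots_secularWeights {m : ℕ} {l μ : Fin m → ℝ} (hl : StrictAnti l)
    (hμ : μ ∈ interlacing l) : secularRoots l (secularWeights l μ) = μ :=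
  secularRoots_eq (fun i => (secularWeights_pos hl hμ i).le)
    (interlacing_strictAnti hμ).antitone (secular_secularWeights hl.injective μ)

theorem injOn_secularWeights {m : ℕ} {l : Fin m → ℝ} (hl : StrictAnti l) :
    Set.InjOn (secularWeights l) (interlacing l) := fun x hx y hy hxy => by
  rw [← secularRoots_secularWeights hl hx, hxy, secularRoots_secularWeights hl hy]

/-! ### The Jacobian of the secular weights -/

/-- The modulus of the Vandermonde determinant. -/
def absVdm {m : ℕ} (x : Fin m → ℝ) : ℝ := |(Matrix.vandermonde x).det|

theorem absVdm_eq {m : ℕ} (x : Fin m → ℝ) :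
    absVdm x = ∏ i, ∏ j ∈ Finset.Iio i, |x i - x j| := by
  unfold absVdm
  rw [Matrix.det_vandermonde, Finset.abs_prod]
  simp only [Finset.abs_prod]
  exact Finset.prod_comm' (by simp)

/-- Every unordered pair of indices occurs twice on the left, once from each end. -/
theorem prod_erase_eq_absVdm_sq {m : ℕ} (x : Fin m → ℝ) :
    ∏ i, |∏ j ∈ Finset.univ.erase i, (x i - x j)| = absVdm x ^ 2 := by
  have h : ∀ i, |∏ j ∈ Finset.univ.erase i, (x i - x j)| =
      (∏ j ∈ Finset.Iio i, |x i - x j|) * ∏ j ∈ Finset.Ioi i, |x j - x i| := by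
    intro i
    rw [Finset.abs_prod, ← Finset.prod_congr rfl fun j _ => abs_sub_comm (x i) (x j),
      ← Finset.prod_union]
    · refine Finset.prod_congr ?_ fun _ _ => rfl
      ext j
      simp only [Finset.mem_erase, Finset.mem_univ, and_true, Finset.mem_union, Finset.mem_Iio,
        Finset.mem_Ioi]
      exact ne_iff_lt_or_gt
    · refine Finset.disjoint_left.2 fun j h1 h2 => ?_
      exact lt_asymm (Finset.mem_Iio.1 h1) (Finset.mem_Ioi.1 h2)
  rw [Finset.prod_congr rfl fun i _ => h i, Finset.prod_mul_distrib, sq]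
  conv_lhs => rw [← absVdm_eq]
  congr 1
  rw [absVdm_eq]
  exact Finset.prod_comm' (by simp)

theorem absVdm_pos {m : ℕ} {x : Fin m → ℝ} (hx : Function.Injective x) : 0 < absVdm x :=
  abs_pos.2 (Matrix.det_vandermonde_ne_zero_iff.2 hx)

open Polynomial in
/-- A polynomial form of Cauchy's determinant. -/
theorem abs_det_prod_erase {m : ℕ} (l : Fin m → ℝ) {μ : Fin m → ℝ} (hμ : Function.Injective μ) :
    |(Matrix.of fun i j => ∏ k ∈ Finset.univ.erase j, (l i - μ k)).det| = absVdm l * absVdm μ := by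
  let P : Fin m → ℝ[X] := fun j => ∏ k ∈ Finset.univ.erase j, (X - C (μ k))
  -- The matrix factors as the Vandermonde matrix of `l` times the coefficient matrix `K`, which
  -- does not involve `l`. Putting `l = μ` makes the product diagonal, and this determines `|K.det|`
  -- as `absVdm μ`.
  let K : Matrix (Fin m) (Fin m) ℝ := Matrix.of fun k j => (P j).coeff k
  have hdeg : ∀ j, (P j).natDegree < m := by
    intro j
    simp only [P]
    rw [natDegree_prod_of_monic _ _ fun k _ => monic_X_sub_C _]
    simp only [natDegree_X_sub_C, Finset.sum_const, Finset.card_erase_of_mem (Finset.mem_univ j),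
      Finset.card_univ, Fintype.card_fin, smul_eq_mul, mul_one]
    have := j.pos
    omega
  have hV : ∀ x : Fin m → ℝ, Matrix.vandermonde x * K =
      Matrix.of fun i j => ∏ k ∈ Finset.univ.erase j, (x i - μ k) := by
    intro x
    ext i j
    have h1 : (P j).eval (x i) = ∏ k ∈ Finset.univ.erase j, (x i - μ k) := by
      simp [P, eval_prod]
    rw [Matrix.of_apply, ← h1, eval_eq_sum_range' (hdeg j), Matrix.mul_apply, Finset.sum_range]
    refine Finset.sum_congr rfl fun k _ => ?_
    simp [K, Matrix.vandermonde_apply, mul_comm]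
  have hdiag : (Matrix.of fun i j => ∏ k ∈ Finset.univ.erase j, (μ i - μ k)) =
      Matrix.diagonal fun i => ∏ k ∈ Finset.univ.erase i, (μ i - μ k) := by
    ext i j
    by_cases hij : i = j
    · subst hij; simp
    · rw [Matrix.diagonal_apply_ne _ hij, Matrix.of_apply]
      exact Finset.prod_eq_zero (Finset.mem_erase.2 ⟨hij, Finset.mem_univ i⟩) (sub_self _)
  have h1 := congrArg (fun A => |Matrix.det A|) (hV μ)
  have h2 := congrArg (fun A => |Matrix.det A|) (hV l)
  simp only [Matrix.det_mul, abs_mul, hdiag, Matrix.det_diagonal, Finset.abs_prod] at h1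
  simp only [Matrix.det_mul, abs_mul] at h2
  rw [← h2]
  have h3 := prod_erase_eq_absVdm_sq μ
  simp only [Finset.abs_prod] at h3
  rw [h3, sq] at h1
  have h4 := absVdm_pos hμ
  change absVdm μ * |K.det| = _ at h1
  rw [mul_left_cancel₀ h4.ne' h1]
  rfl

/-- The Jacobian matrix of `secularWeights l` at `μ`. -/
def secularJacobian {m : ℕ} (l μ : Fin m → ℝ) : Matrix (Fin m) (Fin m) ℝ :=
  Matrix.of fun i j => (∏ k ∈ Finset.univ.erase i, (l i - l k))⁻¹ *
    ∏ k ∈ Finset.univ.erase j, (l i - μ k)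

theorem hasFDerivAt_secularWeights {m : ℕ} (l μ : Fin m → ℝ) :
    HasFDerivAt (secularWeights l) (Matrix.toLin' (secularJacobian l μ)).toContinuousLinearMap μ := by
  rw [hasFDerivAt_pi']
  intro i
  have h1 : HasFDerivAt (fun μ : Fin m → ℝ => ∏ j, (l i - μ j))
      (∑ j, (∏ k ∈ Finset.univ.erase j, (l i - μ k)) •
        (-(ContinuousLinearMap.proj j : (Fin m → ℝ) →L[ℝ] ℝ))) μ :=
    HasFDerivAt.finsetProd fun j _ =>
      ((ContinuousLinearMap.proj j : (Fin m → ℝ) →L[ℝ] ℝ).hasFDerivAt.const_sub (l i))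
  have h2 := h1.neg.mul_const (∏ k ∈ Finset.univ.erase i, (l i - l k))⁻¹
  refine (h2.congr_fderiv ?_).congr_of_eventuallyEq (Filter.Eventually.of_forall fun x => ?_)
  · ext v
    simp [secularJacobian, Matrix.mulVec, dotProduct, Finset.mul_sum, mul_assoc]
  · simp [secularWeights, div_eq_mul_inv]

/-- The diagonal factor contributes `absVdm l` to the power `-2`, and the Cauchy-type determinant
contributes `absVdm l * absVdm μ`. -/
theorem abs_det_secularJacobian {m : ℕ} {l μ : Fin m → ℝ} (hl : Function.Injective l)
    (hμ : Function.Injective μ) : |(secularJacobian l μ).det| = absVdm μ / absVdm l := by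
  have h : secularJacobian l μ =
      Matrix.diagonal (fun i => (∏ k ∈ Finset.univ.erase i, (l i - l k))⁻¹) *
        Matrix.of fun i j => ∏ k ∈ Finset.univ.erase j, (l i - μ k) := by
    ext i j
    simp [secularJacobian, Matrix.diagonal_mul]
  rw [h, Matrix.det_mul, abs_mul, abs_det_prod_erase l hμ, Matrix.det_diagonal, Finset.abs_prod]
  simp only [abs_inv]
  rw [Finset.prod_inv_distrib, prod_erase_eq_absVdm_sq]
  have := (absVdm_pos hl).ne'
  field_simp

theorem measurableSet_interlacing {m : ℕ} (l : Fin m → ℝ) : MeasurableSet (interlacing l) := by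
  unfold interlacing
  simp only [Set.ofPred_forall]
  refine MeasurableSet.iInter fun i => MeasurableSet.iInter fun j => ?_
  refine MeasurableSet.inter ?_ ?_
  · exact MeasurableSet.imp (MeasurableSet.const _)
      (measurableSet_lt measurable_const (measurable_pi_apply j))
  · exact MeasurableSet.imp (MeasurableSet.const _)
      (measurableSet_lt (measurable_pi_apply j) measurable_const)

/-- Change of variables from the weights to the roots of the secular equation. -/
theorem lintegral_secularRoots {m : ℕ} {l : Fin m → ℝ} (hl : StrictAnti l)
    (f g : (Fin m → ℝ) → ℝ≥0∞) :
    ∫⁻ w in {w | ∀ i, 0 < w i}, f (secularRoots l w) * g w =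
      ∫⁻ μ in interlacing l, f μ * (ENNReal.ofReal (absVdm μ / absVdm l) *
        g (secularWeights l μ)) := by
  rw [← image_secularWeights hl, lintegral_image_eq_lintegral_abs_det_fderiv_mul volume
    (measurableSet_interlacing l)
    (fun μ _ => (hasFDerivAt_secularWeights l μ).hasFDerivWithinAt) (injOn_secularWeights hl)]
  refine setLIntegral_congr_fun (measurableSet_interlacing l) fun μ hμ => ?_
  beta_reduce
  rw [secularRoots_secularWeights hl hμ, ← abs_det_secularJacobian hl.injective
    (interlacing_strictAnti hμ).injective]
  have : (LinearMap.toContinuousLinearMap (Matrix.toLin' (secularJacobian l μ))).det =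
      (secularJacobian l μ).det := LinearMap.det_toLin' _
  rw [this]
  ring

/-! ### The integral of a Vandermonde determinant over an interlacing box -/

/-- The tuples `x` with `μ 0 > x 0 > μ 1 > ⋯ > x (k - 1) > μ k`. -/
def gapBox {k : ℕ} (μ : Fin (k + 1) → ℝ) : Set (Fin k → ℝ) :=
  Set.univ.pi fun i => Set.Ioo (μ i.succ) (μ i.castSucc)

theorem measurableSet_gapBox {k : ℕ} (μ : Fin (k + 1) → ℝ) : MeasurableSet (gapBox μ) :=
  MeasurableSet.univ_pi fun _ => measurableSet_Ioo

theorem strictAnti_of_mem_gapBox {k : ℕ} {μ : Fin (k + 1) → ℝ} (hμ : StrictAnti μ)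
    {x : Fin k → ℝ} (hx : x ∈ gapBox μ) : StrictAnti x := by
  intro i j hij
  have h1 := (hx i (Set.mem_univ i)).1
  have h2 := (hx j (Set.mem_univ j)).2
  have h3 : μ j.castSucc ≤ μ i.succ := hμ.antitone (Fin.le_def.2 (by
    have := Fin.lt_def.1 hij; simp; omega))
  linarith

/-- On decreasing tuples the sign of the Vandermonde determinant is constant, so the modulus can be
moved outside an integral over such tuples. -/
theorem absVdm_eq_det_of_strictAnti {k : ℕ} {x : Fin k → ℝ} (hx : StrictAnti x) :
    absVdm x = (∏ i : Fin k, ∏ _j ∈ Finset.Ioi i, (-1 : ℝ)) * (Matrix.vandermonde x).det := by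
  unfold absVdm
  rw [Matrix.det_vandermonde, Finset.abs_prod, ← Finset.prod_mul_distrib]
  refine Finset.prod_congr rfl fun i _ => ?_
  rw [Finset.abs_prod, ← Finset.prod_mul_distrib]
  refine Finset.prod_congr rfl fun j hj => ?_
  rw [abs_of_neg (sub_neg.2 (hx (Finset.mem_Ioi.1 hj)))]
  ring

theorem abs_prod_prod_neg_one (k : ℕ) : |∏ i : Fin k, ∏ _j ∈ Finset.Ioi i, (-1 : ℝ)| = 1 := by
  simp [Finset.abs_prod]

/-- Subtracting from each row of the Vandermonde matrix its predecessor turns the first column into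
`(1, 0, …, 0)`; expansion along that column leaves the matrix of differences up to sign. -/
theorem abs_det_differences {k : ℕ} (μ : Fin (k + 1) → ℝ) :
    |(Matrix.of fun i j : Fin k =>
      μ i.castSucc ^ (j.val + 1) - μ i.succ ^ (j.val + 1)).det| = absVdm μ := by
  let B : Matrix (Fin (k + 1)) (Fin (k + 1)) ℝ := Matrix.of fun i j =>
    Fin.cases (μ 0 ^ j.val) (fun i' => μ i'.succ ^ j.val - μ i'.castSucc ^ j.val) i
  have h1 : (Matrix.vandermonde μ).det = B.det := by
    refine Matrix.det_eq_of_forall_row_eq_smul_add_pred (fun _ => 1) (fun j => ?_) fun i j => ?_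
    · simp [B]
    · simp [B]
  have h2 : B.det = (-1) ^ k * (Matrix.of fun i j : Fin k =>
      μ i.castSucc ^ (j.val + 1) - μ i.succ ^ (j.val + 1)).det := by
    rw [Matrix.det_succ_column_zero, Finset.sum_eq_single 0]
    · have : B.submatrix (Fin.succAbove 0) Fin.succ = -(Matrix.of fun i j : Fin k =>
          μ i.castSucc ^ (j.val + 1) - μ i.succ ^ (j.val + 1)) := by
        ext i j
        simp [B]
      rw [this, Matrix.det_neg]
      simp [B]
    · intro i _ hi
      obtain ⟨i', rfl⟩ := Fin.exists_succ_eq.2 hi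
      simp [B]
    · simp
  unfold absVdm
  rw [h1, h2, abs_mul, abs_pow, abs_neg, abs_one, one_pow, one_mul]

/-- Row `i` of the Vandermonde matrix involves only `x i`, and the region is a box, so the integral
can be taken entry by entry inside the determinant: expand over permutations, integrate each
product, and recombine. The factors `(j + 1)⁻¹` come from integrating `t ^ j`. -/
theorem integral_gapBox_vandermonde {k : ℕ} {μ : Fin (k + 1) → ℝ} (hμ : StrictAnti μ) :
    Integrable (fun x : Fin k → ℝ => (Matrix.vandermonde x).det)
        ((volume : Measure (Fin k → ℝ)).restrict (gapBox μ)) ∧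
      ∫ x in gapBox μ, (Matrix.vandermonde x).det =
        (∏ j : Fin k, ((j : ℝ) + 1)⁻¹) * (Matrix.of fun i j : Fin k =>
          μ i.castSucc ^ (j.val + 1) - μ i.succ ^ (j.val + 1)).det := by
  have hexp : (fun x : Fin k → ℝ => (Matrix.vandermonde x).det) = fun x =>
      ∑ σ : Equiv.Perm (Fin k), ((Equiv.Perm.sign σ : ℤ) : ℝ) * ∏ i, x i ^ (σ i).val := by
    funext x
    rw [← Matrix.det_transpose, Matrix.det_apply']
    rfl
  have hres : (volume : Measure (Fin k → ℝ)).restrict (gapBox μ) =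
      Measure.pi fun i => (volume : Measure ℝ).restrict (Set.Ioo (μ i.succ) (μ i.castSucc)) := by
    rw [volume_pi]
    exact Measure.restrict_pi_pi _ _
  have hle : ∀ i : Fin k, μ i.succ ≤ μ i.castSucc := fun i =>
    (hμ (Fin.castSucc_lt_succ (i := i))).le
  have hint1 : ∀ (i : Fin k) (p : ℕ), Integrable (fun t : ℝ => t ^ p)
      ((volume : Measure ℝ).restrict (Set.Ioo (μ i.succ) (μ i.castSucc))) := by
    intro i p
    exact ((continuous_pow p).integrableOn_Icc (a := μ i.succ) (b := μ i.castSucc)).mono_set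
      Set.Ioo_subset_Icc_self
  have hval : ∀ (i j : Fin k), ∫ t in Set.Ioo (μ i.succ) (μ i.castSucc), t ^ j.val =
      ((j : ℝ) + 1)⁻¹ * (μ i.castSucc ^ (j.val + 1) - μ i.succ ^ (j.val + 1)) := by
    intro i j
    rw [← integral_Ioc_eq_integral_Ioo, ← intervalIntegral.integral_of_le (hle i), integral_pow]
    rw [div_eq_inv_mul]
  have hint2 : ∀ σ : Equiv.Perm (Fin k), Integrable (fun x : Fin k → ℝ =>
      ((Equiv.Perm.sign σ : ℤ) : ℝ) * ∏ i, x i ^ (σ i).val)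
      ((volume : Measure (Fin k → ℝ)).restrict (gapBox μ)) := by
    intro σ
    rw [hres]
    exact (Integrable.fintype_prod (f := fun i (t : ℝ) => t ^ (σ i).val)
      fun i => hint1 i _).const_mul _
  constructor
  · rw [hexp]
    exact integrable_finsetSum _ fun σ _ => hint2 σ
  · rw [hexp, integral_finsetSum _ fun σ _ => hint2 σ, ← Matrix.det_mul_row,
      ← Matrix.det_transpose, Matrix.det_apply']
    refine Finset.sum_congr rfl fun σ _ => ?_
    rw [integral_const_mul, hres,
      integral_fintype_prod_eq_prod (𝕜 := ℝ) (fun i (t : ℝ) => t ^ (σ i).val)]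
    congr 1
    refine Finset.prod_congr rfl fun i _ => ?_
    rw [hval]
    rfl

/-- The point is that `c` does not depend on `μ`; its value is never needed. -/
theorem lintegral_gapBox_absVdm (k : ℕ) : ∃ c : ℝ≥0∞, ∀ μ : Fin (k + 1) → ℝ, StrictAnti μ →
    ∫⁻ x in gapBox μ, ENNReal.ofReal (absVdm x) = c * ENNReal.ofReal (absVdm μ) := by
  refine ⟨ENNReal.ofReal (∏ j : Fin k, ((j : ℝ) + 1)⁻¹), fun μ hμ => ?_⟩
  obtain ⟨hint, hval⟩ := integral_gapBox_vandermonde hμ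
  have hnn : 0 ≤ ∏ j : Fin k, ((j : ℝ) + 1)⁻¹ := Finset.prod_nonneg fun j _ => by positivity
  have h2 : ∫ x in gapBox μ, absVdm x =
      (∏ i : Fin k, ∏ _j ∈ Finset.Ioi i, (-1 : ℝ)) * ∫ x in gapBox μ, (Matrix.vandermonde x).det := by
    rw [← integral_const_mul]
    exact setIntegral_congr_fun (measurableSet_gapBox μ) fun x hx =>
      absVdm_eq_det_of_strictAnti (strictAnti_of_mem_gapBox hμ hx)
  have h3 : ∫ x in gapBox μ, absVdm x = (∏ j : Fin k, ((j : ℝ) + 1)⁻¹) * absVdm μ := by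
    rw [← abs_of_nonneg (integral_nonneg fun x => abs_nonneg _ :
      0 ≤ ∫ x in gapBox μ, absVdm x), h2, abs_mul, abs_prod_prod_neg_one, one_mul, hval, abs_mul,
      abs_det_differences, abs_of_nonneg hnn]
  rw [← ofReal_integral_eq_lintegral_ofReal (f := absVdm) hint.abs
    (Filter.Eventually.of_forall fun x => abs_nonneg _), h3, ENNReal.ofReal_mul hnn]

/-! ### The recursion between Laguerre-type densities -/

theorem sum_eigs {n : ℕ} {A : Matrix (Fin n) (Fin n) ℂ} (hA : A.IsHermitian) :
    ((∑ i, eigs A i : ℝ) : ℂ) = A.trace := by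
  rw [hA.trace_eq_sum_eigenvalues]
  push_cast
  have : eigs A = fun i => hA.eigenvalues₀ (Fin.cast (Fintype.card_fin n).symm i) := by
    unfold eigs; rw [dif_pos hA]
  rw [this]
  let e : Fin n ≃ Fin n := ((finCongr (Fintype.card_fin n).symm).trans
    (Fintype.equivOfCardEq (Fintype.card_fin _)))
  refine Eq.trans ?_ (Equiv.sum_comp e (fun i => (hA.eigenvalues i : ℂ)))
  refine Finset.sum_congr rfl fun i _ => ?_
  simp [Matrix.IsHermitian.eigenvalues, e]

theorem sum_secularRoots {m : ℕ} (l : Fin m → ℝ) {w : Fin m → ℝ} (hw : ∀ i, 0 ≤ w i) :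
    ∑ i, secularRoots l w i = ∑ i, l i + ∑ i, w i := by
  have h := sum_eigs (isHermitian_diagonal_add_vecMulVec l (fun i => (Real.sqrt (w i) : ℂ)))
  rw [Matrix.trace_add, Matrix.trace_diagonal, Matrix.trace_vecMulVec] at h
  have h2 : (fun i => (Real.sqrt (w i) : ℂ)) ⬝ᵥ (star fun i => (Real.sqrt (w i) : ℂ)) =
      ((∑ i, w i : ℝ) : ℂ) := by
    push_cast
    refine Finset.sum_congr rfl fun i _ => ?_
    simp only [Pi.star_apply, RCLike.star_def, Complex.conj_ofReal]
    exact_mod_cast Real.mul_self_sqrt (hw i)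
  rw [h2] at h
  unfold secularRoots
  exact_mod_cast h

/-- The trace of the perturbed matrix. It is what lets the exponential factors of old eigenvalues
and weights combine into those of the new eigenvalues. -/
theorem sum_secularWeights {m : ℕ} {l μ : Fin m → ℝ} (hl : StrictAnti l)
    (hμ : μ ∈ interlacing l) : ∑ i, secularWeights l μ i = ∑ i, μ i - ∑ i, l i := by
  have := sum_secularRoots l (fun i => (secularWeights_pos hl hμ i).le)
  rw [secularRoots_secularWeights hl hμ] at this
  linarith

/-- The open Weyl chamber `x 0 > x 1 > ⋯ > 0`. -/
def chamber (k : ℕ) : Set (Fin k → ℝ) := {x | StrictAnti x ∧ ∀ i, 0 < x i}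

/-- The unnormalised density `∏ e^(-x i) (x i)^e · Δ(x)²`. -/
def laguerre (k e : ℕ) (x : Fin k → ℝ) : ℝ :=
  (∏ i, Real.exp (-x i)) * (∏ i, x i) ^ e * absVdm x ^ 2

/-- Appending a zero. -/
def snocZero {k : ℕ} (x : Fin k → ℝ) : Fin (k + 1) → ℝ := Fin.snoc (α := fun _ => ℝ) x 0

@[simp] theorem snocZero_castSucc {k : ℕ} (x : Fin k → ℝ) (i : Fin k) :
    snocZero x i.castSucc = x i := by simp [snocZero]

@[simp] theorem snocZero_last {k : ℕ} (x : Fin k → ℝ) : snocZero x (Fin.last k) = 0 := by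
  simp [snocZero]

theorem measurable_snocZero {k : ℕ} : Measurable (snocZero (k := k)) := by
  refine measurable_pi_lambda _ fun i => ?_
  induction i using Fin.lastCases with
  | last => simp
  | cast i => simpa using measurable_pi_apply i

theorem snocZero_strictAnti {k : ℕ} {x : Fin k → ℝ} (hx : x ∈ chamber k) :
    StrictAnti (snocZero x) := by
  intro i j hij
  induction j using Fin.lastCases with
  | last =>
    induction i using Fin.lastCases with
    | last => exact absurd hij (lt_irrefl _)
    | cast i => simpa using hx.2 i
  | cast j =>
    induction i using Fin.lastCases with
    | last => exact absurd hij (not_lt.2 (Fin.le_last _))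
    | cast i => simpa using hx.1 (Fin.castSucc_lt_castSucc_iff.1 hij)

theorem absVdm_snocZero {k : ℕ} {x : Fin k → ℝ} (hx : x ∈ chamber k) :
    absVdm (snocZero x) = absVdm x * ∏ i, x i := by
  rw [absVdm_eq, absVdm_eq, Fin.prod_univ_castSucc]
  congr 1
  · refine Finset.prod_congr rfl fun i _ => ?_
    have : Finset.Iio i.castSucc = (Finset.Iio i).map Fin.castSuccEmb := by
      ext j
      simp only [Finset.mem_Iio, Finset.mem_map, Fin.coe_castSuccEmb]
      constructor
      · intro hj
        exact ⟨j.castLT (by have := Fin.lt_def.1 hj; simp at this; omega),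
          Fin.lt_def.2 (by simpa using Fin.lt_def.1 hj), by simp⟩
      · rintro ⟨a, ha, rfl⟩
        exact Fin.castSucc_lt_castSucc_iff.2 ha
    rw [this, Finset.prod_map]
    simp
  · have : Finset.Iio (Fin.last k) = Finset.univ.map Fin.castSuccEmb := by
      ext j
      simp only [Finset.mem_Iio, Finset.mem_map, Finset.mem_univ, true_and, Fin.coe_castSuccEmb]
      constructor
      · intro hj
        exact ⟨j.castLT (Fin.lt_def.1 hj), by simp⟩
      · rintro ⟨a, rfl⟩
        exact Fin.castSucc_lt_last a
    rw [this, Finset.prod_map]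
    refine Finset.prod_congr rfl fun i _ => ?_
    simp [abs_of_pos (hx.2 i)]

/-- At the node `0` numerator and denominator are plain products up to sign, and the signs `(-1) ^
(k + 1)` and `(-1) ^ k` cancel against the minus sign in the weight. -/
theorem secularWeights_snocZero_last {k : ℕ} {x : Fin k → ℝ} (hx : x ∈ chamber k)
    (μ : Fin (k + 1) → ℝ) :
    secularWeights (snocZero x) μ (Fin.last k) = (∏ j, μ j) / ∏ i, x i := by
  have hu : Finset.univ.erase (Fin.last k) = Finset.univ.map Fin.castSuccEmb := by
    ext j
    simp only [Finset.mem_erase, Finset.mem_map, Finset.mem_univ, true_and, and_true,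
      Fin.coe_castSuccEmb]
    exact Fin.exists_castSucc_eq.symm
  have h0 : ∏ i, x i ≠ 0 := Finset.prod_ne_zero_iff.2 fun i _ => (hx.2 i).ne'
  have h1 : ((-1 : ℝ) ^ k) ≠ 0 := pow_ne_zero _ (by norm_num)
  unfold secularWeights
  rw [hu, Finset.prod_map]
  simp only [snocZero_last, zero_sub, Fin.coe_castSuccEmb, snocZero_castSucc, Finset.prod_neg]
  simp only [Finset.card_univ, Fintype.card_fin]
  rw [pow_succ]
  field_simp

/-- The same set of pairs, fibred once over the old eigenvalues `x` and once over the new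
eigenvalues `μ`. It supplies the regions of integration before and after the exchange of integrals.
-/
theorem interlacing_snocZero_iff {k : ℕ} (x : Fin k → ℝ) (μ : Fin (k + 1) → ℝ) :
    (x ∈ chamber k ∧ μ ∈ interlacing (snocZero x)) ↔ (μ ∈ chamber (k + 1) ∧ x ∈ gapBox μ) := by
  constructor
  · rintro ⟨hx, hμ⟩
    refine ⟨⟨interlacing_strictAnti hμ, fun i => ?_⟩, fun i _ => ⟨?_, ?_⟩⟩
    · simpa using (hμ (Fin.last k) i).1 (Fin.le_last i)
    · simpa using (hμ i.castSucc i.succ).2 Fin.castSucc_lt_succ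
    · simpa using (hμ i.castSucc i.castSucc).1 le_rfl
  · rintro ⟨hμ, hx⟩
    have hpos : ∀ i, 0 < x i := fun i => (hμ.2 i.succ).trans (hx i (Set.mem_univ i)).1
    refine ⟨⟨strictAnti_of_mem_gapBox hμ.1 hx, hpos⟩, fun i j => ⟨fun hji => ?_, fun hij => ?_⟩⟩
    · induction i using Fin.lastCases with
      | last => simpa using hμ.2 j
      | cast i =>
        rw [snocZero_castSucc]
        exact (hx i (Set.mem_univ i)).2.trans_le (hμ.1.antitone hji)
    · induction i using Fin.lastCases with
      | last => exact absurd hij (not_lt.2 (Fin.le_last _))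
      | cast i =>
        rw [snocZero_castSucc]
        refine lt_of_le_of_lt (hμ.1.antitone ?_) (hx i (Set.mem_univ i)).1
        exact Fin.castSucc_lt_iff_succ_le.1 hij

theorem measurableSet_chamber (k : ℕ) : MeasurableSet (chamber k) := by
  have : chamber k = (⋂ i, ⋂ j, {x : Fin k → ℝ | i < j → x j < x i}) ∩ ⋂ i, {x | 0 < x i} := by
    ext x
    simp [chamber, StrictAnti]
  rw [this]
  refine MeasurableSet.inter ?_ ?_
  · exact MeasurableSet.iInter fun i => MeasurableSet.iInter fun j =>
      MeasurableSet.imp (MeasurableSet.const _)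
        (measurableSet_lt (measurable_pi_apply j) (measurable_pi_apply i))
  · exact MeasurableSet.iInter fun i => measurableSet_lt measurable_const (measurable_pi_apply i)

/-- Pairs of interlacing tuples. -/
def interlacingPairs (k : ℕ) : Set ((Fin k → ℝ) × (Fin (k + 1) → ℝ)) :=
  {p | p.2 ∈ chamber (k + 1) ∧ p.1 ∈ gapBox p.2}

theorem measurableSet_interlacingPairs (k : ℕ) : MeasurableSet (interlacingPairs k) := by
  have : interlacingPairs k = Prod.snd ⁻¹' chamber (k + 1) ∩
      ⋂ i : Fin k, ({p : (Fin k → ℝ) × (Fin (k + 1) → ℝ) | p.2 i.succ < p.1 i} ∩ {p | p.1 i < p.2 i.castSucc}) := by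
    ext p
    simp [interlacingPairs, gapBox]
  rw [this]
  refine MeasurableSet.inter (measurable_snd (measurableSet_chamber _)) ?_
  refine MeasurableSet.iInter fun i => MeasurableSet.inter ?_ ?_
  · exact measurableSet_lt (by fun_prop) (by fun_prop)
  · exact measurableSet_lt (by fun_prop) (by fun_prop)

@[fun_prop]
theorem continuous_absVdm {k : ℕ} : Continuous (absVdm (m := k)) := by
  have : (absVdm (m := k)) = fun x => ∏ i, ∏ j ∈ Finset.Iio i, |x i - x j| := by
    funext x; exact absVdm_eq x
  rw [this]
  fun_prop

@[fun_prop]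
theorem continuous_laguerre {k e : ℕ} : Continuous (laguerre k e) := by
  unfold laguerre
  fun_prop

/-- The exponent `D + 1` of `∏ x i` disappears completely: one power cancels against the Vandermonde
factor of the tuple extended by zero, and `D` powers against the last weight `∏ μ / ∏ x`. One factor
`absVdm x` survives and is later integrated out. -/
theorem laguerre_mul_jacobian {k D : ℕ} {x : Fin k → ℝ} {μ : Fin (k + 1) → ℝ}
    (hx : x ∈ chamber k) (hμ : μ ∈ interlacing (snocZero x)) :
    laguerre k (D + 1) x * (absVdm μ / absVdm (snocZero x) *
      ((∏ i, Real.exp (-secularWeights (snocZero x) μ i)) *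
        secularWeights (snocZero x) μ (Fin.last k) ^ D)) =
      (∏ i, Real.exp (-μ i)) * (∏ i, μ i) ^ D * absVdm μ * absVdm x := by
  have h1 : (∏ i, Real.exp (-x i)) * (∏ i, Real.exp (-secularWeights (snocZero x) μ i)) =
      ∏ i, Real.exp (-μ i) := by
    rw [← Real.exp_sum, ← Real.exp_sum, ← Real.exp_sum, ← Real.exp_add]
    congr 1
    simp only [Finset.sum_neg_distrib]
    rw [sum_secularWeights (snocZero_strictAnti hx) hμ, Fin.sum_univ_castSucc (snocZero x)]
    simp only [snocZero_castSucc, snocZero_last]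
    ring
  rw [← h1, absVdm_snocZero hx, secularWeights_snocZero_last hx, laguerre]
  have h2 : ∏ i, x i ≠ 0 := Finset.prod_ne_zero_iff.2 fun i _ => (hx.2 i).ne'
  have h3 : absVdm x ≠ 0 := (absVdm_pos hx.1.injective).ne'
  rw [div_pow]
  field_simp
  ring

/-- Adding one rank-one term turns the density with exponent `D + 1` on `k` eigenvalues into the
density with exponent `D` on `k + 1` eigenvalues. -/
theorem lintegral_laguerre_succ (k D : ℕ) : ∃ c : ℝ≥0∞, ∀ F : (Fin (k + 1) → ℝ) → ℝ≥0∞,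
    Measurable F →
    ∫⁻ x in chamber k, ENNReal.ofReal (laguerre k (D + 1) x) *
      ∫⁻ w in {w : Fin (k + 1) → ℝ | ∀ i, 0 < w i}, F (secularRoots (snocZero x) w) *
        ENNReal.ofReal ((∏ i, Real.exp (-w i)) * w (Fin.last k) ^ D) =
    c * ∫⁻ μ in chamber (k + 1), F μ * ENNReal.ofReal (laguerre (k + 1) D μ) := by
  obtain ⟨c, hc⟩ := lintegral_gapBox_absVdm k
  refine ⟨c, fun F hF => ?_⟩
  -- Carrying the interlacing condition as an indicator gives a single measurable function on the
  -- product space, to which Tonelli's theorem applies.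
  let G : (Fin k → ℝ) → (Fin (k + 1) → ℝ) → ℝ≥0∞ := fun x μ =>
    (interlacingPairs k).indicator
      (fun p => F p.2 * ENNReal.ofReal ((∏ i, Real.exp (-p.2 i)) * (∏ i, p.2 i) ^ D *
        absVdm p.2 * absVdm p.1)) (x, μ)
  have hG : Measurable (Function.uncurry G) := by
    change Measurable ((interlacingPairs k).indicator _)
    refine Measurable.indicator ?_ (measurableSet_interlacingPairs k)
    refine (hF.comp measurable_snd).mul (ENNReal.measurable_ofReal.comp ?_)
    exact Continuous.measurable (by fun_prop)
  have hL : ∀ x ∈ chamber k, ENNReal.ofReal (laguerre k (D + 1) x) *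
      ∫⁻ w in {w : Fin (k + 1) → ℝ | ∀ i, 0 < w i}, F (secularRoots (snocZero x) w) *
        ENNReal.ofReal ((∏ i, Real.exp (-w i)) * w (Fin.last k) ^ D) = ∫⁻ μ, G x μ := by
    intro x hx
    have hS := snocZero_strictAnti hx
    rw [lintegral_secularRoots hS F
      (fun w => ENNReal.ofReal ((∏ i, Real.exp (-w i)) * w (Fin.last k) ^ D)),
      ← lintegral_const_mul' _ _ ENNReal.ofReal_ne_top,
      ← lintegral_indicator (measurableSet_interlacing _)]
    refine lintegral_congr fun μ => ?_
    by_cases hμ : μ ∈ interlacing (snocZero x)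
    · rw [Set.indicator_of_mem hμ]
      have h1 : (x, μ) ∈ interlacingPairs k := (interlacing_snocZero_iff x μ).1 ⟨hx, hμ⟩
      simp only [G]
      rw [Set.indicator_of_mem h1, ← laguerre_mul_jacobian hx hμ]
      have hnn : 0 ≤ laguerre k (D + 1) x := by
        unfold laguerre
        have : ∀ i, 0 ≤ x i := fun i => (hx.2 i).le
        have := Finset.prod_nonneg fun i (_ : i ∈ Finset.univ) => this i
        positivity
      have hnn2 : 0 ≤ absVdm μ / absVdm (snocZero x) :=
        div_nonneg (abs_nonneg _) (abs_nonneg _)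
      rw [ENNReal.ofReal_mul hnn, ENNReal.ofReal_mul hnn2]
      ring
    · rw [Set.indicator_of_notMem hμ]
      have h1 : (x, μ) ∉ interlacingPairs k := fun h =>
        hμ ((interlacing_snocZero_iff x μ).2 h).2
      simp only [G]
      rw [Set.indicator_of_notMem h1]
  rw [setLIntegral_congr_fun (measurableSet_chamber k) hL]
  have hzero : ∀ x, x ∉ chamber k → ∀ μ, G x μ = 0 := by
    intro x hx μ
    have : (x, μ) ∉ interlacingPairs k := fun h => hx ((interlacing_snocZero_iff x μ).2 h).1
    exact Set.indicator_of_notMem this _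
  have hun : ∫⁻ x in chamber k, ∫⁻ μ, G x μ = ∫⁻ x, ∫⁻ μ, G x μ := by
    rw [← lintegral_indicator (measurableSet_chamber k)]
    refine lintegral_congr fun x => ?_
    by_cases hx : x ∈ chamber k
    · rw [Set.indicator_of_mem hx]
    · rw [Set.indicator_of_notMem hx]
      simp [hzero x hx]
  have hm : Measurable fun μ => F μ * ENNReal.ofReal (laguerre (k + 1) D μ) :=
    hF.mul (ENNReal.measurable_ofReal.comp continuous_laguerre.measurable)
  rw [hun, lintegral_lintegral_swap hG.aemeasurable, ← lintegral_const_mul _ hm,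
    ← lintegral_indicator (measurableSet_chamber _)]
  refine lintegral_congr fun μ => ?_
  by_cases hμ : μ ∈ chamber (k + 1)
  · rw [Set.indicator_of_mem hμ]
    have hGμ : ∀ x, G x μ = (gapBox μ).indicator (fun x => F μ * ENNReal.ofReal
        ((∏ i, Real.exp (-μ i)) * (∏ i, μ i) ^ D * absVdm μ) * ENNReal.ofReal (absVdm x)) x := by
      intro x
      have hnn : 0 ≤ (∏ i, Real.exp (-μ i)) * (∏ i, μ i) ^ D * absVdm μ := by
        have := Finset.prod_nonneg fun i (_ : i ∈ Finset.univ) => (hμ.2 i).le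
        have := abs_nonneg (Matrix.vandermonde μ).det
        unfold absVdm
        positivity
      by_cases hx : x ∈ gapBox μ
      · have h1 : (x, μ) ∈ interlacingPairs k := ⟨hμ, hx⟩
        simp only [G]
        rw [Set.indicator_of_mem h1, Set.indicator_of_mem hx, ENNReal.ofReal_mul hnn]
        exact (mul_assoc _ _ _).symm
      · have h1 : (x, μ) ∉ interlacingPairs k := fun h => hx h.2
        simp only [G]
        rw [Set.indicator_of_notMem h1, Set.indicator_of_notMem hx]
    rw [lintegral_congr hGμ, lintegral_indicator (measurableSet_gapBox μ),
      lintegral_const_mul _ (by fun_prop),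
      hc μ hμ.1]
    have hnn : 0 ≤ (∏ i, Real.exp (-μ i)) * (∏ i, μ i) ^ D * absVdm μ := by
      have := Finset.prod_nonneg fun i (_ : i ∈ Finset.univ) => (hμ.2 i).le
      have := abs_nonneg (Matrix.vandermonde μ).det
      unfold absVdm
      positivity
    rw [show laguerre (k + 1) D μ = (∏ i, Real.exp (-μ i)) * (∏ i, μ i) ^ D * absVdm μ *
      absVdm μ by unfold laguerre; ring, ENNReal.ofReal_mul hnn]
    ring
  · rw [Set.indicator_of_notMem hμ]
    have : ∀ x, G x μ = 0 := fun x => by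
      have : (x, μ) ∉ interlacingPairs k := fun h => hμ h.1
      exact Set.indicator_of_notMem this _
    simp [this]

/-! ### Densities of product measures -/

theorem pi_withDensity_ofReal {ι : Type*} [Fintype ι] {E : ι → Type*}
    [∀ i, MeasurableSpace (E i)] (μ : ∀ i, Measure (E i)) [∀ i, SigmaFinite (μ i)]
    (g : ∀ i, E i → ℝ) (hg : ∀ i, Integrable (g i) (μ i))
    (hg0 : ∀ i x, 0 ≤ g i x) :
    Measure.pi (fun i => (μ i).withDensity fun x => ENNReal.ofReal (g i x)) =
      (Measure.pi μ).withDensity fun x => ENNReal.ofReal (∏ i, g i (x i)) := by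
  have hσ : ∀ i, SigmaFinite ((μ i).withDensity fun x => ENNReal.ofReal (g i x)) := fun i => by
    have := isFiniteMeasure_withDensity_ofReal (hg i).2
    infer_instance
  refine Measure.pi_eq fun s hs => ?_
  rw [withDensity_apply _ (MeasurableSet.univ_pi hs), Measure.restrict_pi_pi]
  have h1 : ∀ i, Integrable (g i) ((μ i).restrict (s i)) := fun i => (hg i).restrict
  have hint : Integrable (fun x : ∀ i, E i => ∏ i, g i (x i))
      (Measure.pi fun i => (μ i).restrict (s i)) :=
    Integrable.fintype_prod_dep h1
  rw [← ofReal_integral_eq_lintegral_ofReal hint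
    (Filter.Eventually.of_forall fun x => Finset.prod_nonneg fun i _ => hg0 i _),
    integral_fintype_prod_eq_prod (𝕜 := ℝ) g,
    ENNReal.ofReal_prod_of_nonneg fun i _ => integral_nonneg fun x => hg0 i x]
  refine Finset.prod_congr rfl fun i _ => ?_
  rw [withDensity_apply _ (hs i), ofReal_integral_eq_lintegral_ofReal (h1 i)
    (Filter.Eventually.of_forall fun x => hg0 i x)]

/-! ### The complex Gaussian law -/

instance isProbabilityMeasure_complexGaussian (v : ℝ) :
    IsProbabilityMeasure (complexGaussian v) := by
  unfold complexGaussian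
  exact Measure.isProbabilityMeasure_map (by
    exact (Complex.measurableEquivRealProd.symm.measurable).aemeasurable)

theorem complexGaussian_one : complexGaussian 1 =
    volume.withDensity fun z : ℂ => ENNReal.ofReal (Real.pi⁻¹ * Real.exp (-‖z‖ ^ 2)) := by
  have hv : (1 / 2 : ℝ).toNNReal ≠ 0 := by
    rw [ne_eq, Real.toNNReal_eq_zero]; norm_num
  unfold complexGaussian
  rw [gaussianReal_of_var_ne_zero 0 hv, prod_withDensity (measurable_gaussianPDF _ _)
    (measurable_gaussianPDF _ _), ← Measure.volume_eq_prod]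
  ext s hs
  have hmp := Complex.volume_preserving_equiv_real_prod.symm
  have hf : (fun p : ℝ × ℝ => (⟨p.1, p.2⟩ : ℂ)) = Complex.measurableEquivRealProd.symm := rfl
  rw [hf, Measure.map_apply (MeasurableEquiv.measurable _) hs,
    withDensity_apply _ (MeasurableEquiv.measurable _ hs), withDensity_apply _ hs,
    ← hmp.setLIntegral_comp_preimage_emb (MeasurableEquiv.measurableEmbedding _)]
  refine lintegral_congr fun p => ?_
  rw [gaussianPDF, gaussianPDF, ← ENNReal.ofReal_mul (gaussianPDFReal_nonneg _ _ _)]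
  congr 1
  have hn : ‖Complex.measurableEquivRealProd.symm p‖ ^ 2 = p.1 ^ 2 + p.2 ^ 2 := by
    rw [← Complex.normSq_eq_norm_sq, Complex.normSq_apply]
    simp [Complex.measurableEquivRealProd_symm_apply, sq]
  rw [hn, gaussianPDFReal, gaussianPDFReal]
  have h2 : ((1 / 2 : ℝ).toNNReal : ℝ) = 1 / 2 := Real.coe_toNNReal _ (by norm_num)
  rw [h2]
  have h3 : (√(2 * Real.pi * (1 / 2)))⁻¹ * (√(2 * Real.pi * (1 / 2)))⁻¹ = Real.pi⁻¹ := by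
    rw [← mul_inv, Real.mul_self_sqrt (by positivity)]
    congr 1; ring
  rw [mul_mul_mul_comm, h3, ← Real.exp_add]
  congr 2
  ring

theorem integrable_gauss_complex :
    Integrable (fun z : ℂ => Real.pi⁻¹ * Real.exp (-‖z‖ ^ 2)) := by
  have h : IsProbabilityMeasure (complexGaussian 1) := inferInstance
  rw [complexGaussian_one] at h
  have hm : Measurable fun z : ℂ => Real.pi⁻¹ * Real.exp (-‖z‖ ^ 2) := by fun_prop
  refine ⟨hm.aestronglyMeasurable, ?_⟩
  rw [hasFiniteIntegral_iff_ofReal (Filter.Eventually.of_forall fun z => by positivity)]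
  have := h.measure_univ
  rw [withDensity_apply _ MeasurableSet.univ, Measure.restrict_univ] at this
  rw [this]; exact ENNReal.one_lt_top

/-- The law of a vector with i.i.d. `CN(0, 1)` entries. -/
def gaussVec (ι : Type*) [Fintype ι] : Measure (ι → ℂ) := Measure.pi fun _ => complexGaussian 1

instance isProbabilityMeasure_gaussVec (ι : Type*) [Fintype ι] :
    IsProbabilityMeasure (gaussVec ι) := by unfold gaussVec; infer_instance

theorem gaussVec_eq (ι : Type*) [Fintype ι] : gaussVec ι =
    volume.withDensity fun z : ι → ℂ =>
      ENNReal.ofReal (∏ i, (Real.pi⁻¹ * Real.exp (-‖z i‖ ^ 2))) := by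
  unfold gaussVec
  rw [complexGaussian_one, volume_pi]
  exact pi_withDensity_ofReal (fun _ : ι => (volume : Measure ℂ))
    (fun _ z => Real.pi⁻¹ * Real.exp (-‖z‖ ^ 2)) (fun _ => integrable_gauss_complex)
    (fun _ z => by positivity)

theorem lintegral_gaussVec {ι : Type*} [Fintype ι] {f : (ι → ℂ) → ℝ≥0∞} (hf : Measurable f) :
    ∫⁻ z, f z ∂gaussVec ι =
      ∫⁻ z, ENNReal.ofReal (∏ i, (Real.pi⁻¹ * Real.exp (-‖z i‖ ^ 2))) * f z := by
  rw [gaussVec_eq, lintegral_withDensity_eq_lintegral_mul _ (by fun_prop) hf]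
  rfl

theorem sum_norm_sq_mulVec {ι : Type*} [Fintype ι] [DecidableEq ι] {V : Matrix ι ι ℂ}
    (hV : V ∈ Matrix.unitaryGroup ι ℂ) (z : ι → ℂ) :
    ∑ i, ‖(V *ᵥ z) i‖ ^ 2 = ∑ i, ‖z i‖ ^ 2 := by
  have h : ∀ y : ι → ℂ, ((∑ i, ‖y i‖ ^ 2 : ℝ) : ℂ) = star y ⬝ᵥ y := by
    intro y
    push_cast
    refine Finset.sum_congr rfl fun i _ => ?_
    rw [Pi.star_apply, RCLike.star_def, Complex.conj_mul']
  have h2 : star (V *ᵥ z) ⬝ᵥ (V *ᵥ z) = star z ⬝ᵥ z := by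
    rw [Matrix.star_mulVec, Matrix.dotProduct_mulVec, Matrix.vecMul_vecMul,
      ← Matrix.star_eq_conjTranspose, Matrix.mem_unitaryGroup_iff'.1 hV, Matrix.vecMul_one]
  exact_mod_cast (h (V *ᵥ z)).trans (h2.trans (h z).symm)

/-- The standard complex Gaussian law is invariant under unitary matrices. -/
theorem lintegral_gaussVec_mulVec {ι : Type*} [Fintype ι] [DecidableEq ι] {V : Matrix ι ι ℂ}
    (hV : V ∈ Matrix.unitaryGroup ι ℂ) {f : (ι → ℂ) → ℝ≥0∞} (hf : Measurable f) :
    ∫⁻ z, f (V *ᵥ z) ∂gaussVec ι = ∫⁻ z, f z ∂gaussVec ι := by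
  let L : (ι → ℂ) →ₗ[ℝ] (ι → ℂ) := (Matrix.toLin' V).restrictScalars ℝ
  let L' : (ι → ℂ) →ₗ[ℝ] (ι → ℂ) := (Matrix.toLin' (star V)).restrictScalars ℝ
  have hLL' : L.comp L' = LinearMap.id := by
    refine LinearMap.ext fun z => ?_
    change Matrix.toLin' V (Matrix.toLin' (star V) z) = z
    rw [Matrix.toLin'_apply, Matrix.toLin'_apply, Matrix.mulVec_mulVec,
      Matrix.mem_unitaryGroup_iff.1 hV, Matrix.one_mulVec]
  have hdet : LinearMap.det L ≠ 0 := by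
    intro h0
    have := congrArg LinearMap.det hLL'
    rw [LinearMap.det_comp, h0, zero_mul, LinearMap.det_id] at this
    exact zero_ne_one this
  let ρ : (ι → ℂ) → ℝ≥0∞ := fun z => ENNReal.ofReal (∏ i, (Real.pi⁻¹ * Real.exp (-‖z i‖ ^ 2)))
  have hρ : Measurable ρ := by
    refine ENNReal.measurable_ofReal.comp (Continuous.measurable ?_)
    fun_prop
  have hρV : ∀ z, ρ (V *ᵥ z) = ρ z := by
    intro z
    simp only [ρ, Finset.prod_mul_distrib, ← Real.exp_sum, Finset.sum_neg_distrib,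
      sum_norm_sq_mulVec hV]
  have hLm : Measurable fun z : ι → ℂ => V *ᵥ z := by
    have : Continuous fun z : ι → ℂ => V *ᵥ z := by fun_prop
    exact this.measurable
  -- The density is invariant, so the law changes at most by the constant Jacobian of the linear
  -- map. Its value is not computed: testing on the function `1` shows that it is one.
  have key : ∃ c : ℝ≥0∞, ∀ f : (ι → ℂ) → ℝ≥0∞, Measurable f →
      ∫⁻ z, f (V *ᵥ z) ∂gaussVec ι = c * ∫⁻ z, f z ∂gaussVec ι := by
    refine ⟨ENNReal.ofReal |(LinearMap.det L)⁻¹|, fun f hf => ?_⟩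
    have hmap := Measure.map_linearMap_addHaar_eq_smul_addHaar (volume : Measure (ι → ℂ)) hdet
    rw [lintegral_gaussVec (f := fun z => f (V *ᵥ z)) (hf.comp hLm), lintegral_gaussVec hf]
    have h1 : ∫⁻ z, ρ z * f (V *ᵥ z) = ∫⁻ z, (ρ * f) (V *ᵥ z) :=
      lintegral_congr fun z => by simp only [Pi.mul_apply, hρV]
    have h2 : ∫⁻ z, (ρ * f) (V *ᵥ z) = ∫⁻ y, (ρ * f) y ∂(Measure.map L volume) :=
      (lintegral_map (hρ.mul hf) hLm).symm
    rw [hmap, lintegral_smul_measure] at h2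
    exact h1.trans h2
  obtain ⟨c, hc⟩ := key
  have h1 := hc (fun _ => 1) measurable_const
  simp only [lintegral_const, measure_univ, mul_one] at h1
  rw [hc f hf, ← h1, one_mul]

/-! ### Squared norms of Gaussian vectors -/

/-- The law with density `e^(-t) t^D / D!` on the positive reals. -/
def erlang (D : ℕ) : Measure ℝ :=
  (volume.restrict (Set.Ioi 0)).withDensity fun t =>
    ENNReal.ofReal (Real.exp (-t) * t ^ D / D.factorial)

theorem lintegral_erlang (D : ℕ) {f : ℝ → ℝ≥0∞} (hf : Measurable f) :
    ∫⁻ t, f t ∂erlang D =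
      ∫⁻ t in Set.Ioi 0, ENNReal.ofReal (Real.exp (-t) * t ^ D / D.factorial) * f t := by
  unfold erlang
  rw [lintegral_withDensity_eq_lintegral_mul _ (by fun_prop) hf]
  rfl

/-- Polar coordinates followed by `t = r ^ 2`: the angle gives `2 * π`, the density `π⁻¹`, and `2 *
r dr = dt`. -/
theorem lintegral_complexGaussian_norm_sq {f : ℝ → ℝ≥0∞} (hf : Measurable f) :
    ∫⁻ z, f (‖z‖ ^ 2) ∂complexGaussian 1 = ∫⁻ t, f t ∂erlang 0 := by
  let g : ℂ → ℝ≥0∞ := fun z => ENNReal.ofReal (Real.pi⁻¹ * Real.exp (-‖z‖ ^ 2)) * f (‖z‖ ^ 2)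
  have h0 : ∫⁻ z, f (‖z‖ ^ 2) ∂complexGaussian 1 = ∫⁻ z, g z := by
    rw [complexGaussian_one,
      lintegral_withDensity_eq_lintegral_mul _ (by fun_prop) (by fun_prop)]
    rfl
  rw [lintegral_erlang 0 hf, h0, ← Complex.lintegral_comp_polarCoord_symm]
  have h1 : ∀ p ∈ polarCoord.target, ENNReal.ofReal p.1 • g (Complex.polarCoord.symm p) =
      ENNReal.ofReal (p.1 * (Real.pi⁻¹ * Real.exp (-p.1 ^ 2))) * f (p.1 ^ 2) := by
    intro p hp
    have hp0 : 0 < p.1 := hp.1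
    simp only [g, smul_eq_mul, Complex.norm_polarCoord_symm, sq_abs]
    rw [ENNReal.ofReal_mul hp0.le, mul_assoc]
  rw [setLIntegral_congr_fun polarCoord.open_target.measurableSet h1, polarCoord_target,
    Measure.volume_eq_prod, setLIntegral_prod _ (by fun_prop)]
  have himg : (fun r : ℝ => r ^ 2) '' Set.Ioi 0 = Set.Ioi 0 := by
    ext t
    constructor
    · rintro ⟨r, hr, rfl⟩
      exact pow_pos (Set.mem_Ioi.1 hr) 2
    · intro ht
      exact ⟨√t, Real.sqrt_pos.2 ht, Real.sq_sqrt (le_of_lt ht)⟩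
  conv_rhs => rw [← himg, lintegral_image_eq_lintegral_abs_deriv_mul measurableSet_Ioi
    (f := fun r : ℝ => r ^ 2) (f' := fun r => 2 * r)
    (fun r _ => by simpa using (hasDerivAt_pow 2 r).hasDerivWithinAt)
    (fun a ha b hb hab => (pow_left_inj₀ (le_of_lt ha) (le_of_lt hb) two_ne_zero).1 hab)]
  refine setLIntegral_congr_fun measurableSet_Ioi fun r hr => ?_
  have hr0 : 0 < r := hr
  simp only [lintegral_const, Measure.restrict_apply MeasurableSet.univ, Set.univ_inter,
    Real.volume_Ioo]
  rw [mul_right_comm, ← ENNReal.ofReal_mul (by positivity), abs_of_pos (by positivity),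
    ← mul_assoc (ENNReal.ofReal (2 * r)), ← ENNReal.ofReal_mul (by positivity)]
  congr 2
  have := Real.pi_pos.ne'
  simp
  field_simp
  ring

instance (D : ℕ) : SFinite (erlang D) := by unfold erlang; infer_instance

/-- The convolution with an exponential law. For fixed total `u` the exponential factor is constant,
and integrating `t ^ D` over `(0, u)` raises the power by one and turns `D!` into `(D + 1)!`. -/
theorem lintegral_erlang_add (D : ℕ) {f : ℝ → ℝ≥0∞} (hf : Measurable f) :
    ∫⁻ s, ∫⁻ t, f (s + t) ∂erlang D ∂erlang 0 = ∫⁻ t, f t ∂erlang (D + 1) := by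
  let S : Set (ℝ × ℝ) := {p | 0 < p.1} ∩ {p | 0 < p.2}
  have hS : MeasurableSet S :=
    (measurableSet_lt measurable_const measurable_fst).inter
      (measurableSet_lt measurable_const measurable_snd)
  let K : ℝ → ℝ → ℝ≥0∞ := fun s t => S.indicator (fun p => ENNReal.ofReal
    (Real.exp (-(p.1 + p.2)) * p.2 ^ D / D.factorial) * f (p.1 + p.2)) (s, t)
  have hK : Measurable (Function.uncurry K) := by
    change Measurable (S.indicator _)
    exact Measurable.indicator (by fun_prop) hS
  have h1 : ∫⁻ s, ∫⁻ t, f (s + t) ∂erlang D ∂erlang 0 = ∫⁻ s, ∫⁻ t, K s t := by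
    rw [lintegral_erlang 0 (by
      exact Measurable.lintegral_prod_right' (f := fun p : ℝ × ℝ => f (p.1 + p.2))
        (ν := erlang D) (by fun_prop)), ← lintegral_indicator measurableSet_Ioi]
    refine lintegral_congr fun s => ?_
    by_cases hs : s ∈ Set.Ioi 0
    · rw [Set.indicator_of_mem hs, lintegral_erlang D (by fun_prop),
        ← lintegral_const_mul _ (by fun_prop), ← lintegral_indicator measurableSet_Ioi]
      refine lintegral_congr fun t => ?_
      by_cases ht : t ∈ Set.Ioi 0
      · have hst : (s, t) ∈ S := ⟨hs, ht⟩
        simp only [K]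
        rw [Set.indicator_of_mem ht, Set.indicator_of_mem hst, ← mul_assoc,
          ← ENNReal.ofReal_mul (by positivity)]
        congr 2
        rw [neg_add, Real.exp_add]
        simp
        ring
      · have hst : (s, t) ∉ S := fun h => ht h.2
        simp only [K]
        rw [Set.indicator_of_notMem ht, Set.indicator_of_notMem hst]
    · rw [Set.indicator_of_notMem hs]
      have : ∀ t, K s t = 0 := fun t => by
        have hst : (s, t) ∉ S := fun h => hs h.1
        exact Set.indicator_of_notMem hst _
      simp [this]
  have h2 : ∀ t, ∫⁻ s, K s t = ∫⁻ u, K (u - t) t := fun t =>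
    (lintegral_sub_right_eq_self (fun s => K s t) t).symm
  have hK2 : Measurable (Function.uncurry fun t u => K (u - t) t) :=
    hK.comp (f := fun p : ℝ × ℝ => (p.2 - p.1, p.1)) (by fun_prop)
  rw [h1, lintegral_lintegral_swap hK.aemeasurable, lintegral_congr h2,
    lintegral_lintegral_swap hK2.aemeasurable, lintegral_erlang (D + 1) hf,
    ← lintegral_indicator measurableSet_Ioi]
  refine lintegral_congr fun u => ?_
  have h3 : ∀ t, K (u - t) t = (Set.Ioo 0 u).indicator (fun t => ENNReal.ofReal (t ^ D) *
      (ENNReal.ofReal (Real.exp (-u) / D.factorial) * f u)) t := by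
    intro t
    by_cases ht : t ∈ Set.Ioo 0 u
    · have hst : (u - t, t) ∈ S := ⟨sub_pos.2 ht.2, ht.1⟩
      have : 0 ≤ t ^ D := pow_nonneg ht.1.le _
      simp only [K]
      rw [Set.indicator_of_mem ht, Set.indicator_of_mem hst, ← mul_assoc,
        ← ENNReal.ofReal_mul this, sub_add_cancel]
      congr 2
      ring
    · have hst : (u - t, t) ∉ S := fun h => ht ⟨h.2, sub_pos.1 h.1⟩
      simp only [K]
      rw [Set.indicator_of_notMem ht, Set.indicator_of_notMem hst]
  rw [lintegral_congr h3, lintegral_indicator measurableSet_Ioo,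
    lintegral_mul_const _ (by fun_prop)]
  by_cases hu : u ∈ Set.Ioi 0
  · have hu0 : 0 < u := hu
    rw [Set.indicator_of_mem hu, ← ofReal_integral_eq_lintegral_ofReal
      (((continuous_pow D).integrableOn_Icc (a := 0) (b := u)).mono_set Set.Ioo_subset_Icc_self)
      ((ae_restrict_iff' measurableSet_Ioo).2 (Filter.Eventually.of_forall fun t ht =>
        pow_nonneg ht.1.le _)), ← integral_Ioc_eq_integral_Ioo,
      ← intervalIntegral.integral_of_le hu0.le, integral_pow, ← mul_assoc,
      ← ENNReal.ofReal_mul (by simp; positivity)]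
    congr 2
    rw [Nat.factorial_succ]
    push_cast
    have : (D.factorial : ℝ) ≠ 0 := by positivity
    have : (D + 1 : ℝ) ≠ 0 := by positivity
    field_simp
    simp
  · rw [Set.indicator_of_notMem hu, Set.Ioo_eq_empty (by simpa using hu)]
    simp

/-- Splitting off one coordinate convolves with `erlang 0`. The index is shifted: `D + 1`
coordinates correspond to the power `t ^ D`. -/
theorem lintegral_gaussVec_sum_norm_sq (D : ℕ) {f : ℝ → ℝ≥0∞} (hf : Measurable f) :
    ∫⁻ z, f (∑ i, ‖z i‖ ^ 2) ∂gaussVec (Fin (D + 1)) = ∫⁻ t, f t ∂erlang D := by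
  induction D generalizing f with
  | zero =>
    rw [← lintegral_complexGaussian_norm_sq hf]
    have := measurePreserving_piUnique (fun _ : Fin 1 => complexGaussian 1)
    rw [← this.lintegral_comp (f := fun z => f (‖z‖ ^ 2)) (by fun_prop)]
    simp [gaussVec]
  | succ D ih =>
    have hmp := measurePreserving_piFinSuccAbove (fun _ : Fin (D + 2) => complexGaussian 1) 0
    have h1 : ∫⁻ z, f (∑ i, ‖z i‖ ^ 2) ∂gaussVec (Fin (D + 2)) =
        ∫⁻ p : ℂ × (Fin (D + 1) → ℂ), f (‖p.1‖ ^ 2 + ∑ i, ‖p.2 i‖ ^ 2)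
          ∂(complexGaussian 1).prod (gaussVec (Fin (D + 1))) := by
      refine Eq.trans ?_ (hmp.lintegral_comp (f := fun p : ℂ × (Fin (D + 1) → ℂ) =>
        f (‖p.1‖ ^ 2 + ∑ i, ‖p.2 i‖ ^ 2)) (by fun_prop))
      refine lintegral_congr fun z => ?_
      rw [Fin.sum_univ_succ]
      rfl
    have h2 : ∀ x : ℂ, ∫⁻ y, f (‖x‖ ^ 2 + ∑ i, ‖y i‖ ^ 2) ∂gaussVec (Fin (D + 1)) =
        ∫⁻ t, f (‖x‖ ^ 2 + t) ∂erlang D := fun x =>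
      ih (f := fun t => f (‖x‖ ^ 2 + t)) (by fun_prop)
    rw [h1, lintegral_prod _ (by fun_prop), lintegral_congr h2, ← lintegral_erlang_add D hf]
    exact lintegral_complexGaussian_norm_sq (f := fun s => ∫⁻ t, f (s + t) ∂erlang D)
      (Measurable.lintegral_prod_right' (f := fun p : ℝ × ℝ => f (p.1 + p.2)) (by fun_prop))

/-! ### The effect of an additional row on the eigenvalues -/

/-- Equal multisets of values mean fibres of equal cardinality over every value; bijections of
fibres glue. -/
theorem exists_equiv_of_multiset_map_eq {ι κ α : Type*} [Fintype ι] [Fintype κ] {f : ι → α}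
    {g : κ → α} (h : Finset.univ.val.map f = Finset.univ.val.map g) :
    ∃ e : ι ≃ κ, ∀ i, g (e i) = f i := by
  classical
  have hc : ∀ c, Fintype.card {i // f i = c} = Fintype.card {j // g j = c} := by
    intro c
    have := congrArg (Multiset.count c) h
    rw [Multiset.count_map, Multiset.count_map] at this
    rw [Fintype.card_subtype, Fintype.card_subtype]
    simpa [Finset.card, eq_comm] using this
  exact ⟨Equiv.ofFiberEquiv fun c => Fintype.equivOfCardEq (hc c), fun i =>
    Equiv.ofFiberEquiv_map _ i⟩

theorem secular_eq_of_ne {ι : Type*} [Fintype ι] [DecidableEq ι] {l : ι → ℝ} (w : ι → ℝ) {t : ℝ}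
    (ht : ∀ i, t - l i ≠ 0) :
    secular l w t = (∏ i, (t - l i)) * (1 - ∑ i, w i / (t - l i)) := by
  unfold secular
  rw [mul_sub, mul_one, Finset.mul_sum]
  congr 1
  refine Finset.sum_congr rfl fun i _ => ?_
  rw [← Finset.mul_prod_erase _ _ (Finset.mem_univ i)]
  have := ht i
  field_simp

/-- The squared moduli of the first `k` coordinates, and the sum of those of the others. -/
def weightVec {k m : ℕ} (z : Fin k ⊕ Fin m → ℂ) : Fin (k + 1) → ℝ :=
  Fin.snoc (α := fun _ => ℝ) (fun i => ‖z (Sum.inl i)‖ ^ 2) (∑ j, ‖z (Sum.inr j)‖ ^ 2)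

@[simp] theorem weightVec_castSucc {k m : ℕ} (z : Fin k ⊕ Fin m → ℂ) (i : Fin k) :
    weightVec z i.castSucc = ‖z (Sum.inl i)‖ ^ 2 := by simp [weightVec]

@[simp] theorem weightVec_last {k m : ℕ} (z : Fin k ⊕ Fin m → ℂ) :
    weightVec z (Fin.last k) = ∑ j, ‖z (Sum.inr j)‖ ^ 2 := by simp [weightVec]

theorem weightVec_nonneg {k m : ℕ} (z : Fin k ⊕ Fin m → ℂ) (i : Fin (k + 1)) :
    0 ≤ weightVec z i := by
  induction i using Fin.lastCases with
  | last => rw [weightVec_last]; positivity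
  | cast i => rw [weightVec_castSucc]; positivity

theorem measurable_weightVec {k m : ℕ} : Measurable (weightVec (k := k) (m := m)) := by
  refine measurable_pi_lambda _ fun i => ?_
  induction i using Fin.lastCases with
  | last => simp only [weightVec_last]; fun_prop
  | cast i => simp only [weightVec_castSucc]; fun_prop

/-- The secular function sees only the total weight at each location. The node `0` has multiplicity
`D + 1`; merging its copies into one splits off the factor `t ^ D`. -/
theorem secular_sum_elim {k D : ℕ} {x : Fin k → ℝ} (z : Fin k ⊕ Fin (D + 1) → ℂ) {t : ℝ}
    (ht0 : t ≠ 0) (ht : ∀ i, t - x i ≠ 0) :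
    secular (Sum.elim x fun _ => 0) (fun i => ‖z i‖ ^ 2) t =
      t ^ D * secular (snocZero x) (weightVec z) t := by
  rw [secular_eq_of_ne, secular_eq_of_ne]
  · rw [Fintype.prod_sum_type, Fintype.sum_sum_type,
      Fin.prod_univ_castSucc (fun i => t - snocZero x i),
      Fin.sum_univ_castSucc (fun i => weightVec z i / (t - snocZero x i))]
    simp only [Sum.elim_inl, Sum.elim_inr, snocZero_castSucc, snocZero_last, weightVec_castSucc,
      weightVec_last, sub_zero, Finset.prod_const, Finset.card_univ, Fintype.card_fin,
      Finset.sum_div]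
    ring
  · intro i
    induction i using Fin.lastCases with
    | last => simpa using ht0
    | cast i => simpa using ht i
  · rintro (i | j)
    · simpa using ht i
    · simpa using ht0

/-- The characteristic polynomials of `Hᴴ * H` and `H * Hᴴ` differ by the factor `X ^ m`, so
comparing roots gives the same multiset once `m` zeros are added. The order of `eigenvalues` is not
controlled, hence the equivalence. -/
theorem eigenvalues_conjTranspose_mul_self {k N m : ℕ} (hN : k + m = N)
    (H : Matrix (Fin k) (Fin N) ℂ) :
    ∃ e : Fin N ≃ Fin k ⊕ Fin m, ∀ j,
      Sum.elim (eigs (H * Hᴴ)) (fun _ => 0) (e j) =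
        (Matrix.isHermitian_conjTranspose_mul_self H).eigenvalues j := by
  set hA := Matrix.isHermitian_conjTranspose_mul_self H
  have h1 := Matrix.charpoly_mul_comm_of_le Hᴴ H (by simp; omega)
  have h2 : (H * Hᴴ).charpoly =
      ∏ i, (Polynomial.X - Polynomial.C ((eigs (H * Hᴴ) i : ℝ) : ℂ)) := by
    refine Polynomial.eq_of_infinite_eval_eq _ _ ((Set.infinite_range_of_injective
      Complex.ofReal_injective).mono ?_)
    rintro _ ⟨t, rfl⟩
    have := eval_charpoly_eq_prod_eigs (Matrix.isHermitian_mul_conjTranspose_self H) t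
    change _ = _
    rw [this, Polynomial.eval_prod]
    push_cast
    simp
  have h3 : (∏ j, (Polynomial.X - Polynomial.C ((hA.eigenvalues j : ℝ) : ℂ))) =
      ∏ i : Fin k ⊕ Fin m, (Polynomial.X - Polynomial.C
        ((Sum.elim (eigs (H * Hᴴ)) (fun _ => (0 : ℝ)) i : ℝ) : ℂ)) := by
    refine hA.charpoly_eq.symm.trans ?_
    rw [h1, h2, Fintype.prod_sum_type]
    simp only [Fintype.card_fin, Sum.elim_inl, Sum.elim_inr, Complex.ofReal_zero,
      Polynomial.C_0, sub_zero, Finset.prod_const, Finset.card_univ]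
    rw [mul_comm]
    congr 2
    omega
  have h4 := congrArg Polynomial.roots h3
  rw [Polynomial.roots_prod _ _ (by simp [Finset.prod_ne_zero_iff, Polynomial.X_sub_C_ne_zero]),
    Polynomial.roots_prod _ _ (Finset.prod_ne_zero_iff.2 fun i _ =>
      Polynomial.X_sub_C_ne_zero _)] at h4
  simp only [Polynomial.roots_X_sub_C, Multiset.bind_singleton] at h4
  obtain ⟨e, he⟩ := exists_equiv_of_multiset_map_eq h4
  exact ⟨e, fun j => by exact_mod_cast he j⟩

theorem secular_comp_equiv {ι κ : Type*} [Fintype ι] [DecidableEq ι] [Fintype κ] [DecidableEq κ]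
    (e : ι ≃ κ) (l w : κ → ℝ) {t : ℝ} (ht : ∀ i, t - l i ≠ 0) :
    secular (fun i => l (e i)) (fun i => w (e i)) t = secular l w t := by
  rw [secular_eq_of_ne _ ht, secular_eq_of_ne _ fun i => ht (e i),
    Equiv.prod_comp e (fun i => t - l i), Equiv.sum_comp e (fun i => w i / (t - l i))]

theorem conjTranspose_mul_cons {k N : ℕ} (h : Fin N → ℂ) (H : Fin k → Fin N → ℂ) :
    (Matrix.of (Fin.cons (α := fun _ => Fin N → ℂ) h H))ᴴ *
      Matrix.of (Fin.cons (α := fun _ => Fin N → ℂ) h H) =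
      (Matrix.of H)ᴴ * Matrix.of H + Matrix.vecMulVec (star h) h := by
  ext i j
  rw [Matrix.add_apply, Matrix.mul_apply, Matrix.mul_apply, Fin.sum_univ_succ, add_comm]
  simp [Matrix.vecMulVec_apply]

/-- Adding a row `h` to `H` is, up to a unitary matrix depending on `H` only, a rank-one
perturbation of the diagonal matrix of eigenvalues. -/
theorem eigs_cons {k N D : ℕ} (hN : k + (D + 1) = N) (H : Fin k → Fin N → ℂ) :
    ∃ V ∈ Matrix.unitaryGroup (Fin N) ℂ, ∃ e : Fin N ≃ Fin k ⊕ Fin (D + 1), ∀ h : Fin N → ℂ,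
      eigs (Matrix.of (Fin.cons (α := fun _ => Fin N → ℂ) h H) *
        (Matrix.of (Fin.cons (α := fun _ => Fin N → ℂ) h H))ᴴ) =
      secularRoots (snocZero (eigs (Matrix.of H * (Matrix.of H)ᴴ)))
        (weightVec fun i => (V *ᵥ h) (e.symm i)) := by
  obtain ⟨e, he⟩ := eigenvalues_conjTranspose_mul_self hN (Matrix.of H)
  set hA := Matrix.isHermitian_conjTranspose_mul_self (Matrix.of H)
  set x := eigs (Matrix.of H * (Matrix.of H)ᴴ)
  let U : Matrix (Fin N) (Fin N) ℂ := hA.eigenvectorUnitary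
  have hU : U ∈ Matrix.unitaryGroup (Fin N) ℂ := hA.eigenvectorUnitary.2
  have hU1 : Uᴴ * U = 1 := Matrix.mem_unitaryGroup_iff'.1 hU
  have hU2 : U * Uᴴ = 1 := Matrix.mem_unitaryGroup_iff.1 hU
  -- The rank-one term is built from `star h`, whose coordinates in the eigenbasis are `Uᴴ *ᵥ star h
  -- = star (Uᵀ *ᵥ h)`. Only their moduli matter, so the transpose gives a unitary map acting on `h`
  -- itself.
  refine ⟨Uᵀ, ?_, e, fun h => ?_⟩
  · rw [Matrix.mem_unitaryGroup_iff, Matrix.star_eq_conjTranspose]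
    have := congrArg Matrix.transpose hU1
    rw [Matrix.transpose_mul, Matrix.transpose_one] at this
    exact this
  set H' := Matrix.of (Fin.cons (α := fun _ => Fin N → ℂ) h H)
  set z : Fin k ⊕ Fin (D + 1) → ℂ := fun i => (Uᵀ *ᵥ h) (e.symm i)
  have hS : (insert 0 (Set.range x))ᶜ.Infinite := ((Set.finite_range x).insert 0).infinite_compl
  refine antitone_eq_of_prod_eq (eigs_antitone _) (secularRoots_antitone _ _) hS fun t ht => ?_
  have ht0 : t ≠ 0 := fun h0 => ht (Set.mem_insert_iff.2 (Or.inl h0))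
  have htx : ∀ i, t - x i ≠ 0 := fun i h0 =>
    ht (Set.mem_insert_iff.2 (Or.inr ⟨i, (sub_eq_zero.1 h0).symm⟩))
  rw [prod_secularRoots _ (weightVec_nonneg z)]
  let g : Fin N → ℂ := Uᴴ *ᵥ star h
  have hspec : (Matrix.of H)ᴴ * Matrix.of H =
      U * Matrix.diagonal (fun i => (hA.eigenvalues i : ℂ)) * Uᴴ := by
    have := hA.spectral_theorem
    rw [Unitary.conjStarAlgAut_apply] at this
    exact this
  have hdec : H'ᴴ * H' = U * (Matrix.diagonal (fun i => (hA.eigenvalues i : ℂ)) +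
      Matrix.vecMulVec g (star g)) * Uᴴ := by
    rw [conjTranspose_mul_cons, Matrix.mul_add, Matrix.add_mul]
    refine congrArg₂ (· + ·) hspec ?_
    rw [Matrix.mul_vecMulVec, Matrix.vecMulVec_mul]
    congr 1
    · rw [Matrix.mulVec_mulVec, hU2, Matrix.one_mulVec]
    · rw [Matrix.star_mulVec, star_star, Matrix.conjTranspose_conjTranspose, Matrix.vecMul_vecMul,
        hU2, Matrix.vecMul_one]
  have hchar : (H'ᴴ * H').charpoly = (Matrix.diagonal (fun i => (hA.eigenvalues i : ℂ)) +
      Matrix.vecMulVec g (star g)).charpoly := by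
    rw [hdec, Matrix.charpoly_mul_comm, ← Matrix.mul_assoc, hU1, Matrix.one_mul]
  have hg : ∀ i, ‖g i‖ = ‖z (e i)‖ := by
    intro i
    have : g = star (Uᵀ *ᵥ h) := by
      rw [Matrix.star_mulVec, ← Matrix.mulVec_transpose]
      rfl
    rw [this]
    simp [z]
  have hsec : (H'ᴴ * H').charpoly.eval (t : ℂ) =
      ((t ^ D * secular (snocZero x) (weightVec z) t : ℝ) : ℂ) := by
    have hz : ∀ i : Fin k ⊕ Fin (D + 1), t - Sum.elim x (fun _ => 0) i ≠ 0 := by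
      rintro (i | j)
      · simpa using htx i
      · simpa using ht0
    rw [hchar, eval_charpoly_diagonal_add_vecMulVec, ← secular_sum_elim z ht0 htx,
      ← secular_comp_equiv e _ _ hz]
    congr 2
    · funext i; exact (he i).symm
    · funext i; rw [hg]
  -- The secular form describes the `N × N` matrix `H'ᴴ * H'`; the commutation rule for
  -- characteristic polynomials transfers it to `H' * H'ᴴ`. The powers of `t` balance because `k + 1
  -- + D = N`.
  have hcomm := congrArg (Polynomial.eval (t : ℂ)) (Matrix.charpoly_mul_comm' H' H'ᴴ)
  rw [Polynomial.eval_mul, Polynomial.eval_mul, hsec,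
    eval_charpoly_eq_prod_eigs (Matrix.isHermitian_mul_conjTranspose_self H')] at hcomm
  simp only [Polynomial.eval_pow, Polynomial.eval_X, Fintype.card_fin] at hcomm
  have hreal : t ^ N * ∏ i, (t - eigs (H' * H'ᴴ) i) =
      t ^ (k + 1) * (t ^ D * secular (snocZero x) (weightVec z) t) := by exact_mod_cast hcomm
  rw [← mul_assoc, ← pow_add, show k + 1 + D = N by omega] at hreal
  exact mul_left_cancel₀ (pow_ne_zero N ht0) hreal

/-! ### The law of the ordered eigenvalues of a Gaussian Gram matrix -/

theorem integrable_erlang_density (D : ℕ) :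
    Integrable (fun t : ℝ => Real.exp (-t) * t ^ D / D.factorial)
      (volume.restrict (Set.Ioi 0)) := by
  have h := (Real.GammaIntegral_convergent (s := (D + 1 : ℝ)) (by positivity)).div_const
    (D.factorial : ℝ)
  refine IntegrableOn.congr_fun h (fun t ht => ?_) measurableSet_Ioi
  simp only [add_sub_cancel_right, Real.rpow_natCast]

instance (D : ℕ) : IsFiniteMeasure (erlang D) := by
  unfold erlang
  exact isFiniteMeasure_withDensity_ofReal (integrable_erlang_density D).2

theorem map_norm_sq_complexGaussian :
    (complexGaussian 1).map (fun z => ‖z‖ ^ 2) = erlang 0 :=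
  Measure.ext_of_lintegral _ fun f hf => by
    rw [lintegral_map hf (by fun_prop), lintegral_complexGaussian_norm_sq hf]

theorem map_sum_norm_sq_gaussVec (D : ℕ) :
    (gaussVec (Fin (D + 1))).map (fun z => ∑ i, ‖z i‖ ^ 2) = erlang D :=
  Measure.ext_of_lintegral _ fun f hf => by
    rw [lintegral_map hf (by fun_prop), lintegral_gaussVec_sum_norm_sq D hf]

/-- The exponents of the laws of the coordinates of `weightVec`. -/
def weightExponent (k D : ℕ) : Fin (k + 1) → ℕ := Fin.snoc (α := fun _ => ℕ) (fun _ => 0) D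

/-- The entries of `weightVec` use disjoint groups of independent coordinates: single ones, and
finally a group of `D + 1`. -/
theorem map_weightVec (k D : ℕ) :
    (gaussVec (Fin k ⊕ Fin (D + 1))).map weightVec =
      Measure.pi fun i => erlang (weightExponent k D i) := by
  refine (Measure.pi_eq fun s hs => ?_).symm
  rw [Measure.map_apply measurable_weightVec (MeasurableSet.univ_pi hs)]
  have hmp := (measurePreserving_sumPiEquivProdPi_symm
    (fun _ : Fin k ⊕ Fin (D + 1) => complexGaussian 1)).symm
  let A : Set (Fin k → ℂ) := Set.univ.pi fun i => (fun z : ℂ => ‖z‖ ^ 2) ⁻¹' s i.castSucc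
  let B : Set (Fin (D + 1) → ℂ) := (fun z => ∑ i, ‖z i‖ ^ 2) ⁻¹' s (Fin.last k)
  have hAB : weightVec ⁻¹' (Set.univ.pi s) =
      (MeasurableEquiv.sumPiEquivProdPi (fun _ : Fin k ⊕ Fin (D + 1) => ℂ)) ⁻¹' (A ×ˢ B) := by
    ext z
    simp only [Set.mem_preimage, Set.mem_univ_pi, Set.mem_prod, A, B]
    rw [Fin.forall_fin_succ']
    simp only [weightVec_castSucc, weightVec_last]
    rfl
  have hA : MeasurableSet A := MeasurableSet.univ_pi fun i =>
    (by fun_prop : Measurable fun z : ℂ => ‖z‖ ^ 2) (hs i.castSucc)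
  have hB : MeasurableSet B :=
    (by fun_prop : Measurable fun z : Fin (D + 1) → ℂ => ∑ i, ‖z i‖ ^ 2) (hs (Fin.last k))
  rw [hAB]
  have h1 := hmp.measure_preimage (s := A ×ˢ B) (hA.prod hB).nullMeasurableSet
  refine h1.trans ?_
  rw [Measure.prod_prod, Fin.prod_univ_castSucc]
  congr 1
  · rw [Measure.pi_pi]
    refine Finset.prod_congr rfl fun i _ => ?_
    rw [← Measure.map_apply (by fun_prop) (hs _), map_norm_sq_complexGaussian]
    simp [weightExponent]
  · have := Measure.map_apply (μ := gaussVec (Fin (D + 1)))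
      (by fun_prop : Measurable fun z : Fin (D + 1) → ℂ => ∑ i, ‖z i‖ ^ 2) (hs (Fin.last k))
    rw [map_sum_norm_sq_gaussVec] at this
    refine this.symm.trans ?_
    simp [weightExponent]

theorem lintegral_weightVec (k D : ℕ) : ∃ c : ℝ≥0∞, ∀ f : (Fin (k + 1) → ℝ) → ℝ≥0∞,
    Measurable f → ∫⁻ z, f (weightVec z) ∂gaussVec (Fin k ⊕ Fin (D + 1)) =
      c * ∫⁻ w in {w : Fin (k + 1) → ℝ | ∀ i, 0 < w i}, f w *
        ENNReal.ofReal ((∏ i, Real.exp (-w i)) * w (Fin.last k) ^ D) := by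
  refine ⟨ENNReal.ofReal (D.factorial : ℝ)⁻¹, fun f hf => ?_⟩
  -- The absolute value makes `g` nonnegative on all of `ℝ`, as `pi_withDensity_ofReal` requires; it
  -- changes nothing on the positive half-line.
  let g : Fin (k + 1) → ℝ → ℝ := fun i t =>
    Real.exp (-t) * |t| ^ weightExponent k D i / (weightExponent k D i).factorial
  have hset : {w : Fin (k + 1) → ℝ | ∀ i, 0 < w i} = Set.univ.pi fun _ => Set.Ioi 0 := by
    ext w; simp
  have hg : ∀ i, Integrable (g i) (volume.restrict (Set.Ioi 0)) := fun i =>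
    IntegrableOn.congr_fun (integrable_erlang_density (weightExponent k D i))
      (fun t ht => by simp only [g, abs_of_pos (Set.mem_Ioi.1 ht)]) measurableSet_Ioi
  have herl : ∀ i, erlang (weightExponent k D i) =
      (volume.restrict (Set.Ioi 0)).withDensity fun t => ENNReal.ofReal (g i t) := by
    intro i
    refine withDensity_congr_ae ((ae_restrict_iff' measurableSet_Ioi).2
      (Filter.Eventually.of_forall fun t ht => ?_))
    simp only [g, abs_of_pos (Set.mem_Ioi.1 ht)]
  have hpi : (Measure.pi fun i => erlang (weightExponent k D i)) =
      ((volume : Measure (Fin (k + 1) → ℝ)).restrict {w | ∀ i, 0 < w i}).withDensity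
        fun w => ENNReal.ofReal (∏ i, g i (w i)) := by
    simp_rw [herl]
    rw [pi_withDensity_ofReal _ g hg fun i t => by positivity, hset, volume_pi,
      Measure.restrict_pi_pi]
  have hm : MeasurableSet {w : Fin (k + 1) → ℝ | ∀ i, 0 < w i} := by
    rw [hset]; exact MeasurableSet.univ_pi fun _ => measurableSet_Ioi
  have hgm : Measurable fun w : Fin (k + 1) → ℝ => ENNReal.ofReal (∏ i, g i (w i)) := by
    simp only [g]; fun_prop
  rw [← lintegral_map hf measurable_weightVec, map_weightVec, hpi,
    lintegral_withDensity_eq_lintegral_mul _ hgm hf, ← lintegral_const_mul _ (by fun_prop)]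
  refine setLIntegral_congr_fun hm fun w hw => ?_
  have hprod : ∏ i, g i (w i) =
      (D.factorial : ℝ)⁻¹ * ((∏ i, Real.exp (-w i)) * w (Fin.last k) ^ D) := by
    simp only [g, abs_of_pos (hw _)]
    rw [Fin.prod_univ_castSucc, Fin.prod_univ_castSucc (fun i => Real.exp (-w i))]
    simp [weightExponent]
    ring
  simp only [Pi.mul_apply]
  rw [hprod, ENNReal.ofReal_mul (by positivity)]
  ring

/-- The law of a `k × N` matrix with i.i.d. `CN(0, 1)` entries. -/
def gaussMat (k N : ℕ) : Measure (Fin k → Fin N → ℂ) := Measure.pi fun _ => gaussVec (Fin N)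

instance (k N : ℕ) : IsProbabilityMeasure (gaussMat k N) := by
  unfold gaussMat; infer_instance

theorem measurable_eigs_mul_conjTranspose {X : Type*} [MeasurableSpace X] {k N : ℕ}
    {f : X → Fin k → Fin N → ℂ} (hf : Measurable f) :
    Measurable fun x => eigs (Matrix.of (f x) * (Matrix.of (f x))ᴴ) := by
  refine measurable_eigs (fun i j => ?_) fun x => Matrix.isHermitian_mul_conjTranspose_self _
  simp only [Matrix.mul_apply, Matrix.conjTranspose_apply, Matrix.of_apply, RCLike.star_def]
  have : ∀ i j, Measurable fun x => f x i j := fun i j => by fun_prop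
  refine Finset.measurable_sum _ fun l _ => (this i l).mul ?_
  exact (Complex.continuous_conj.measurable).comp (this j l)

theorem measurable_comp_secularRoots {m : ℕ} {F : (Fin m → ℝ) → ℝ≥0∞} (hF : Measurable F)
    (x : Fin m → ℝ) : Measurable fun w => F (secularRoots x w) := by
  have h1 : Measurable fun w : Fin m → ℝ => (x, w) := measurable_prodMk_left
  have h2 : Measurable fun p : (Fin m → ℝ) × (Fin m → ℝ) => F (secularRoots p.1 p.2) :=
    Measurable.comp (g := F) hF measurable_secularRoots
  exact Measurable.comp (g := fun p : (Fin m → ℝ) × (Fin m → ℝ) => F (secularRoots p.1 p.2)) h2 h1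

theorem lintegral_gaussVec_comp_equiv {ι κ : Type*} [Fintype ι] [Fintype κ] (e : ι ≃ κ)
    {f : (κ → ℂ) → ℝ≥0∞} (hf : Measurable f) :
    ∫⁻ y, f (fun i => y (e.symm i)) ∂gaussVec ι = ∫⁻ z, f z ∂gaussVec κ := by
  have hmp := measurePreserving_piCongrLeft (fun _ : κ => complexGaussian 1) e
  refine Eq.trans (lintegral_congr fun y => ?_) (hmp.lintegral_comp hf)
  congr 1
  funext i
  obtain ⟨j, rfl⟩ := e.surjective i
  simp [MeasurableEquiv.coe_piCongrLeft, Equiv.piCongrLeft_apply_apply]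

/-- With `H` fixed, the unitary matrix from `eigs_cons` is fixed too, so it can be absorbed by the
invariance of the Gaussian law of the new row. -/
theorem lintegral_eigs_gaussVec {k N D : ℕ} (hN : k + (D + 1) = N) (H : Fin k → Fin N → ℂ)
    {F : (Fin (k + 1) → ℝ) → ℝ≥0∞} (hF : Measurable F) :
    ∫⁻ h, F (eigs (Matrix.of (Fin.cons (α := fun _ => Fin N → ℂ) h H) *
        (Matrix.of (Fin.cons (α := fun _ => Fin N → ℂ) h H))ᴴ)) ∂gaussVec (Fin N) =
      ∫⁻ z, F (secularRoots (snocZero (eigs (Matrix.of H * (Matrix.of H)ᴴ))) (weightVec z))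
        ∂gaussVec (Fin k ⊕ Fin (D + 1)) := by
  obtain ⟨V, hV, e, he⟩ := eigs_cons hN H
  simp_rw [he]
  generalize snocZero (eigs (Matrix.of H * (Matrix.of H)ᴴ)) = x
  have hm : Measurable fun z : Fin k ⊕ Fin (D + 1) → ℂ => F (secularRoots x (weightVec z)) :=
    (measurable_comp_secularRoots hF x).comp measurable_weightVec
  rw [← lintegral_gaussVec_comp_equiv e hm]
  refine lintegral_gaussVec_mulVec hV (f := fun y => F (secularRoots x
    (weightVec fun i => y (e.symm i)))) ?_
  have h2 : Measurable fun (y : Fin N → ℂ) (i : Fin k ⊕ Fin (D + 1)) => y (e.symm i) := by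
    fun_prop
  exact hm.comp h2

/-- The ordered eigenvalues of `H Hᴴ`, `H` being `k × N` Gaussian with `k ≤ N`, have a density
proportional to `laguerre k (N - k)`. -/
theorem lintegral_eigs_gaussMat (N k : ℕ) (hk : k ≤ N) : ∃ c : ℝ≥0∞,
    ∀ F : (Fin k → ℝ) → ℝ≥0∞, Measurable F →
    ∫⁻ H, F (eigs (Matrix.of H * (Matrix.of H)ᴴ)) ∂gaussMat k N =
      c * ∫⁻ x in chamber k, F x * ENNReal.ofReal (laguerre k (N - k) x) := by
  induction k with
  | zero =>
    refine ⟨1, fun F _ => ?_⟩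
    have h1 : ∀ x : Fin 0 → ℝ, F x = F 0 := fun x => congrArg F (Subsingleton.elim _ _)
    have h2 : chamber 0 = Set.univ := by
      ext x
      simp only [chamber, Set.mem_univ, iff_true]
      exact ⟨fun i => i.elim0, fun i => i.elim0⟩
    have h3 : ∀ x : Fin 0 → ℝ, laguerre 0 (N - 0) x = 1 := fun x => by
      simp [laguerre, absVdm]
    simp_rw [h3, h1]
    have h4 : (volume : Measure (Fin 0 → ℝ)) Set.univ = 1 := by simp [volume_pi]
    simp [h2, h4]
  | succ k ih =>
    obtain ⟨D, hD⟩ : ∃ D, k + (D + 1) = N := ⟨N - k - 1, by omega⟩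
    obtain ⟨c₁, h₁⟩ := ih (by omega)
    obtain ⟨c₂, h₂⟩ := lintegral_weightVec k D
    obtain ⟨c₃, h₃⟩ := lintegral_laguerre_succ k D
    have hNk : N - k = D + 1 := by omega
    have hNk' : N - (k + 1) = D := by omega
    rw [hNk] at h₁
    rw [hNk']
    refine ⟨c₁ * (c₂ * c₃), fun F hF => ?_⟩
    have hmp := measurePreserving_piFinSuccAbove (fun _ : Fin (k + 1) => gaussVec (Fin N)) 0
    have hcons : Measurable fun p : (Fin N → ℂ) × (Fin k → Fin N → ℂ) =>
        (Fin.cons (α := fun _ => Fin N → ℂ) p.1 p.2 : Fin (k + 1) → Fin N → ℂ) := by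
      refine measurable_pi_lambda _ fun i => ?_
      induction i using Fin.cases with
      | zero => exact measurable_fst
      | succ i => simpa using (by fun_prop : Measurable fun p : (Fin N → ℂ) × (Fin k → Fin N → ℂ) => p.2 i)
    let Ψ : (Fin N → ℂ) × (Fin k → Fin N → ℂ) → ℝ≥0∞ := fun p =>
      F (eigs (Matrix.of (Fin.cons (α := fun _ => Fin N → ℂ) p.1 p.2) *
        (Matrix.of (Fin.cons (α := fun _ => Fin N → ℂ) p.1 p.2))ᴴ))
    have hΨ : Measurable Ψ := hF.comp (measurable_eigs_mul_conjTranspose hcons)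
    have step1 : ∫⁻ H, F (eigs (Matrix.of H * (Matrix.of H)ᴴ)) ∂gaussMat (k + 1) N =
        ∫⁻ p, Ψ p ∂(gaussVec (Fin N)).prod (gaussMat k N) := by
      refine Eq.trans (lintegral_congr fun H => ?_) (hmp.lintegral_comp hΨ)
      have : (Fin.cons (α := fun _ => Fin N → ℂ) (H 0) (fun j => H j.succ)) = H := Fin.cons_self_tail H
      change _ = F (eigs (Matrix.of (Fin.cons (α := fun _ => Fin N → ℂ) (H 0) (fun j => H j.succ)) *
        (Matrix.of (Fin.cons (α := fun _ => Fin N → ℂ) (H 0) (fun j => H j.succ)))ᴴ))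
      rw [this]
    let G : (Fin k → ℝ) → ℝ≥0∞ := fun x =>
      ∫⁻ w in {w : Fin (k + 1) → ℝ | ∀ i, 0 < w i}, F (secularRoots (snocZero x) w) *
        ENNReal.ofReal ((∏ i, Real.exp (-w i)) * w (Fin.last k) ^ D)
    have hG : Measurable G := by
      refine Measurable.lintegral_prod_right' (f := fun p : (Fin k → ℝ) × (Fin (k + 1) → ℝ) =>
        F (secularRoots (snocZero p.1) p.2) *
          ENNReal.ofReal ((∏ i, Real.exp (-p.2 i)) * p.2 (Fin.last k) ^ D)) ?_
      refine Measurable.mul ?_ (by fun_prop)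
      have h1 : Measurable fun p : (Fin k → ℝ) × (Fin (k + 1) → ℝ) => (snocZero p.1, p.2) :=
        (measurable_snocZero.comp measurable_fst).prodMk measurable_snd
      have h2 : Measurable fun p : (Fin (k + 1) → ℝ) × (Fin (k + 1) → ℝ) =>
        F (secularRoots p.1 p.2) := Measurable.comp (g := F) hF measurable_secularRoots
      exact Measurable.comp (g := fun p : (Fin (k + 1) → ℝ) × (Fin (k + 1) → ℝ) =>
        F (secularRoots p.1 p.2)) h2 h1
    have step2 : ∀ H : Fin k → Fin N → ℂ, ∫⁻ h, Ψ (h, H) ∂gaussVec (Fin N) =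
        c₂ * G (eigs (Matrix.of H * (Matrix.of H)ᴴ)) := by
      intro H
      refine (lintegral_eigs_gaussVec hD H hF).trans ?_
      generalize eigs (Matrix.of H * (Matrix.of H)ᴴ) = x
      exact h₂ (fun w => F (secularRoots (snocZero x) w)) (measurable_comp_secularRoots hF _)
    have hGe : Measurable fun H : Fin k → Fin N → ℂ => G (eigs (Matrix.of H * (Matrix.of H)ᴴ)) :=
      hG.comp (measurable_eigs_mul_conjTranspose (f := fun H => H) measurable_id)
    have step3 : ∫⁻ x in chamber k, G x * ENNReal.ofReal (laguerre k (D + 1) x) =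
        c₃ * ∫⁻ μ in chamber (k + 1), F μ * ENNReal.ofReal (laguerre (k + 1) D μ) := by
      rw [← h₃ F hF]
      exact lintegral_congr fun x => mul_comm _ _
    -- The new row is integrated first. What remains is a function `G` of the old ordered
    -- eigenvalues alone, to which the induction hypothesis applies.
    rw [step1, lintegral_prod_symm' _ hΨ, lintegral_congr step2, lintegral_const_mul _ hGe,
      h₁ G hG, step3]
    ring

/-! ### The density on the ordered domain -/

theorem measurableSet_orderedDomain (n : ℕ) : MeasurableSet (orderedDomain n) := by
  have : orderedDomain n =
      (⋂ i, ⋂ j, {x : Fin n → ℝ | i ≤ j → x j ≤ x i}) ∩ ⋂ i, {x | 0 ≤ x i} := by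
    ext x
    simp [orderedDomain, Antitone]
  rw [this]
  refine MeasurableSet.inter ?_ ?_
  · exact MeasurableSet.iInter fun i => MeasurableSet.iInter fun j =>
      MeasurableSet.imp (MeasurableSet.const _)
        (measurableSet_le (measurable_pi_apply j) (measurable_pi_apply i))
  · exact MeasurableSet.iInter fun i => measurableSet_le measurable_const (measurable_pi_apply i)

theorem laguerre_nonneg {k e : ℕ} {x : Fin k → ℝ} (hx : x ∈ orderedDomain k) :
    0 ≤ laguerre k e x := by
  unfold laguerre
  have := Finset.prod_nonneg fun i (_ : i ∈ Finset.univ) => hx.2 i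
  positivity

/-- The two domains differ where a coordinate vanishes, which is a null set, or where coordinates
coincide, and there the Vandermonde factor is zero. -/
theorem lintegral_orderedDomain_laguerre {k e : ℕ} (F : (Fin k → ℝ) → ℝ≥0∞) :
    ∫⁻ x in orderedDomain k, F x * ENNReal.ofReal (laguerre k e x) =
      ∫⁻ x in chamber k, F x * ENNReal.ofReal (laguerre k e x) := by
  rw [← lintegral_indicator (measurableSet_orderedDomain k),
    ← lintegral_indicator (measurableSet_chamber k)]
  have hnull : ∀ᵐ x : Fin k → ℝ, ∀ i, x i ≠ 0 := by
    rw [ae_all_iff]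
    intro i
    have := Measure.pi_hyperplane (fun _ : Fin k => (volume : Measure ℝ)) i 0
    rw [← volume_pi] at this
    rw [ae_iff]
    simpa using this
  refine lintegral_congr_ae (hnull.mono fun x hx => ?_)
  by_cases h1 : x ∈ chamber k
  · have h2 : x ∈ orderedDomain k := ⟨h1.1.antitone, fun i => (h1.2 i).le⟩
    simp only [Set.indicator_of_mem h1, Set.indicator_of_mem h2]
  · by_cases h2 : x ∈ orderedDomain k
    · have hni : ¬ Function.Injective x := fun hinj =>
        h1 ⟨h2.1.strictAnti_of_injective hinj, fun i => lt_of_le_of_ne (h2.2 i) (hx i).symm⟩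
      have h0 : absVdm x = 0 := by
        unfold absVdm
        rw [abs_eq_zero]
        by_contra h
        exact hni (Matrix.det_vandermonde_ne_zero_iff.1 h)
      simp only [Set.indicator_of_notMem h1, Set.indicator_of_mem h2, laguerre, h0]
      simp
    · simp only [Set.indicator_of_notMem h1, Set.indicator_of_notMem h2]

/-- The normalised law with density proportional to `laguerre k e` on the ordered domain. -/
def laguerreLaw (k e : ℕ) : Measure (Fin k → ℝ) :=
  (volume.restrict (orderedDomain k)).withDensity fun x =>
    ENNReal.ofReal (1 / (∫ x in orderedDomain k, laguerre k e x) * laguerre k e x)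

/-- Testing the proportionality on the constant `1` gives `1 = c * Z`, where `Z` is the integral of
the unnormalised density. This single equation shows that `Z` is finite and nonzero and that `c =
Z⁻¹`, so integrability of the density needs no separate estimate. -/
theorem laguerreLaw_spec (N k : ℕ) (hk : k ≤ N) :
    IntegrableOn (laguerre k (N - k)) (orderedDomain k) ∧
    0 < ∫ x in orderedDomain k, laguerre k (N - k) x ∧
    (gaussMat k N).map (fun H => eigs (Matrix.of H * (Matrix.of H)ᴴ)) = laguerreLaw k (N - k) := by
  obtain ⟨c, hc⟩ := lintegral_eigs_gaussMat N k hk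
  simp_rw [← lintegral_orderedDomain_laguerre] at hc
  have hm : Measurable fun x => ENNReal.ofReal (laguerre k (N - k) x) :=
    ENNReal.measurable_ofReal.comp continuous_laguerre.measurable
  have h1 := hc (fun _ => 1) measurable_const
  simp only [lintegral_const, measure_univ, mul_one, one_mul] at h1
  set Z := ∫⁻ x in orderedDomain k, ENNReal.ofReal (laguerre k (N - k) x) with hZ
  have hZ0 : Z ≠ 0 := fun h => by rw [h, mul_zero] at h1; exact one_ne_zero h1
  have hZt : Z ≠ ⊤ := fun h => by
    rw [h] at h1
    by_cases hc0 : c = 0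
    · rw [hc0, zero_mul] at h1; exact one_ne_zero h1
    · rw [ENNReal.mul_top hc0] at h1; exact ENNReal.one_ne_top h1
  have hnn : 0 ≤ᵐ[volume.restrict (orderedDomain k)] laguerre k (N - k) :=
    (ae_restrict_iff' (measurableSet_orderedDomain k)).2
      (Filter.Eventually.of_forall fun x hx => laguerre_nonneg hx)
  have hint : IntegrableOn (laguerre k (N - k)) (orderedDomain k) := by
    refine ⟨continuous_laguerre.aestronglyMeasurable, ?_⟩
    rw [hasFiniteIntegral_iff_ofReal hnn]
    exact lt_top_iff_ne_top.2 hZt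
  have hC : ∫ x in orderedDomain k, laguerre k (N - k) x = Z.toReal :=
    integral_eq_lintegral_of_nonneg_ae hnn continuous_laguerre.aestronglyMeasurable
  have hCpos : 0 < ∫ x in orderedDomain k, laguerre k (N - k) x := by
    rw [hC]; exact ENNReal.toReal_pos hZ0 hZt
  have hcZ : c = Z⁻¹ := ENNReal.eq_inv_of_mul_eq_one_left h1.symm
  refine ⟨hint, hCpos, ?_⟩
  refine Measure.ext_of_lintegral _ fun F hF => ?_
  rw [lintegral_map hF (measurable_eigs_mul_conjTranspose (f := fun H => H) measurable_id), hc F hF,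
    laguerreLaw, lintegral_withDensity_eq_lintegral_mul _ (by
      exact ENNReal.measurable_ofReal.comp (continuous_laguerre.measurable.const_mul _)) hF,
    ← lintegral_const_mul _ (show Measurable fun x =>
      F x * ENNReal.ofReal (laguerre k (N - k) x) from hF.mul hm)]
  refine lintegral_congr fun x => ?_
  simp only [Pi.mul_apply]
  rw [ENNReal.ofReal_mul (one_div_nonneg.2 hCpos.le), hC, one_div, ENNReal.ofReal_inv_of_pos
    (ENNReal.toReal_pos hZ0 hZt), ENNReal.ofReal_toReal hZt, hcZ]
  ring

theorem densityFactor_eq_laguerre {k e : ℕ} (x : Fin k → ℝ) :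
    (∏ m, Real.exp (-x m) * x m ^ e) * ∏ m, ∏ m' ∈ Finset.Iio m, (x m - x m') ^ 2 =
      laguerre k e x := by
  unfold laguerre
  rw [absVdm_eq, Finset.prod_mul_distrib, Finset.prod_pow,
    ← Finset.prod_pow Finset.univ 2 (fun i => ∏ j ∈ Finset.Iio i, |x i - x j|)]
  congr 1
  refine Finset.prod_congr rfl fun i _ => ?_
  rw [← Finset.prod_pow]
  exact Finset.prod_congr rfl fun j _ => (sq_abs _).symm

theorem eval_densityPoly {Nt Nr : ℕ} (x : Fin (min Nt Nr) → ℝ) :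
    (∏ m, Real.exp (-x m)) * MvPolynomial.eval x (densityPoly Nt Nr) =
      laguerre (min Nt Nr) ((Nt : ℤ) - (Nr : ℤ)).natAbs x := by
  rw [← densityFactor_eq_laguerre, densityPoly]
  simp only [map_mul, map_prod, map_pow, map_sub, MvPolynomial.eval_X]
  rw [Finset.prod_mul_distrib, mul_assoc]

theorem normConst_eq (Nt Nr : ℕ) : normConst Nt Nr =
    ∫ x in orderedDomain (min Nt Nr), laguerre (min Nt Nr) ((Nt : ℤ) - (Nr : ℤ)).natAbs x := by
  unfold normConst
  simp_rw [eval_densityPoly]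

theorem eigenvalueDensity_eq {Nt Nr : ℕ} (x : Fin (min Nt Nr) → ℝ) :
    eigenvalueDensity Nt Nr x = 1 / normConst Nt Nr *
      laguerre (min Nt Nr) ((Nt : ℤ) - (Nr : ℤ)).natAbs x := by
  unfold eigenvalueDensity
  rw [densityFactor_eq_laguerre]

/-- The law of the ordered eigenvalues of the Gaussian channel. -/
def eigenvalueLaw (Nt Nr : ℕ) : Measure (Fin (min Nt Nr) → ℝ) :=
  laguerreLaw (min Nt Nr) ((Nt : ℤ) - (Nr : ℤ)).natAbs

theorem natAbs_sub_eq (Nt Nr : ℕ) : ((Nt : ℤ) - (Nr : ℤ)).natAbs = max Nt Nr - min Nt Nr := by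
  omega

theorem map_eigs_eq_eigenvalueLaw (Nt Nr : ℕ) :
    (gaussMat (min Nt Nr) (max Nt Nr)).map (fun H => eigs (Matrix.of H * (Matrix.of H)ᴴ)) =
      eigenvalueLaw Nt Nr := by
  unfold eigenvalueLaw
  rw [natAbs_sub_eq]
  exact (laguerreLaw_spec _ _ min_le_max).2.2

theorem normConst_pos (Nt Nr : ℕ) : 0 < normConst Nt Nr := by
  rw [normConst_eq, natAbs_sub_eq]
  exact (laguerreLaw_spec _ _ min_le_max).2.1

instance (Nt Nr : ℕ) : IsProbabilityMeasure (eigenvalueLaw Nt Nr) := by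
  rw [← map_eigs_eq_eigenvalueLaw]
  exact Measure.isProbabilityMeasure_map
    (measurable_eigs_mul_conjTranspose (f := fun H => H) measurable_id).aemeasurable

theorem eigenvalueLaw_ae_pos (Nt Nr : ℕ) : ∀ᵐ x ∂eigenvalueLaw Nt Nr, ∀ i, 0 < x i := by
  have hnull : ∀ᵐ x : Fin (min Nt Nr) → ℝ, ∀ i, x i ≠ 0 := by
    rw [ae_all_iff]
    intro i
    have := Measure.pi_hyperplane (fun _ : Fin (min Nt Nr) => (volume : Measure ℝ)) i 0
    rw [← volume_pi] at this
    rw [ae_iff]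
    simpa using this
  refine (withDensity_absolutelyContinuous _ _).ae_le ?_
  refine (ae_restrict_iff' (measurableSet_orderedDomain _)).2 ?_
  exact hnull.mono fun x hx hx' i => lt_of_le_of_ne (hx'.2 i) (hx i).symm

theorem integral_eigenvalueLaw {Nt Nr : ℕ} (f : (Fin (min Nt Nr) → ℝ) → ℝ) :
    ∫ x, f x ∂eigenvalueLaw Nt Nr =
      ∫ x in orderedDomain (min Nt Nr), f x * eigenvalueDensity Nt Nr x := by
  unfold eigenvalueLaw laguerreLaw
  rw [integral_withDensity_eq_integral_toReal_smul (by
      exact ENNReal.measurable_ofReal.comp (continuous_laguerre.measurable.const_mul _))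
    (Filter.Eventually.of_forall fun x => ENNReal.ofReal_lt_top)]
  refine setIntegral_congr_fun (measurableSet_orderedDomain _) fun x hx => ?_
  rw [← normConst_eq, ENNReal.toReal_ofReal (mul_nonneg
    (one_div_nonneg.2 (normConst_pos Nt Nr).le) (laguerre_nonneg hx)), ← eigenvalueDensity_eq,
    smul_eq_mul, mul_comm]

/-! ### The closed form of the moment generating function -/

/-- The right side, as a function of `y`, is minus an antiderivative: differentiating the truncated
exponential series drops its top term, so after the product rule only the term in `x ^ p` survives.
-/
theorem integral_Ioi_pow_mul_exp {c : ℝ} (hc : 0 < c) (p : ℕ) {y : ℝ} (hy : 0 ≤ y) :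
    IntegrableOn (fun x => x ^ p * Real.exp (-(c * x))) (Set.Ioi y) ∧
    ∫ x in Set.Ioi y, x ^ p * Real.exp (-(c * x)) =
      p.factorial / c ^ (p + 1) * Real.exp (-(c * y)) *
        ∑ j ∈ Finset.range (p + 1), (c * y) ^ j / j.factorial := by
  let g : ℝ → ℝ := fun x => -(p.factorial / c ^ (p + 1) * Real.exp (-(c * x)) *
    ∑ j ∈ Finset.range (p + 1), (c * x) ^ j / j.factorial)
  have hsum : ∀ x, HasDerivAt (fun x => ∑ j ∈ Finset.range (p + 1), (c * x) ^ j / j.factorial)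
      (c * ∑ j ∈ Finset.range p, (c * x) ^ j / j.factorial) x := by
    intro x
    have h1 : ∀ j ∈ Finset.range (p + 1), HasDerivAt (fun x : ℝ => (c * x) ^ j / j.factorial)
        (j * (c * x) ^ (j - 1) * c / j.factorial) x := by
      intro j _
      have := (((hasDerivAt_id x).const_mul c).pow j).div_const (j.factorial : ℝ)
      simpa using this
    have h2 := HasDerivAt.fun_sum h1
    refine h2.congr_deriv ?_
    rw [Finset.sum_range_succ', Finset.mul_sum]
    simp only [Nat.cast_zero, zero_mul, zero_div, add_zero, Nat.add_sub_cancel]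
    refine Finset.sum_congr rfl fun j _ => ?_
    rw [Nat.factorial_succ]
    push_cast
    have h3 : (j.factorial : ℝ) ≠ 0 := by positivity
    have h4 : (j + 1 : ℝ) ≠ 0 := by positivity
    field_simp
  have hderiv : ∀ x ∈ Set.Ici y, HasDerivAt g (x ^ p * Real.exp (-(c * x))) x := by
    intro x _
    have h1 : HasDerivAt (fun x : ℝ => Real.exp (-(c * x))) (Real.exp (-(c * x)) * (-c)) x := by
      have := (((hasDerivAt_id x).const_mul c).neg).exp
      simpa using this
    have h2 := ((h1.const_mul (p.factorial / c ^ (p + 1) : ℝ)).mul (hsum x)).neg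
    refine h2.congr_deriv ?_
    rw [Finset.sum_range_succ, mul_pow]
    have h3 : (p.factorial : ℝ) ≠ 0 := by positivity
    field_simp
    ring
  have hpos : ∀ x ∈ Set.Ioi y, 0 ≤ x ^ p * Real.exp (-(c * x)) := fun x hx =>
    mul_nonneg (pow_nonneg (hy.trans (le_of_lt hx)) _) (Real.exp_pos _).le
  have hlim : Filter.Tendsto g Filter.atTop (nhds 0) := by
    have hcx : Filter.Tendsto (fun x : ℝ => c * x) Filter.atTop Filter.atTop :=
      Filter.tendsto_id.const_mul_atTop hc
    have h1 : ∀ j ∈ Finset.range (p + 1), Filter.Tendsto (fun x : ℝ =>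
        (c * x) ^ j * Real.exp (-(c * x)) / j.factorial) Filter.atTop (nhds (0 / j.factorial)) :=
      fun j _ => ((Real.tendsto_pow_mul_exp_neg_atTop_nhds_zero j).comp hcx).div_const _
    have h2 := ((tendsto_finsetSum _ h1).const_mul (p.factorial / c ^ (p + 1) : ℝ)).neg
    simp only [zero_div, Finset.sum_const_zero, mul_zero, neg_zero] at h2
    refine h2.congr fun x => ?_
    simp only [g, Finset.mul_sum]
    congr 1
    refine Finset.sum_congr rfl fun j _ => ?_
    ring
  refine ⟨integrableOn_Ioi_deriv_of_nonneg' hderiv hpos hlim, ?_⟩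
  rw [integral_Ioi_of_hasDerivAt_of_nonneg' hderiv hpos hlim]
  simp only [g]
  ring

theorem lintegral_Ici_pow_mul_exp {c : ℝ} (hc : 0 < c) (p : ℕ) {y : ℝ} (hy : 0 ≤ y) :
    ∫⁻ x in Set.Ici y, ENNReal.ofReal (x ^ p * Real.exp (-(c * x))) =
      ENNReal.ofReal (p.factorial / c ^ (p + 1) * Real.exp (-(c * y)) *
        ∑ j ∈ Finset.range (p + 1), (c * y) ^ j / j.factorial) := by
  obtain ⟨h1, h2⟩ := integral_Ioi_pow_mul_exp hc p hy
  rw [← h2, ofReal_integral_eq_lintegral_ofReal h1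
    ((ae_restrict_iff' measurableSet_Ioi).2 (Filter.Eventually.of_forall fun x hx =>
      mul_nonneg (pow_nonneg (hy.trans (le_of_lt hx)) _) (Real.exp_pos _).le))]
  exact (setLIntegral_congr Ioi_ae_eq_Ici).symm

/-- The factor `∏ e^(-(1 + a m) x m) (x m)^(β m)`. -/
def expMonomial {n : ℕ} (a : Fin n → ℝ) (β : Fin n → ℕ) (x : Fin n → ℝ) : ℝ :=
  ∏ m, (Real.exp (-((1 + a m) * x m)) * x m ^ β m)

theorem expMonomial_nonneg {n : ℕ} (a : Fin n → ℝ) (β : Fin n → ℕ) {x : Fin n → ℝ}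
    (hx : ∀ m, 0 ≤ x m) : 0 ≤ expMonomial a β x :=
  Finset.prod_nonneg fun m _ => mul_nonneg (Real.exp_pos _).le (pow_nonneg (hx m) _)

theorem nestedSum_nonneg {n : ℕ} {c : ℝ} (hc : 0 ≤ c) (i : ℕ) {a : Fin n → ℝ}
    (ha : ∀ m, 0 ≤ a m) (β : Fin n → ℕ) : 0 ≤ nestedSum n c i a β := by
  induction n generalizing c i with
  | zero => simp [nestedSum]
  | succ n ih =>
    have h0 := ha 0
    cases n with
    | zero =>
      simp only [nestedSum]
      positivity
    | succ n =>
      simp only [nestedSum]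
      refine mul_nonneg (by positivity) (Finset.sum_nonneg fun j _ => ?_)
      exact ih (by positivity) j (fun m => ha m.succ) _

theorem mem_orderedDomain_cons {n : ℕ} (x₀ : ℝ) (y : Fin (n + 1) → ℝ) :
    (Fin.cons (α := fun _ => ℝ) x₀ y : Fin (n + 2) → ℝ) ∈ orderedDomain (n + 2) ↔
      y ∈ orderedDomain (n + 1) ∧ x₀ ∈ Set.Ici (y 0) := by
  constructor
  · rintro ⟨h1, h2⟩
    refine ⟨⟨fun i j hij => ?_, fun m => ?_⟩, ?_⟩
    · simpa using h1 (Fin.succ_le_succ_iff.2 hij)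
    · simpa using h2 m.succ
    · simpa using h1 (Fin.zero_le (1 : Fin (n + 2)))
  · rintro ⟨⟨h1, h2⟩, h3⟩
    refine ⟨fun i j hij => ?_, fun m => ?_⟩
    · induction j using Fin.cases with
      | zero =>
        have : i = 0 := Fin.le_zero_iff.1 hij
        rw [this]
      | succ j =>
        induction i using Fin.cases with
        | zero =>
          rw [Fin.cons_succ, Fin.cons_zero]
          exact (h1 (Fin.zero_le j)).trans h3
        | succ i =>
          rw [Fin.cons_succ, Fin.cons_succ]
          exact h1 (Fin.succ_le_succ_iff.1 hij)
    · induction m using Fin.cases with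
      | zero => rw [Fin.cons_zero]; exact (h2 0).trans h3
      | succ m => rw [Fin.cons_succ]; exact h2 m

@[fun_prop]
theorem measurable_expMonomial {n : ℕ} (a : Fin n → ℝ) (β : Fin n → ℕ) :
    Measurable (expMonomial a β) := by
  unfold expMonomial; fun_prop

/-- The iterated integral behind `nestedSum`. -/
theorem lintegral_nestedSum (n : ℕ) {c : ℝ} (hc : 0 ≤ c) (i : ℕ) {a : Fin (n + 1) → ℝ}
    (ha : ∀ m, 0 ≤ a m) (β : Fin (n + 1) → ℕ) :
    ∫⁻ x in orderedDomain (n + 1), ENNReal.ofReal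
      ((c * x 0) ^ i / i.factorial * Real.exp (-(c * x 0)) * expMonomial a β x) =
      ENNReal.ofReal (nestedSum (n + 1) c i a β) := by
  -- The factor `(c * x 0) ^ i / i! * exp (-(c * x 0))` is one term of the tail integral over the
  -- preceding larger variable. Integrating `x 0` from the next variable to infinity reproduces a
  -- sum of such factors, with `c` replaced by `c + (1 + a 0)` and `i` by `j ≤ β 0 + i`.
  induction n generalizing c i with
  | zero =>
    have hc' : 0 < c + (1 + a 0) := by linarith [ha 0]
    have hmp := volume_preserving_piUnique (fun _ : Fin 1 => ℝ)
    have hpre : orderedDomain 1 = (MeasurableEquiv.piUnique (fun _ : Fin 1 => ℝ)) ⁻¹' Set.Ici 0 := by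
      ext x
      constructor
      · exact fun h => h.2 0
      · exact fun h => ⟨fun i j _ => by rw [Subsingleton.elim i j], fun m => by
          rw [Subsingleton.elim m 0]; exact h⟩
    rw [hpre]
    have h1 := hmp.setLIntegral_comp_preimage (s := Set.Ici 0) measurableSet_Ici
      (f := fun t => ENNReal.ofReal ((c * t) ^ i / i.factorial * Real.exp (-(c * t)) *
        (Real.exp (-((1 + a 0) * t)) * t ^ β 0))) (by fun_prop)
    have h2 : ∀ t : ℝ, ENNReal.ofReal ((c * t) ^ i / i.factorial * Real.exp (-(c * t)) *
        (Real.exp (-((1 + a 0) * t)) * t ^ β 0)) = ENNReal.ofReal (c ^ i / i.factorial) *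
          ENNReal.ofReal (t ^ (β 0 + i) * Real.exp (-((c + (1 + a 0)) * t))) := by
      intro t
      rw [← ENNReal.ofReal_mul (by positivity), add_mul c, neg_add, Real.exp_add]
      congr 1
      ring
    refine Eq.trans (lintegral_congr fun x => ?_) (h1.trans ?_)
    · simp [expMonomial, MeasurableEquiv.piUnique]
    · simp_rw [h2]
      rw [lintegral_const_mul _ (by fun_prop), lintegral_Ici_pow_mul_exp hc' _ le_rfl,
        ← ENNReal.ofReal_mul (by positivity)]
      congr 1
      have h3 : ∑ j ∈ Finset.range (β 0 + i + 1), ((c + (1 + a 0)) * 0) ^ j / (j.factorial : ℝ) = 1 := by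
        rw [Finset.sum_range_succ']
        simp
      rw [h3]
      simp only [nestedSum, mul_zero, neg_zero, Real.exp_zero, mul_one]
      -- The quotient `(i + β 0)! / i!` left by the tail integral is the rising factorial in
      -- `nestedSum`.
      have h4 := Nat.factorial_mul_ascFactorial i (β 0)
      rw [add_comm (β 0) i, ← h4]
      push_cast
      have : (i.factorial : ℝ) ≠ 0 := by positivity
      field_simp
  | succ n ih =>
    have hc' : 0 < c + (1 + a 0) := by linarith [ha 0]
    set c' := c + (1 + a 0) with hc'def
    have hmp := (volume_preserving_piFinSuccAbove (fun _ : Fin (n + 2) => ℝ) 0).symm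
    let f : (Fin (n + 2) → ℝ) → ℝ≥0∞ := fun x => ENNReal.ofReal
      ((c * x 0) ^ i / i.factorial * Real.exp (-(c * x 0)) * expMonomial a β x)
    have hf : Measurable f := by simp only [f]; fun_prop
    have hfi : Measurable ((orderedDomain (n + 2)).indicator f) :=
      hf.indicator (measurableSet_orderedDomain _)
    have h1 : ∫⁻ x in orderedDomain (n + 2), f x = ∫⁻ y, ∫⁻ x₀,
        (orderedDomain (n + 2)).indicator f (Fin.cons (α := fun _ => ℝ) x₀ y) := by
      rw [← lintegral_indicator (measurableSet_orderedDomain _), ← hmp.lintegral_comp hfi,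
        Measure.volume_eq_prod, lintegral_prod_symm' (fun p => (orderedDomain (n + 2)).indicator f
          ((MeasurableEquiv.piFinSuccAbove (fun _ : Fin (n + 2) => ℝ) 0).symm p))
          (hfi.comp (MeasurableEquiv.measurable _))]
      refine lintegral_congr fun y => lintegral_congr fun x₀ => ?_
      simp [MeasurableEquiv.piFinSuccAbove]
      rfl
    let K : ℝ := ((i + 1).ascFactorial (β 0) : ℝ) * c ^ i / c' ^ (β 0 + i + 1)
    have hK : 0 ≤ K := by positivity
    have h2 : ∀ y, ∫⁻ x₀, (orderedDomain (n + 2)).indicator f (Fin.cons (α := fun _ => ℝ) x₀ y) =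
        (orderedDomain (n + 1)).indicator (fun y => ENNReal.ofReal K *
          ∑ j ∈ Finset.range (β 0 + i + 1), ENNReal.ofReal ((c' * y 0) ^ j / j.factorial *
            Real.exp (-(c' * y 0)) * expMonomial (Fin.tail a) (Fin.tail β) y)) y := by
      intro y
      by_cases hy : y ∈ orderedDomain (n + 1)
      · rw [Set.indicator_of_mem hy]
        have hE := expMonomial_nonneg (Fin.tail a) (Fin.tail β) hy.2
        have h3 : ∀ x₀ : ℝ, (orderedDomain (n + 2)).indicator f (Fin.cons (α := fun _ => ℝ) x₀ y) =
            (Set.Ici (y 0)).indicator (fun t => ENNReal.ofReal (c ^ i / i.factorial *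
              expMonomial (Fin.tail a) (Fin.tail β) y) *
              ENNReal.ofReal (t ^ (β 0 + i) * Real.exp (-(c' * t)))) x₀ := by
          intro x₀
          by_cases hx : x₀ ∈ Set.Ici (y 0)
          · rw [Set.indicator_of_mem hx, Set.indicator_of_mem
              ((mem_orderedDomain_cons x₀ y).2 ⟨hy, hx⟩), ← ENNReal.ofReal_mul (by positivity)]
            simp only [f, expMonomial]
            rw [Fin.prod_univ_succ]
            simp only [Fin.cons_zero, Fin.cons_succ, Fin.tail, hc'def]
            rw [add_mul c, neg_add, Real.exp_add]
            congr 1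
            ring
          · rw [Set.indicator_of_notMem hx, Set.indicator_of_notMem fun h =>
              hx ((mem_orderedDomain_cons x₀ y).1 h).2]
        rw [lintegral_congr h3, lintegral_indicator measurableSet_Ici,
          lintegral_const_mul _ (by fun_prop), lintegral_Ici_pow_mul_exp hc' _ (hy.2 0),
          ← ENNReal.ofReal_mul (by positivity), ← ENNReal.ofReal_sum_of_nonneg,
          ← ENNReal.ofReal_mul hK]
        · congr 1
          rw [Finset.mul_sum, Finset.mul_sum, Finset.mul_sum]
          refine Finset.sum_congr rfl fun j _ => ?_
          simp only [K]
          have h4 := Nat.factorial_mul_ascFactorial i (β 0)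
          rw [add_comm (β 0) i, ← h4]
          push_cast
          have : (i.factorial : ℝ) ≠ 0 := by positivity
          field_simp
        · intro j _
          have := mul_nonneg hc'.le (hy.2 0)
          positivity
      · rw [Set.indicator_of_notMem hy]
        have : ∀ x₀ : ℝ, (orderedDomain (n + 2)).indicator f
            (Fin.cons (α := fun _ => ℝ) x₀ y) = 0 := fun x₀ =>
          Set.indicator_of_notMem (fun h => hy ((mem_orderedDomain_cons x₀ y).1 h).1) _
        simp [this]
    have h5 : ∀ j ∈ Finset.range (β 0 + i + 1), Measurable fun y : Fin (n + 1) → ℝ =>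
        ENNReal.ofReal ((c' * y 0) ^ j / j.factorial *
            Real.exp (-(c' * y 0)) * expMonomial (Fin.tail a) (Fin.tail β) y) := by
      intro j _
      fun_prop
    change ∫⁻ x in orderedDomain (n + 2), f x = _
    rw [h1, lintegral_congr h2, lintegral_indicator (measurableSet_orderedDomain _),
      lintegral_const_mul _ (Finset.measurable_fun_sum _ h5), lintegral_finsetSum' _
        fun j hj => (h5 j hj).aemeasurable]
    have ha' : ∀ m, 0 ≤ Fin.tail a m := fun m => ha m.succ
    rw [Finset.sum_congr rfl fun j _ => ih hc'.le j ha' (Fin.tail β), ← ENNReal.ofReal_sum_of_nonneg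
      fun j _ => nestedSum_nonneg hc'.le j ha' _, ← ENNReal.ofReal_mul hK]
    rfl

theorem integral_expMonomial {n : ℕ} (hn : 0 < n) {a : Fin n → ℝ} (ha : ∀ m, 0 ≤ a m)
    (β : Fin n → ℕ) : IntegrableOn (expMonomial a β) (orderedDomain n) ∧
      ∫ x in orderedDomain n, expMonomial a β x = nestedSum n 0 0 a β := by
  obtain ⟨n, rfl⟩ := Nat.exists_eq_succ_of_ne_zero hn.ne'
  have h1 := lintegral_nestedSum n le_rfl 0 ha β
  simp only [zero_mul, pow_zero, Nat.factorial_zero, Nat.cast_one, div_one, neg_zero,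
    Real.exp_zero, one_mul] at h1
  have hnn : 0 ≤ᵐ[volume.restrict (orderedDomain (n + 1))] expMonomial a β :=
    (ae_restrict_iff' (measurableSet_orderedDomain _)).2
      (Filter.Eventually.of_forall fun x hx => expMonomial_nonneg a β hx.2)
  refine ⟨⟨(measurable_expMonomial a β).aestronglyMeasurable, ?_⟩, ?_⟩
  · rw [hasFiniteIntegral_iff_ofReal hnn, h1]
    exact ENNReal.ofReal_lt_top
  · rw [integral_eq_lintegral_of_nonneg_ae hnn (measurable_expMonomial a β).aestronglyMeasurable,
      h1, ENNReal.toReal_ofReal (nestedSum_nonneg le_rfl 0 ha β)]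

theorem integral_exp_mul_eigenvalueDensity {Nt Nr : ℕ} (hNt : 0 < Nt) (hNr : 0 < Nr)
    {a : Fin (min Nt Nr) → ℝ} (ha : ∀ m, 0 ≤ a m) :
    ∫ x in orderedDomain (min Nt Nr), (∏ m, Real.exp (-a m * x m)) * eigenvalueDensity Nt Nr x =
      mgfClosedForm Nt Nr a := by
  have hn : 0 < min Nt Nr := lt_min hNt hNr
  have h1 : ∀ x : Fin (min Nt Nr) → ℝ,
      (∏ m, Real.exp (-a m * x m)) * eigenvalueDensity Nt Nr x = 1 / normConst Nt Nr *
        ∑ β ∈ (densityPoly Nt Nr).support, (densityPoly Nt Nr).coeff β * expMonomial a β x := by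
    intro x
    rw [eigenvalueDensity_eq, ← eval_densityPoly, MvPolynomial.eval_eq', mul_left_comm]
    congr 1
    rw [← mul_assoc, ← Finset.prod_mul_distrib, Finset.mul_sum]
    refine Finset.sum_congr rfl fun β _ => ?_
    unfold expMonomial
    rw [mul_left_comm, ← Finset.prod_mul_distrib]
    congr 1
    refine Finset.prod_congr rfl fun m _ => ?_
    rw [← Real.exp_add]
    congr 2
    ring
  simp_rw [h1]
  rw [integral_const_mul, integral_finsetSum (densityPoly Nt Nr).support
    (f := fun β x => (densityPoly Nt Nr).coeff β * expMonomial a β x) fun β _ =>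
    ((integral_expMonomial hn ha β).1.const_mul _)]
  unfold mgfClosedForm
  congr 1
  refine Finset.sum_congr rfl fun β _ => ?_
  rw [integral_const_mul, (integral_expMonomial hn ha β).2]

/-! ### The law of the ordered eigenvalues of the channel -/

/-- The channel matrix or its transpose, whichever has at most as many rows as columns. -/
def wideMatrix {Nt Nr : ℕ} (H : Matrix (Fin Nr) (Fin Nt) ℂ) :
    Fin (min Nt Nr) → Fin (max Nt Nr) → ℂ := fun i j =>
  if h : Nr < Nt then H (Fin.cast (by omega) i) (Fin.cast (by omega) j)
  else H (Fin.cast (by omega) j) (Fin.cast (by omega) i)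

theorem eigenvalues₀_castLE {n m : ℕ} (h : m = n) {A : Matrix (Fin n) (Fin n) ℂ}
    (hA : A.IsHermitian) (hle : m ≤ Fintype.card (Fin n)) :
    (fun i : Fin m => hA.eigenvalues₀ (Fin.castLE hle i)) =
      eigs (A.submatrix (Fin.cast h) (Fin.cast h)) := by
  subst h
  have : A.submatrix (Fin.cast rfl) (Fin.cast rfl) = A := rfl
  rw [this]
  unfold eigs
  rw [dif_pos hA]
  rfl

theorem eigs_transpose {n : ℕ} {A : Matrix (Fin n) (Fin n) ℂ} (hA : A.IsHermitian) :
    eigs Aᵀ = eigs A :=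
  eigs_eq hA.transpose (eigs_antitone A) Set.infinite_univ fun t _ => by
    rw [Matrix.charpoly_transpose, eval_charpoly_eq_prod_eigs hA]

/-- If `Nr ≥ Nt`, the wide matrix is the transpose of `H`, and its Gram matrix is the transpose of
`Hᴴ * H`; transposition preserves the characteristic polynomial. -/
theorem orderedEigenvalues_eq {Nt Nr : ℕ} (H : Matrix (Fin Nr) (Fin Nt) ℂ) :
    orderedEigenvalues H = eigs (Matrix.of (wideMatrix H) * (Matrix.of (wideMatrix H))ᴴ) := by
  by_cases h : Nr < Nt
  · have h1 : orderedEigenvalues H = fun m =>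
        (Matrix.isHermitian_mul_conjTranspose_self H).eigenvalues₀ (Fin.castLE (by simp) m) := by
      funext m; unfold orderedEigenvalues; rw [if_pos h]
    rw [h1, eigenvalues₀_castLE (by omega)]
    congr 1
    ext i j
    simp only [Matrix.submatrix_apply, Matrix.mul_apply, Matrix.conjTranspose_apply, Matrix.of_apply,
      wideMatrix, dif_pos h]
    exact (Equiv.sum_comp (finCongr (show max Nt Nr = Nt by omega)) (fun l =>
      H (Fin.cast _ i) l * star (H (Fin.cast _ j) l))).symm
  · have h1 : orderedEigenvalues H = fun m =>
        (Matrix.isHermitian_conjTranspose_mul_self H).eigenvalues₀ (Fin.castLE (by simp) m) := by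
      funext m; unfold orderedEigenvalues; rw [if_neg h]
    rw [h1, eigenvalues₀_castLE (by omega),
      ← eigs_transpose (Matrix.isHermitian_mul_conjTranspose_self _)]
    congr 1
    ext i j
    simp only [Matrix.submatrix_apply, Matrix.mul_apply, Matrix.conjTranspose_apply, Matrix.of_apply,
      wideMatrix, dif_neg h, Matrix.transpose_apply]
    refine (Equiv.sum_comp (finCongr (show max Nt Nr = Nr by omega)) (fun l =>
      star (H l (Fin.cast _ i)) * H l (Fin.cast _ j))).symm.trans ?_
    exact Finset.sum_congr rfl fun l _ => mul_comm _ _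

theorem orderedEigenvalues_nonneg {Nt Nr : ℕ} (H : Matrix (Fin Nr) (Fin Nt) ℂ)
    (m : Fin (min Nt Nr)) : 0 ≤ orderedEigenvalues H m := by
  rw [orderedEigenvalues_eq]
  exact eigs_nonneg _ m

theorem map_eq_gaussMat {k N : ℕ} {Ω : Type*} [MeasurableSpace Ω] {μ : Measure Ω}
    [IsProbabilityMeasure μ] {K : Ω → Fin k → Fin N → ℂ}
    (hi : iIndepFun (fun (ij : Fin k × Fin N) ω => K ω ij.1 ij.2) μ)
    (hl : ∀ i j, HasLaw (fun ω => K ω i j) (complexGaussian 1) μ) :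
    AEMeasurable K μ ∧ μ.map K = gaussMat k N := by
  have hm : AEMeasurable K μ := aemeasurable_pi_lambda _ fun i => aemeasurable_pi_lambda _ fun j =>
    (hl i j).aemeasurable
  refine ⟨hm, ?_⟩
  have h1 := (iIndepFun_iff_map_fun_eq_pi_map fun ij : Fin k × Fin N =>
    (hl ij.1 ij.2).aemeasurable).1 hi
  simp_rw [fun ij : Fin k × Fin N => (hl ij.1 ij.2).map_eq] at h1
  let u : (Fin k → Fin N → ℂ) → (Fin k × Fin N → ℂ) := fun f ij => f ij.1 ij.2
  let v : (Fin k × Fin N → ℂ) → (Fin k → Fin N → ℂ) := fun f i j => f (i, j)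
  have hu : Measurable u := by fun_prop
  have hv : Measurable v := by fun_prop
  have h2 : (gaussMat k N).map u = Measure.pi fun _ => complexGaussian 1 := by
    refine (Measure.pi_eq fun s hs => ?_).symm
    have hpre : u ⁻¹' Set.univ.pi s =
        Set.univ.pi fun i => Set.univ.pi fun j => s (i, j) := by
      ext f
      simp only [Set.mem_preimage, Set.mem_univ_pi, u]
      exact ⟨fun h i j => h (i, j), fun h ij => h ij.1 ij.2⟩
    rw [Measure.map_apply hu (MeasurableSet.univ_pi hs), hpre, gaussMat, Measure.pi_pi]
    simp only [gaussVec, Measure.pi_pi]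
    exact (Fintype.prod_prod_type
      (fun ij : Fin k × Fin N => complexGaussian 1 (s ij))).symm
  have h3 : μ.map (u ∘ K) = (gaussMat k N).map u := h1.trans h2.symm
  have h4 := congrArg (Measure.map v) h3
  rw [AEMeasurable.map_map_of_aemeasurable hv.aemeasurable (hu.comp_aemeasurable hm),
    Measure.map_map hv hu] at h4
  have h5 : v ∘ u = id := rfl
  rw [h5, Measure.map_id] at h4
  exact h4

theorem IsGaussianChannel.map_wideMatrix {Nt Nr : ℕ} {Ω : Type*} [MeasurableSpace Ω]
    {μ : Measure Ω} [IsProbabilityMeasure μ] {H : Ω → Matrix (Fin Nr) (Fin Nt) ℂ}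
    (h : IsGaussianChannel H μ) :
    AEMeasurable (fun ω => wideMatrix (H ω)) μ ∧
      μ.map (fun ω => wideMatrix (H ω)) = gaussMat (min Nt Nr) (max Nt Nr) := by
  by_cases hN : Nr < Nt
  · have hσ : Function.Injective fun ij : Fin (min Nt Nr) × Fin (max Nt Nr) =>
        ((Fin.cast (by omega) ij.1, Fin.cast (by omega) ij.2) : Fin Nr × Fin Nt) := by
      rintro ⟨a, b⟩ ⟨c, d⟩ hab
      simpa using hab
    refine map_eq_gaussMat ?_ fun i j => ?_
    · have := h.indep.precomp hσ
      simpa only [wideMatrix, dif_pos hN] using this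
    · simpa only [wideMatrix, dif_pos hN] using h.law _ _
  · have hσ : Function.Injective fun ij : Fin (min Nt Nr) × Fin (max Nt Nr) =>
        ((Fin.cast (by omega) ij.2, Fin.cast (by omega) ij.1) : Fin Nr × Fin Nt) := by
      rintro ⟨a, b⟩ ⟨c, d⟩ hab
      simpa [and_comm] using hab
    refine map_eq_gaussMat ?_ fun i j => ?_
    · have := h.indep.precomp hσ
      simpa only [wideMatrix, dif_neg hN] using this
    · simpa only [wideMatrix, dif_neg hN] using h.law _ _

/-- The ordered eigenvalues of a Gaussian channel have the law `eigenvalueLaw`. -/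
theorem IsGaussianChannel.hasLaw_orderedEigenvalues {Nt Nr : ℕ} {Ω : Type*} [MeasurableSpace Ω]
    {μ : Measure Ω} [IsProbabilityMeasure μ] {H : Ω → Matrix (Fin Nr) (Fin Nt) ℂ}
    (h : IsGaussianChannel H μ) :
    HasLaw (fun ω => orderedEigenvalues (H ω)) (eigenvalueLaw Nt Nr) μ := by
  obtain ⟨hm, hl⟩ := h.map_wideMatrix
  have he : Measurable fun K : Fin (min Nt Nr) → Fin (max Nt Nr) → ℂ =>
      eigs (Matrix.of K * (Matrix.of K)ᴴ) :=
    measurable_eigs_mul_conjTranspose (f := fun K => K) measurable_id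
  simp_rw [orderedEigenvalues_eq]
  refine ⟨he.comp_aemeasurable hm, ?_⟩
  rw [← map_eigs_eq_eigenvalueLaw, ← hl,
    AEMeasurable.map_map_of_aemeasurable he.aemeasurable hm]
  rfl

theorem integral_orderedEigenvalues {Nt Nr : ℕ} {Ω : Type*} [MeasurableSpace Ω]
    {μ : Measure Ω} [IsProbabilityMeasure μ] {H : Ω → Matrix (Fin Nr) (Fin Nt) ℂ}
    (h : IsGaussianChannel H μ) {f : (Fin (min Nt Nr) → ℝ) → ℝ} (hf : Measurable f) :
    ∫ ω, f (orderedEigenvalues (H ω)) ∂μ = ∫ x, f x ∂eigenvalueLaw Nt Nr := by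
  rw [← h.hasLaw_orderedEigenvalues.map_eq,
    integral_map h.hasLaw_orderedEigenvalues.aemeasurable hf.aestronglyMeasurable]

/-! ### The Gaussian tail in Craig's form -/

/-- Craig's integral for the Gaussian tail function at `√(2y)`. -/
def craig (y : ℝ) : ℝ :=
  (2 * Real.pi)⁻¹ * ∫ θ in (-(Real.pi / 2))..(Real.pi / 2), Real.exp (-(y / Real.cos θ ^ 2))

theorem exp_neg_div_le_one {y : ℝ} (hy : 0 ≤ y) (c : ℝ) : Real.exp (-(y / c ^ 2)) ≤ 1 := by
  rw [Real.exp_le_one_iff, neg_nonpos]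
  positivity

theorem measurable_craig_integrand (y : ℝ) :
    Measurable fun θ : ℝ => Real.exp (-(y / Real.cos θ ^ 2)) := by
  have : Measurable Real.cos := Real.measurable_cos
  fun_prop

theorem intervalIntegrable_craig {y : ℝ} (hy : 0 ≤ y) (a b : ℝ) :
    IntervalIntegrable (fun θ => Real.exp (-(y / Real.cos θ ^ 2))) volume a b := by
  refine (intervalIntegrable_const (c := (1 : ℝ))).mono_fun
    (measurable_craig_integrand y).aestronglyMeasurable (ae_of_all _ fun θ => ?_)
  simpa [abs_of_pos (Real.exp_pos _)] using exp_neg_div_le_one hy _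

theorem craig_nonneg (y : ℝ) : 0 ≤ craig y := by
  refine mul_nonneg (by positivity) (intervalIntegral.integral_nonneg (by linarith [Real.pi_pos])
    fun θ _ => (Real.exp_pos _).le)

theorem lintegral_mul_exp_Ici {a : ℝ} (ha : 0 ≤ a) :
    ∫⁻ r in Set.Ici a, ENNReal.ofReal (r * Real.exp (-r ^ 2 / 2)) =
      ENNReal.ofReal (Real.exp (-a ^ 2 / 2)) := by
  have hd : ∀ r ∈ Set.Ici a, HasDerivAt (fun r : ℝ => -Real.exp (-r ^ 2 / 2))
      (r * Real.exp (-r ^ 2 / 2)) r := fun r _ => by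
    have h1 : HasDerivAt (fun r : ℝ => -r ^ 2 / 2) (-r) r := by
      have := ((hasDerivAt_pow 2 r).neg).div_const 2
      exact this.congr_deriv (by norm_num; ring)
    exact h1.exp.neg.congr_deriv (by ring)
  have hp : ∀ r ∈ Set.Ioi a, 0 ≤ r * Real.exp (-r ^ 2 / 2) := fun r hr =>
    mul_nonneg (ha.trans (le_of_lt hr)) (Real.exp_pos _).le
  have ht : Filter.Tendsto (fun r : ℝ => -Real.exp (-r ^ 2 / 2)) Filter.atTop (nhds 0) := by
    rw [← neg_zero]
    refine (Real.tendsto_exp_atBot.comp ?_).neg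
    have : Filter.Tendsto (fun r : ℝ => r ^ 2 / 2) Filter.atTop Filter.atTop :=
      (Filter.tendsto_pow_atTop two_ne_zero).atTop_div_const two_pos
    refine (Filter.tendsto_neg_atTop_atBot.comp this).congr fun r => ?_
    simp [neg_div]
  have hc : ContinuousWithinAt (fun r : ℝ => -Real.exp (-r ^ 2 / 2)) (Set.Ici a) a := by
    fun_prop
  have hi := integrableOn_Ioi_deriv_of_nonneg hc (fun r hr => hd r (Set.Ioi_subset_Ici_self hr)) hp ht
  have hv := integral_Ioi_of_hasDerivAt_of_nonneg hc
    (fun r hr => hd r (Set.Ioi_subset_Ici_self hr)) hp ht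
  rw [← Measure.restrict_congr_set Ioi_ae_eq_Ici, ← ofReal_integral_eq_lintegral_ofReal hi
    ((ae_restrict_mem measurableSet_Ioi).mono hp), hv]
  simp

theorem cos_nonpos_of_mem {θ : ℝ} (h1 : θ ∈ Set.Ioo (-Real.pi) Real.pi)
    (h2 : θ ∉ Set.Ioo (-(Real.pi / 2)) (Real.pi / 2)) : Real.cos θ ≤ 0 := by
  by_cases h : θ ≤ -(Real.pi / 2)
  · rw [← Real.cos_neg]
    exact Real.cos_nonpos_of_pi_div_two_le_of_le (by linarith) (by linarith [h1.1, Real.pi_pos])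
  · have h' : Real.pi / 2 ≤ θ := by
      by_contra h3
      exact h2 ⟨not_le.1 h, not_le.1 h3⟩
    exact Real.cos_nonpos_of_pi_div_two_le_of_le h' (by linarith [h1.2, Real.pi_pos])

/-- Craig's formula. -/
theorem gaussianReal_Ici {x : ℝ} (hx : 0 < x) :
    gaussianReal 0 1 (Set.Ici x) = ENNReal.ofReal (craig (x ^ 2 / 2)) := by
  have hpi := Real.pi_pos
  let g : ℝ → ℝ≥0∞ := gaussianPDF 0 1
  have hg : Measurable g := measurable_gaussianPDF 0 1
  have hgg : ∀ r θ : ℝ, g (r * Real.cos θ) * g (r * Real.sin θ) =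
      ENNReal.ofReal ((2 * Real.pi)⁻¹ * Real.exp (-r ^ 2 / 2)) := fun r θ => by
    simp only [g, gaussianPDF, gaussianPDFReal, NNReal.coe_one, mul_one, sub_zero]
    rw [← ENNReal.ofReal_mul (by positivity)]
    congr 1
    have h1 : (√(2 * Real.pi))⁻¹ * (√(2 * Real.pi))⁻¹ = (2 * Real.pi)⁻¹ := by
      rw [← mul_inv, Real.mul_self_sqrt (by positivity)]
    have h2 : Real.exp (-(r * Real.cos θ) ^ 2 / 2) * Real.exp (-(r * Real.sin θ) ^ 2 / 2) =
        Real.exp (-r ^ 2 / 2) := by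
      rw [← Real.exp_add]
      congr 1
      linear_combination (-r ^ 2 / 2) * Real.sin_sq_add_cos_sq θ
    rw [← h1, ← h2]
    ring
  -- A second, independent normal variable turns the tail into the mass of a half-plane under a
  -- rotation-invariant density. In polar coordinates a ray at angle `θ` enters the half-plane at `r
  -- = x / cos θ` if `cos θ > 0` and never otherwise, so the radial integral is elementary.
  have h0 : ∫⁻ p : ℝ × ℝ, (Set.Ici x).indicator g p.1 * g p.2 = gaussianReal 0 1 (Set.Ici x) := by
    rw [Measure.volume_eq_prod, lintegral_prod_mul (hg.indicator measurableSet_Ici).aemeasurable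
      hg.aemeasurable, lintegral_gaussianPDF_eq_one 0 one_ne_zero, mul_one,
      lintegral_indicator measurableSet_Ici, gaussianReal_apply 0 one_ne_zero]
  rw [← h0, ← lintegral_comp_polarCoord_symm, polarCoord_target, Measure.volume_eq_prod,
    ← Measure.prod_restrict]
  have hmeas : Measurable fun p : ℝ × ℝ => ENNReal.ofReal p.1 •
      ((Set.Ici x).indicator g (polarCoord.symm p).1 * g (polarCoord.symm p).2) := by
    simp only [polarCoord_symm_apply, smul_eq_mul]
    have : Measurable Real.cos := Real.measurable_cos
    have : Measurable Real.sin := Real.measurable_sin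
    have := hg.indicator (measurableSet_Ici (a := x))
    fun_prop
  rw [lintegral_prod_symm _ hmeas.aemeasurable]
  have hin : ∀ θ ∈ Set.Ioo (-Real.pi) Real.pi,
      ∫⁻ r in Set.Ioi (0 : ℝ), ENNReal.ofReal r •
        ((Set.Ici x).indicator g (polarCoord.symm (r, θ)).1 * g (polarCoord.symm (r, θ)).2) =
      (Set.Ioo (-(Real.pi / 2)) (Real.pi / 2)).indicator (fun θ => ENNReal.ofReal
        ((2 * Real.pi)⁻¹ * Real.exp (-(x ^ 2 / 2 / Real.cos θ ^ 2)))) θ := fun θ hθ => by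
    simp only [polarCoord_symm_apply, smul_eq_mul]
    by_cases h : θ ∈ Set.Ioo (-(Real.pi / 2)) (Real.pi / 2)
    · have hcos : 0 < Real.cos θ := Real.cos_pos_of_mem_Ioo h
      have hsub : Set.Ici (x / Real.cos θ) ⊆ Set.Ioi 0 := fun r hr =>
        (div_pos hx hcos).trans_le hr
      rw [Set.indicator_of_mem h]
      have : ∀ r ∈ Set.Ioi (0 : ℝ), ENNReal.ofReal r *
          ((Set.Ici x).indicator g (r * Real.cos θ) * g (r * Real.sin θ)) =
          (Set.Ici (x / Real.cos θ)).indicator (fun r => ENNReal.ofReal (2 * Real.pi)⁻¹ *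
            ENNReal.ofReal (r * Real.exp (-r ^ 2 / 2))) r := fun r hr => by
        have hr' : (0 : ℝ) < r := hr
        by_cases hm : x / Real.cos θ ≤ r
        · rw [Set.indicator_of_mem (show r * Real.cos θ ∈ Set.Ici x from (div_le_iff₀ hcos).1 hm),
            Set.indicator_of_mem (show r ∈ Set.Ici (x / Real.cos θ) from hm), hgg,
            ← ENNReal.ofReal_mul hr'.le, ← ENNReal.ofReal_mul (by positivity)]
          congr 1
          ring
        · rw [Set.indicator_of_notMem
            (show r * Real.cos θ ∉ Set.Ici x from fun h' => hm ((div_le_iff₀ hcos).2 h')),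
            Set.indicator_of_notMem (show r ∉ Set.Ici (x / Real.cos θ) from hm)]
          simp
      rw [setLIntegral_congr_fun measurableSet_Ioi this,
        setLIntegral_indicator measurableSet_Ici, Set.inter_eq_left.2 hsub,
        lintegral_const_mul' _ _ ENNReal.ofReal_ne_top,
        lintegral_mul_exp_Ici (div_pos hx hcos).le, ← ENNReal.ofReal_mul (by positivity)]
      congr 3
      field_simp
    · rw [Set.indicator_of_notMem h]
      have hcos := cos_nonpos_of_mem hθ h
      rw [setLIntegral_congr_fun (g := fun _ => 0) measurableSet_Ioi fun r hr => ?_]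
      · simp
      · have : r * Real.cos θ ∉ Set.Ici x := fun h' =>
          absurd (hx.trans_le h') (not_lt.2 (mul_nonpos_of_nonneg_of_nonpos (le_of_lt hr) hcos))
        simp [Set.indicator_of_notMem this]
  rw [setLIntegral_congr_fun measurableSet_Ioo hin, setLIntegral_indicator measurableSet_Ioo,
    Set.inter_eq_left.2 (Set.Ioo_subset_Ioo (by linarith) (by linarith)), craig,
    ← intervalIntegral.integral_const_mul,
    intervalIntegral.integral_of_le (by linarith), integral_Ioc_eq_integral_Ioo,
    ofReal_integral_eq_lintegral_ofReal]
  · have := ((intervalIntegrable_craig (y := x ^ 2 / 2) (by positivity) (-(Real.pi / 2))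
      (Real.pi / 2)).const_mul (2 * Real.pi)⁻¹)
    rw [intervalIntegrable_iff_integrableOn_Ioo_of_le (by linarith)] at this
    exact this
  · exact ae_of_all _ fun θ => by positivity

/-- The exponential bound for the tail function that goes with the weights `1/12`, `1/4`. -/
def expBound (y : ℝ) : ℝ := 1 / 12 * Real.exp (-y) + 1 / 4 * Real.exp (-(4 / 3 * y))

theorem one_add_sq_le_inv_cos_sq {θ : ℝ} (h : θ ∈ Set.Ioo (-(Real.pi / 2)) (Real.pi / 2)) :
    1 + θ ^ 2 ≤ 1 / Real.cos θ ^ 2 := by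
  have hpi := Real.pi_pos
  have hc := Real.cos_pos_of_mem_Ioo h
  have h1 := Real.cos_le_one_div_sqrt_sq_add_one (x := θ) (by linarith [h.1]) (by linarith [h.2])
  have h2 : 0 < √(θ ^ 2 + 1) := by positivity
  rw [le_div_iff₀ h2] at h1
  rw [le_div_iff₀ (by positivity)]
  have h3 : (Real.cos θ * √(θ ^ 2 + 1)) ^ 2 ≤ 1 := pow_le_one₀ (by positivity) h1
  rw [mul_pow, Real.sq_sqrt (by positivity)] at h3
  linarith

/-- The factor `3 / 2` is forced by `y = 0`, where both sides equal `1 / 2`. By `1 / cos² θ ≥ 1 +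
θ²` the integrand is at most `exp (-(y * (1 + θ²)))`; for `3 * θ² ≤ 1`, convexity of `exp` bounds
this by interpolating between the two exponentials of `expBound`. For larger `|θ|` the value at the
cut-off is used. The integrated coefficient of `A - B` then has to stay below `π / 4`. -/
theorem craig_le {y : ℝ} (hy : 0 ≤ y) : craig y ≤ 3 / 2 * expBound y := by
  have hpi := Real.pi_gt_d2
  set A := Real.exp (-y) with hA
  set B := Real.exp (-(4 / 3 * y)) with hB
  have hBA : B ≤ A := Real.exp_le_exp.2 (by linarith)
  have hB0 : 0 < B := Real.exp_pos _
  have hle : ∀ θ ∈ Set.Ioo (-(Real.pi / 2)) (Real.pi / 2),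
      Real.exp (-(y / Real.cos θ ^ 2)) ≤ Real.exp (-(y * (1 + θ ^ 2))) := fun θ hθ =>
    Real.exp_le_exp.2 (by
      have := mul_le_mul_of_nonneg_left (one_add_sq_le_inv_cos_sq hθ) hy
      rw [mul_one_div] at this
      linarith)
  -- The cut-off `15 / 26` is a rational number just below `1 / √3`: `1 - 3 * (15 / 26) ^ 2 = 1 /
  -- 676`, which is the small coefficient used outside.
  have hmid : ∀ θ ∈ Set.Icc (-(15 / 26 : ℝ)) (15 / 26),
      Real.exp (-(y * (1 + θ ^ 2))) ≤ (A - B) * (1 - 3 * θ ^ 2) + B := fun θ hθ => by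
    have h3 : 3 * θ ^ 2 ≤ 1 := by nlinarith [hθ.1, hθ.2]
    obtain ⟨-, hconv⟩ := convexOn_exp
    have := hconv (Set.mem_univ (-y)) (Set.mem_univ (-(4 / 3 * y)))
      (show 0 ≤ 1 - 3 * θ ^ 2 by linarith) (show 0 ≤ 3 * θ ^ 2 by positivity) (by ring)
    simp only [smul_eq_mul] at this
    calc Real.exp (-(y * (1 + θ ^ 2)))
        = Real.exp ((1 - 3 * θ ^ 2) * -y + 3 * θ ^ 2 * -(4 / 3 * y)) := by congr 1; ring
      _ ≤ _ := this
      _ = _ := by rw [← hA, ← hB]; ring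
  have hout : ∀ θ : ℝ, 15 / 26 ≤ |θ| → Real.exp (-(y * (1 + θ ^ 2))) ≤
      (A - B) * (1 / 676) + B := fun θ hθ => by
    have h3 : (15 / 26) ^ 2 ≤ θ ^ 2 := by
      rw [← sq_abs θ]
      exact pow_le_pow_left₀ (by norm_num) hθ 2
    have h4 := hmid (15 / 26) ⟨by norm_num, le_rfl⟩
    refine (Real.exp_le_exp.2 ?_).trans (h4.trans (by norm_num))
    have := mul_le_mul_of_nonneg_left h3 hy
    linarith
  have hI := fun a b => intervalIntegrable_craig hy a b
  have hcont : Continuous fun θ : ℝ => (A - B) * (1 - 3 * θ ^ 2) + B := by fun_prop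
  have i1 : ∫ θ in (-(Real.pi / 2))..(-(15 / 26)), Real.exp (-(y / Real.cos θ ^ 2)) ≤
      ∫ θ in (-(Real.pi / 2))..(-(15 / 26)), ((A - B) * (1 / 676) + B) :=
    intervalIntegral.integral_mono_on_of_le_Ioo (by linarith) (hI _ _) intervalIntegrable_const
      fun θ hθ => (hle θ ⟨hθ.1, by linarith [hθ.2]⟩).trans
        (hout θ (by rw [abs_of_neg (by linarith [hθ.2])]; linarith [hθ.2]))
  have i2 : ∫ θ in (-(15 / 26))..(15 / 26), Real.exp (-(y / Real.cos θ ^ 2)) ≤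
      ∫ θ in (-(15 / 26 : ℝ))..(15 / 26), ((A - B) * (1 - 3 * θ ^ 2) + B) :=
    intervalIntegral.integral_mono_on_of_le_Ioo (by norm_num) (hI _ _)
      (hcont.intervalIntegrable _ _)
      fun θ hθ => (hle θ ⟨by linarith [hθ.1], by linarith [hθ.2]⟩).trans
        (hmid θ ⟨hθ.1.le, hθ.2.le⟩)
  have i3 : ∫ θ in (15 / 26)..(Real.pi / 2), Real.exp (-(y / Real.cos θ ^ 2)) ≤
      ∫ θ in (15 / 26)..(Real.pi / 2), ((A - B) * (1 / 676) + B) :=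
    intervalIntegral.integral_mono_on_of_le_Ioo (by linarith) (hI _ _) intervalIntegrable_const
      fun θ hθ => (hle θ ⟨by linarith [hθ.1], hθ.2⟩).trans
        (hout θ (by rw [abs_of_pos (by linarith [hθ.1])]; exact hθ.1.le))
  have e2 : ∫ θ in (-(15 / 26 : ℝ))..(15 / 26), ((A - B) * (1 - 3 * θ ^ 2) + B) =
      (A - B) * (2 * (15 / 26) - 2 * (15 / 26) ^ 3) + B * (15 / 13) := by
    rw [intervalIntegral.integral_add (by apply Continuous.intervalIntegrable; fun_prop)
      (by simp), intervalIntegral.integral_const_mul,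
      intervalIntegral.integral_sub (by simp) (by apply Continuous.intervalIntegrable; fun_prop),
      intervalIntegral.integral_const_mul, integral_pow]
    simp
    norm_num
    ring
  rw [intervalIntegral.integral_const, smul_eq_mul] at i1 i3
  rw [e2] at i2
  have hsum := intervalIntegral.integral_add_adjacent_intervals
    ((hI (-(Real.pi / 2)) (-(15 / 26))).trans (hI (-(15 / 26)) (15 / 26))) (hI (15 / 26) (Real.pi / 2))
  rw [← intervalIntegral.integral_add_adjacent_intervals (hI (-(Real.pi / 2)) (-(15 / 26)))
    (hI (-(15 / 26)) (15 / 26))] at hsum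
  have htot : ∫ θ in (-(Real.pi / 2))..(Real.pi / 2), Real.exp (-(y / Real.cos θ ^ 2)) ≤
      (A - B) * (Real.pi / 4) + B * Real.pi := by
    rw [← hsum]
    have := mul_nonneg (sub_nonneg.2 hBA) (show 0 ≤ Real.pi / 4 -
      ((Real.pi - 15 / 13) * (1 / 676) + (2 * (15 / 26) - 2 * (15 / 26) ^ 3)) by linarith)
    linarith
  unfold craig expBound
  rw [inv_mul_le_iff₀ (by positivity)]
  refine htot.trans ?_
  rw [← hA, ← hB]
  nlinarith

/-- The union bound, capped at one, in terms of the exponential bound. -/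
theorem min_one_sum_craig_le {ι : Type*} (s : Finset ι) (y : ι → ℝ) (hy : ∀ i ∈ s, 0 ≤ y i) :
    min 1 (∑ i ∈ s, craig (y i)) ≤ 1 / 3 + ∑ i ∈ s, expBound (y i) := by
  have h : ∑ i ∈ s, craig (y i) ≤ 3 / 2 * ∑ i ∈ s, expBound (y i) := by
    rw [Finset.mul_sum]
    exact Finset.sum_le_sum fun i hi => craig_le (hy i hi)
  -- With `S` the sum of the exponential bounds, `3 / 2 * S ≤ 1 / 3 + S` holds exactly for `S ≤ 2 /
  -- 3`; beyond that, `1 / 3 + S` already exceeds the cap.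
  by_cases h1 : ∑ i ∈ s, expBound (y i) ≤ 2 / 3
  · exact (min_le_right _ _).trans (by linarith)
  · exact (min_le_left _ _).trans (by linarith)

/-! ### Rational functions of the signal-to-noise ratio -/

/-- `f` agrees on `(0, ∞)` with a rational function without poles there. -/
def IsRational (f : ℝ → ℝ) : Prop :=
  ∃ P Q : Polynomial ℝ, ∀ s > 0, Q.eval s ≠ 0 ∧ f s = P.eval s / Q.eval s

theorem IsRational.eval (P : Polynomial ℝ) : IsRational fun s => P.eval s :=
  ⟨P, 1, fun s _ => by simp⟩

theorem IsRational.const (c : ℝ) : IsRational fun _ => c :=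
  ⟨Polynomial.C c, 1, fun s _ => by simp⟩

theorem IsRational.mul {f g : ℝ → ℝ} (hf : IsRational f) (hg : IsRational g) :
    IsRational fun s => f s * g s := by
  obtain ⟨P, Q, h⟩ := hf
  obtain ⟨P', Q', h'⟩ := hg
  refine ⟨P * P', Q * Q', fun s hs => ?_⟩
  beta_reduce
  rw [Polynomial.eval_mul, Polynomial.eval_mul, (h s hs).2, (h' s hs).2, div_mul_div_comm]
  exact ⟨mul_ne_zero (h s hs).1 (h' s hs).1, rfl⟩

theorem IsRational.add {f g : ℝ → ℝ} (hf : IsRational f) (hg : IsRational g) :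
    IsRational fun s => f s + g s := by
  obtain ⟨P, Q, h⟩ := hf
  obtain ⟨P', Q', h'⟩ := hg
  refine ⟨P * Q' + Q * P', Q * Q', fun s hs => ?_⟩
  beta_reduce
  rw [(h s hs).2, (h' s hs).2, div_add_div _ _ (h s hs).1 (h' s hs).1]
  simp only [Polynomial.eval_add, Polynomial.eval_mul]
  exact ⟨mul_ne_zero (h s hs).1 (h' s hs).1, trivial⟩

theorem IsRational.sum {ι : Type*} (t : Finset ι) {f : ι → ℝ → ℝ}
    (hf : ∀ i ∈ t, IsRational (f i)) : IsRational fun s => ∑ i ∈ t, f i s := by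
  classical
  induction t using Finset.induction_on with
  | empty => simpa using IsRational.const 0
  | insert i t hi ih =>
    simp only [Finset.sum_insert hi]
    exact (hf i (Finset.mem_insert_self i t)).add
      (ih fun j hj => hf j (Finset.mem_insert_of_mem hj))

theorem IsRational.inv_pow {Q : Polynomial ℝ} (hQ : ∀ s > 0, Q.eval s ≠ 0) (k : ℕ) :
    IsRational fun s => (Q.eval s ^ k)⁻¹ :=
  ⟨1, Q ^ k, fun s hs => by simpa using fun h => absurd h (hQ s hs)⟩

/-- Along a ray `a = s * w` every denominator is a power of a polynomial in `s` that is positive for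
`s > 0`. The argument `c` is a polynomial so that the recursion can be followed. -/
theorem isRational_nestedSum (n : ℕ) (c : Polynomial ℝ) (hc : ∀ s > 0, 0 ≤ c.eval s) (i : ℕ)
    {w : Fin n → ℝ} (hw : ∀ m, 0 ≤ w m) (β : Fin n → ℕ) :
    IsRational fun s => nestedSum n (c.eval s) i (fun m => s * w m) β := by
  induction n generalizing c i with
  | zero => exact IsRational.const 1
  | succ n ih =>
    let q : Polynomial ℝ := c + (1 + Polynomial.X * Polynomial.C (w 0))
    have hq : ∀ s > 0, 0 < q.eval s := fun s hs => by
      have := hc s hs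
      have := mul_nonneg hs.le (hw 0)
      simp only [q, Polynomial.eval_add, Polynomial.eval_one, Polynomial.eval_mul,
        Polynomial.eval_X, Polynomial.eval_C]
      linarith
    have hqe : ∀ s, q.eval s = c.eval s + (1 + s * w 0) := fun s => by
      simp only [q, Polynomial.eval_add, Polynomial.eval_one, Polynomial.eval_mul,
        Polynomial.eval_X, Polynomial.eval_C]
    have h0 : IsRational fun s => ((i + 1).ascFactorial (β 0) : ℝ) * (c ^ i).eval s *
        (q.eval s ^ (β 0 + i + 1))⁻¹ :=
      ((IsRational.const _).mul (IsRational.eval _)).mul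
        (IsRational.inv_pow (fun s hs => (hq s hs).ne') _)
    cases n with
    | zero =>
      simp only [nestedSum]
      simpa only [Polynomial.eval_pow, hqe, div_eq_mul_inv] using h0
    | succ n =>
      have h1 := h0.mul (IsRational.sum (Finset.range (β 0 + i + 1)) fun j _ =>
        ih q (fun s hs => (hq s hs).le) j (w := Fin.tail w) (fun m => hw m.succ) (Fin.tail β))
      have ht : ∀ s : ℝ, (Fin.tail fun m => s * w m) = fun m => s * Fin.tail w m := fun s => rfl
      simp only [nestedSum]
      simpa only [Polynomial.eval_pow, hqe, div_eq_mul_inv, ht] using h1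

theorem isRational_mgfClosedForm (Nt Nr : ℕ) {w : Fin (min Nt Nr) → ℝ} (hw : ∀ m, 0 ≤ w m) :
    IsRational fun s => mgfClosedForm Nt Nr fun m => s * w m := by
  refine (IsRational.const _).mul (IsRational.sum _ fun β _ => (IsRational.const _).mul ?_)
  simpa using isRational_nestedSum (min Nt Nr) 0 (fun s _ => by simp) 0 hw β

/-- A positive rational function that vanishes at infinity decays like an inverse power. -/
theorem IsRational.exists_tendsto_pow_mul {f : ℝ → ℝ} (hf : IsRational f)
    (hpos : ∀ s > 0, 0 < f s) (h0 : Filter.Tendsto f Filter.atTop (nhds 0)) :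
    ∃ D : ℕ, 0 < D ∧ ∃ c : ℝ, 0 < c ∧
      Filter.Tendsto (fun s => s ^ D * f s) Filter.atTop (nhds c) := by
  obtain ⟨P, Q, h⟩ := hf
  have hP : P ≠ 0 := by
    rintro rfl
    have := hpos 1 one_pos
    rw [(h 1 one_pos).2] at this
    simp at this
  have hQ : Q ≠ 0 := by
    rintro rfl
    exact (h 1 one_pos).1 (by simp)
  have hev : f =ᶠ[Filter.atTop] fun s => P.eval s / Q.eval s :=
    (Filter.eventually_gt_atTop 0).mono fun s hs => (h s hs).2
  have hdeg := (Polynomial.div_tendsto_atTop_zero_iff_degree_lt P Q hQ).1 (h0.congr' hev)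
  have hnat := Polynomial.natDegree_lt_natDegree hP hdeg
  -- Vanishing at infinity means that the numerator has smaller degree, so `D > 0`; multiplying by
  -- `s ^ D` equalises the degrees and the limit is the ratio of leading coefficients.
  set D := Q.natDegree - P.natDegree with hD
  have hXP : (Polynomial.X ^ D * P).degree = Q.degree := by
    rw [Polynomial.degree_mul, Polynomial.degree_X_pow, Polynomial.degree_eq_natDegree hP,
      Polynomial.degree_eq_natDegree hQ]
    norm_cast
    omega
  have ht := Polynomial.div_tendsto_atTop_leadingCoeff_div_of_degree_eq _ Q hXP
  set c := (Polynomial.X ^ D * P).leadingCoeff / Q.leadingCoeff with hc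
  have hc0 : c ≠ 0 := div_ne_zero (Polynomial.leadingCoeff_ne_zero.2
    (mul_ne_zero (pow_ne_zero _ Polynomial.X_ne_zero) hP)) (Polynomial.leadingCoeff_ne_zero.2 hQ)
  have ht' : Filter.Tendsto (fun s => s ^ D * f s) Filter.atTop (nhds c) := by
    refine ht.congr' (hev.mono fun s hs => ?_)
    beta_reduce at hs ⊢
    rw [hs, Polynomial.eval_mul, Polynomial.eval_pow, Polynomial.eval_X, mul_div_assoc]
  refine ⟨D, by omega, c, lt_of_le_of_ne ?_ hc0.symm, ht'⟩
  exact ge_of_tendsto ht' ((Filter.eventually_gt_atTop 0).mono fun s hs =>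
    mul_nonneg (pow_nonneg (le_of_lt hs) _) (hpos s hs).le)

/-! ### Averages of the tail function -/

/-- The Laplace transform of the law of `g`. -/
def laplace {α : Type*} [MeasurableSpace α] (ν : Measure α) (g : α → ℝ) (s : ℝ) : ℝ :=
  ∫ x, Real.exp (-(s * g x)) ∂ν

section Laplace

variable {α : Type*} [MeasurableSpace α] {ν : Measure α} [IsProbabilityMeasure ν] {g : α → ℝ}

theorem integrable_laplace (hg : Measurable g) (h0 : ∀ᵐ x ∂ν, 0 ≤ g x) {s : ℝ} (hs : 0 ≤ s) :
    Integrable (fun x => Real.exp (-(s * g x))) ν := by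
  refine (integrable_const (1 : ℝ)).mono' (by fun_prop) (h0.mono fun x hx => ?_)
  rw [Real.norm_eq_abs, abs_of_pos (Real.exp_pos _), Real.exp_le_one_iff]
  nlinarith

theorem laplace_pos (hg : Measurable g) (h0 : ∀ᵐ x ∂ν, 0 ≤ g x) {s : ℝ} (hs : 0 ≤ s) :
    0 < laplace ν g s :=
  integral_exp_pos (integrable_laplace hg h0 hs)

theorem tendsto_laplace (hg : Measurable g) (h0 : ∀ᵐ x ∂ν, 0 < g x) :
    Filter.Tendsto (laplace ν g) Filter.atTop (nhds 0) := by
  have : (0 : ℝ) = ∫ _, 0 ∂ν := by simp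
  rw [this]
  refine tendsto_integral_filter_of_dominated_convergence (fun _ => 1)
    (Filter.Eventually.of_forall fun s => by fun_prop) ?_ (integrable_const 1) ?_
  · filter_upwards [Filter.eventually_ge_atTop 0] with s hs
    filter_upwards [h0] with x hx
    rw [Real.norm_eq_abs, abs_of_pos (Real.exp_pos _), Real.exp_le_one_iff]
    nlinarith
  · filter_upwards [h0] with x hx
    exact Real.tendsto_exp_neg_atTop_nhds_zero.comp (Filter.tendsto_id.atTop_mul_const hx)

theorem integrable_craig_uncurry (hg : Measurable g) (h0 : ∀ᵐ x ∂ν, 0 ≤ g x) {s : ℝ}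
    (hs : 0 ≤ s) : Integrable (Function.uncurry fun x θ : _ =>
      Real.exp (-(s * g x / Real.cos θ ^ 2)))
      (ν.prod (volume.restrict (Set.Ioc (-(Real.pi / 2)) (Real.pi / 2)))) := by
  have : Measurable Real.cos := Real.measurable_cos
  refine (integrable_const (1 : ℝ)).mono' (Measurable.aestronglyMeasurable
    (by unfold Function.uncurry; fun_prop)) ?_
  have hm : MeasurableSet {p : α × ℝ | 0 ≤ g p.1} :=
    measurableSet_le measurable_const (hg.comp measurable_fst)
  refine ((Measure.ae_prod_iff_ae_ae hm).2 (h0.mono fun x hx => ae_of_all _ fun _ => hx)).mono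
    fun p hp => ?_
  rw [Real.norm_eq_abs, Function.uncurry, abs_of_pos (Real.exp_pos _)]
  exact exp_neg_div_le_one (mul_nonneg hs hp) _

/-- By Fubini, Craig's form makes the mean tail an average over angles of Laplace transforms at `s /
cos² θ`, arguments no smaller than `s` where the cosine does not vanish. -/
theorem integral_craig (hg : Measurable g) (h0 : ∀ᵐ x ∂ν, 0 ≤ g x) {s : ℝ} (hs : 0 ≤ s) :
    ∫ x, craig (s * g x) ∂ν = (2 * Real.pi)⁻¹ *
      ∫ θ in (-(Real.pi / 2))..(Real.pi / 2), laplace ν g (s / Real.cos θ ^ 2) := by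
  have hpi := Real.pi_pos
  unfold craig
  rw [integral_const_mul]
  simp only [intervalIntegral.integral_of_le (show -(Real.pi / 2) ≤ Real.pi / 2 by linarith)]
  rw [integral_integral_swap (integrable_craig_uncurry hg h0 hs)]
  congr 1
  refine integral_congr_ae (ae_of_all _ fun θ => ?_)
  unfold laplace
  simp only [div_mul_eq_mul_div]

theorem integrable_laplace_div (hg : Measurable g) (h0 : ∀ᵐ x ∂ν, 0 ≤ g x) {s : ℝ}
    (hs : 0 ≤ s) : IntervalIntegrable (fun θ => laplace ν g (s / Real.cos θ ^ 2)) volume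
      (-(Real.pi / 2)) (Real.pi / 2) := by
  have hpi := Real.pi_pos
  rw [intervalIntegrable_iff_integrableOn_Ioc_of_le (by linarith)]
  refine (integrable_craig_uncurry hg h0 hs).integral_prod_right.congr (ae_of_all _ fun θ => ?_)
  simp only [laplace, Function.uncurry, div_mul_eq_mul_div]

end Laplace

/-! ### Wallis integrals -/

/-- The mean of `cos ^ (2D)`. -/
def wallis (D : ℕ) : ℝ := ∏ i ∈ Finset.range D, ((2 * i + 1) / (2 * i + 2) : ℝ)

theorem integral_cos_even (D : ℕ) :
    ∫ θ in (-(Real.pi / 2))..(Real.pi / 2), Real.cos θ ^ (2 * D) = Real.pi * wallis D := by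
  induction D with
  | zero => simp [wallis]
  | succ D ih =>
    rw [show 2 * (D + 1) = 2 * D + 2 by ring, integral_cos_pow, ih,
      show wallis (D + 1) = wallis D * ((2 * D + 1) / (2 * D + 2)) from Finset.prod_range_succ _ _]
    simp
    ring

theorem wallis_nonneg (D : ℕ) : 0 ≤ wallis D := Finset.prod_nonneg fun i _ => by positivity

theorem wallis_antitone : Antitone wallis := antitone_nat_of_succ_le fun D => by
  rw [wallis, Finset.prod_range_succ, ← wallis]
  refine mul_le_of_le_one_right (wallis_nonneg D) ?_
  rw [div_le_one (by positivity)]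
  linarith

/-- The value `12` is the first `D` with `wallis D < 1 / 6`; from there on the term `1 / 12` alone
suffices by monotonicity, and the smaller cases are computed. -/
theorem wallis_lt {D : ℕ} (hD : 0 < D) :
    wallis D / 2 < 1 / 12 + 1 / 4 * (3 / 4 : ℝ) ^ D := by
  rcases lt_or_ge D 12 with h | h
  · interval_cases D <;> norm_num [wallis, Finset.prod_range_succ]
  · have h1 := wallis_antitone h
    have h2 : wallis 12 < 1 / 6 := by norm_num [wallis, Finset.prod_range_succ]
    have h3 : (0 : ℝ) < (3 / 4 : ℝ) ^ D := by positivity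
    linarith

/-! ### The tail function against the exponential bound at high signal-to-noise ratio -/

/-- With `laplace ν g s ~ c / s ^ D`, the two sides are asymptotic to `wallis D / 2` and `1 / 12 + 1
/ 4 * (3 / 4) ^ D` times `c / s ^ D`. The strict inequality between these constants leaves room for
a relative error `ε` on each side. -/
theorem eventually_integral_craig_le {α : Type*} [MeasurableSpace α] {ν : Measure α}
    [IsProbabilityMeasure ν] {g : α → ℝ} (hg : Measurable g) (h0 : ∀ᵐ x ∂ν, 0 < g x)
    (hr : IsRational (laplace ν g)) : ∀ᶠ s in Filter.atTop,
      ∫ x, craig (s * g x) ∂ν ≤ 1 / 12 * laplace ν g s + 1 / 4 * laplace ν g (4 / 3 * s) := by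
  have hpi := Real.pi_pos
  have h0' : ∀ᵐ x ∂ν, 0 ≤ g x := h0.mono fun x hx => hx.le
  obtain ⟨D, hD, c, hc, ht⟩ := hr.exists_tendsto_pow_mul
    (fun s hs => laplace_pos hg h0' (le_of_lt hs)) (tendsto_laplace hg h0)
  set K : ℝ := 1 / 12 + 1 / 4 * (3 / 4 : ℝ) ^ D with hK
  have hWK := wallis_lt hD
  have hW := wallis_nonneg D
  have hK0 : 0 < K := by positivity
  -- The inequality amounts to `ε * (K + wallis D / 2) ≤ K - wallis D / 2`; the witness is half of
  -- the largest admissible `ε`.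
  obtain ⟨ε, hε0, hε1, hε⟩ : ∃ ε : ℝ, 0 < ε ∧ ε < 1 ∧
      (1 + ε) * (wallis D / 2) ≤ (1 - ε) * K := by
    have hT : 0 < K + wallis D / 2 := by linarith
    have hT2 : 0 < 2 * (K + wallis D / 2) := by linarith
    refine ⟨(K - wallis D / 2) / (2 * (K + wallis D / 2)), by apply div_pos <;> linarith, ?_, ?_⟩
    · rw [div_lt_one hT2]
      linarith
    · have : (K - wallis D / 2) / (2 * (K + wallis D / 2)) * (2 * (K + wallis D / 2)) =
        K - wallis D / 2 := div_mul_cancel₀ _ hT2.ne'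
      linarith
  have hup : ∀ᶠ t in Filter.atTop, t ^ D * laplace ν g t < (1 + ε) * c :=
    ht.eventually_lt_const (by nlinarith)
  have hlo : ∀ᶠ t in Filter.atTop, (1 - ε) * c < t ^ D * laplace ν g t :=
    ht.eventually_const_lt (by nlinarith)
  obtain ⟨S, hS⟩ := Filter.eventually_atTop.1 (hup.and hlo)
  filter_upwards [Filter.eventually_ge_atTop S, Filter.eventually_gt_atTop 0] with s hs hs0
  have hsD : 0 < s ^ D := by positivity
  -- For every angle `s / cos² θ ≥ s ≥ S`, so the asymptotic upper bound holds uniformly in `θ` and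
  -- produces the factor `cos θ ^ (2 * D)`.
  have hcos : ∫ θ in (-(Real.pi / 2))..(Real.pi / 2), laplace ν g (s / Real.cos θ ^ 2) ≤
      ∫ θ in (-(Real.pi / 2))..(Real.pi / 2), (1 + ε) * c / s ^ D * Real.cos θ ^ (2 * D) := by
    refine intervalIntegral.integral_mono_on_of_le_Ioo (by linarith)
      (integrable_laplace_div hg h0' hs0.le)
      (by apply Continuous.intervalIntegrable; fun_prop) fun θ hθ => ?_
    have hcθ := Real.cos_pos_of_mem_Ioo hθ
    have hc1 : Real.cos θ ^ 2 ≤ 1 := by nlinarith [Real.cos_le_one θ]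
    have hst : S ≤ s / Real.cos θ ^ 2 :=
      hs.trans ((le_div_iff₀ (by positivity)).2 (by nlinarith))
    have := (hS _ hst).1
    rw [div_pow, ← pow_mul, div_mul_eq_mul_div, div_lt_iff₀ (by positivity)] at this
    rw [div_mul_eq_mul_div, le_div_iff₀ hsD]
    linarith
  rw [intervalIntegral.integral_const_mul, integral_cos_even] at hcos
  have h1 := (hS s hs).2
  have h2 := (hS (4 / 3 * s) (by linarith)).2
  rw [integral_craig hg h0' hs0.le]
  rw [mul_pow] at h2
  have hq : (4 / 3 : ℝ) ^ D * (3 / 4) ^ D = 1 := by rw [← mul_pow]; norm_num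
  have h34 : (0 : ℝ) < (3 / 4) ^ D := by positivity
  have h2' : (1 - ε) * c * (3 / 4) ^ D ≤ s ^ D * laplace ν g (4 / 3 * s) := by
    have := mul_le_mul_of_nonneg_right h2.le h34.le
    calc _ ≤ _ := this
      _ = ((4 / 3 : ℝ) ^ D * (3 / 4) ^ D) * (s ^ D * laplace ν g (4 / 3 * s)) := by ring
      _ = _ := by rw [hq, one_mul]
  have h3 : (2 * Real.pi)⁻¹ * ∫ θ in (-(Real.pi / 2))..(Real.pi / 2),
      laplace ν g (s / Real.cos θ ^ 2) ≤ (1 + ε) * (wallis D / 2) * c / s ^ D := by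
    refine (mul_le_mul_of_nonneg_left hcos (by positivity)).trans (le_of_eq ?_)
    field_simp
  refine h3.trans ?_
  rw [div_le_iff₀ hsD]
  have h4 := mul_le_mul_of_nonneg_right hε hc.le
  rw [hK] at h4
  nlinarith

/-! ### Linear functionals of complex Gaussian noise -/

theorem integral_exp_re_mul (v t : ℝ) (hv : 0 ≤ v) (u : ℂ) :
    ∫ z, Complex.exp (t * ((star u * z).re : ℝ) * Complex.I) ∂complexGaussian v =
      Complex.exp (-((‖u‖ ^ 2 * (v / 2) * t ^ 2 / 2 : ℝ) : ℂ)) := by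
  have hm : Measurable fun p : ℝ × ℝ => (⟨p.1, p.2⟩ : ℂ) :=
    Complex.measurableEquivRealProd.symm.measurable
  unfold complexGaussian
  rw [integral_map hm.aemeasurable (by
    apply Continuous.aestronglyMeasurable; fun_prop)]
  have h1 : ∀ p : ℝ × ℝ, Complex.exp (t * ((star u * (⟨p.1, p.2⟩ : ℂ)).re : ℝ) * Complex.I) =
      Complex.exp ((t * u.re : ℝ) * p.1 * Complex.I) *
        Complex.exp ((t * u.im : ℝ) * p.2 * Complex.I) := fun p => by
    rw [← Complex.exp_add]
    congr 1
    simp only [RCLike.star_def, Complex.mul_re, Complex.conj_re, Complex.conj_im]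
    push_cast
    ring
  simp_rw [h1]
  rw [integral_prod_mul (fun x : ℝ => Complex.exp ((t * u.re : ℝ) * x * Complex.I))
      (fun y : ℝ => Complex.exp ((t * u.im : ℝ) * y * Complex.I)),
    ← charFun_apply_real, ← charFun_apply_real, charFun_gaussianReal, charFun_gaussianReal,
    ← Complex.exp_add]
  congr 1
  rw [← Complex.normSq_eq_norm_sq, Complex.normSq_apply, Real.coe_toNNReal _ (by positivity)]
  push_cast
  ring

/-- Characteristic functions: each coordinate contributes a Gaussian factor with variance `‖u i‖ ^ 2
* (v / 2)`, and the hypothesis normalises the total variance to one. -/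
theorem map_re_dotProduct {ι : Type*} [Fintype ι] {v : ℝ} (hv : 0 ≤ v) {u : ι → ℂ}
    (hu : (∑ i, ‖u i‖ ^ 2) * (v / 2) = 1) :
    (Measure.pi fun _ : ι => complexGaussian v).map (fun n => (star u ⬝ᵥ n).re) =
      gaussianReal 0 1 := by
  have hm : Continuous fun n : ι → ℂ => (star u ⬝ᵥ n).re := by
    unfold dotProduct
    fun_prop
  have := Measure.isProbabilityMeasure_map (μ := Measure.pi fun _ : ι => complexGaussian v)
    hm.aemeasurable
  refine Measure.ext_of_charFun (funext fun t => ?_)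
  rw [charFun_apply_real, integral_map hm.aemeasurable (by
    apply Continuous.aestronglyMeasurable; fun_prop), charFun_gaussianReal]
  have h1 : ∀ n : ι → ℂ, Complex.exp (t * ((star u ⬝ᵥ n).re : ℝ) * Complex.I) =
      ∏ i, Complex.exp (t * ((star (u i) * n i).re : ℝ) * Complex.I) := fun n => by
    rw [← Complex.exp_sum, ← Finset.sum_mul, ← Finset.mul_sum, ← Complex.ofReal_sum,
      ← Complex.re_sum]
    rfl
  simp_rw [h1]
  rw [integral_fintype_prod_eq_prod (fun i z =>
    Complex.exp (t * ((star (u i) * z).re : ℝ) * Complex.I))]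
  simp_rw [integral_exp_re_mul v t hv]
  rw [← Complex.exp_sum, Finset.sum_neg_distrib, ← Complex.ofReal_sum, ← Finset.sum_div,
    ← Finset.sum_mul, ← Finset.sum_mul, hu]
  congr 1
  push_cast
  simp

/-- The pairwise error probability: the noise crosses the half-way hyperplane. -/
theorem measure_re_dotProduct_le {ι : Type*} [Fintype ι] {v : ℝ} (hv : 0 < v) {u : ι → ℂ} {τ : ℝ}
    (hτ : τ = ∑ i, ‖u i‖ ^ 2) (hτ0 : 0 < τ) :
    (Measure.pi fun _ : ι => complexGaussian v) {n | τ + 2 * (star u ⬝ᵥ n).re ≤ 0} =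
      ENNReal.ofReal (craig (τ / (4 * v))) := by
  -- The real part of `star u ⬝ᵥ n` has variance `τ * v / 2`, so `k` is the reciprocal of its
  -- standard deviation. Scaling by `-k` turns the event into an upper tail at `k * τ / 2`, and `(k
  -- * τ / 2) ^ 2 / 2 = τ / (4 * v)`.
  set k : ℝ := √(2 / (v * τ)) with hk
  have hk0 : 0 < k := by positivity
  have hk2 : k ^ 2 = 2 / (v * τ) := Real.sq_sqrt (by positivity)
  have hmap := map_re_dotProduct (u := fun i => (-k : ℂ) * u i) hv.le (by
    simp only [norm_mul, norm_neg, Complex.norm_real, Real.norm_eq_abs, abs_of_pos hk0, mul_pow]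
    rw [← Finset.mul_sum, ← hτ, hk2]
    field_simp)
  have hx : 0 < k * τ / 2 := by positivity
  have hc := gaussianReal_Ici hx
  have he : (k * τ / 2) ^ 2 / 2 = τ / (4 * v) := by
    rw [div_pow, mul_pow, hk2]
    field_simp
    norm_num
  have hm : Measurable fun n : ι → ℂ => (star (fun i => (-k : ℂ) * u i) ⬝ᵥ n).re := by
    unfold dotProduct
    exact (by fun_prop : Continuous _).measurable
  rw [he, ← hmap, Measure.map_apply hm measurableSet_Ici] at hc
  rw [← hc]
  congr 1
  ext n
  have hs : (star (fun i => (-k : ℂ) * u i) ⬝ᵥ n).re = -k * (star u ⬝ᵥ n).re := by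
    have : star (fun i => (-k : ℂ) * u i) = (-k : ℂ) • star u := by
      ext i
      simp
    rw [this, smul_dotProduct, smul_eq_mul, ← Complex.ofReal_neg, Complex.re_ofReal_mul]
  simp only [Set.mem_ofPred_eq, Set.mem_preimage, Set.mem_Ici, hs]
  constructor
  · intro h
    nlinarith
  · intro h
    by_contra h'
    nlinarith [mul_pos hk0 (not_le.1 h')]

theorem measurable_craig : Measurable craig := by
  have hc : Measurable Real.cos := Real.measurable_cos
  have h : StronglyMeasurable fun p : ℝ × ℝ => Real.exp (-(p.1 / Real.cos p.2 ^ 2)) :=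
    Measurable.stronglyMeasurable (by fun_prop)
  have h2 := (h.integral_prod_right'
    (ν := volume.restrict (Set.Ioc (-(Real.pi / 2)) (Real.pi / 2)))).measurable.const_mul
      (2 * Real.pi)⁻¹
  have : craig = fun y => (2 * Real.pi)⁻¹ *
      ∫ θ in Set.Ioc (-(Real.pi / 2)) (Real.pi / 2), Real.exp (-(y / Real.cos θ ^ 2)) := by
    funext y
    rw [craig, intervalIntegral.integral_of_le (by linarith [Real.pi_pos])]
  rw [this]
  exact h2

/-! ### The equivalent diagonal channel -/

section Diagonal

variable {Nt Nr : ℕ}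

theorem submatrix_unitary {N k : ℕ} {U : Matrix (Fin N) (Fin N) ℂ}
    (hU : U ∈ Matrix.unitaryGroup (Fin N) ℂ) {f : Fin k → Fin N} :
    (U.submatrix id f)ᴴ * U = (1 : Matrix (Fin N) (Fin N) ℂ).submatrix f id := by
  rw [← Matrix.mem_unitaryGroup_iff'.1 hU, Matrix.star_eq_conjTranspose,
    Matrix.conjTranspose_submatrix]
  rfl

theorem conjTranspose_leftPart_mul {H : Matrix (Fin Nr) (Fin Nt) ℂ}
    {U : Matrix (Fin Nr) (Fin Nr) ℂ} {V : Matrix (Fin Nt) (Fin Nt) ℂ} (h : IsOrderedSVD H U V) :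
    (leftPart (Nt := Nt) U)ᴴ * H * rightPart (Nr := Nr) V =
      Matrix.diagonal fun m => ((√(orderedEigenvalues H m) : ℝ) : ℂ) := by
  obtain ⟨hU, hV, hH⟩ := h
  generalize hlam : orderedEigenvalues H = lam at hH ⊢
  have h2 : Vᴴ * rightPart (Nr := Nr) V =
      (1 : Matrix (Fin Nt) (Fin Nt) ℂ).submatrix id (Fin.castLE (min_le_left Nt Nr)) := by
    rw [← Matrix.mem_unitaryGroup_iff'.1 hV, Matrix.star_eq_conjTranspose]
    rfl
  have h1 : (leftPart (Nt := Nt) U)ᴴ * U =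
      (1 : Matrix (Fin Nr) (Fin Nr) ℂ).submatrix (Fin.castLE (min_le_right Nt Nr)) id :=
    submatrix_unitary hU
  rw [hH, show (leftPart (Nt := Nt) U)ᴴ * (U * singularMatrix Nt Nr lam * Vᴴ) *
      rightPart (Nr := Nr) V = ((leftPart (Nt := Nt) U)ᴴ * U) * singularMatrix Nt Nr lam *
        (Vᴴ * rightPart (Nr := Nr) V) by simp only [Matrix.mul_assoc], h1, h2]
  ext i j
  rw [Matrix.mul_assoc, Matrix.mul_apply]
  simp only [Matrix.submatrix_apply, id_eq, Matrix.mul_apply, Matrix.one_apply, ite_mul, one_mul,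
    zero_mul, mul_ite, mul_one, mul_zero, Finset.sum_ite_eq, Finset.sum_ite_eq', Finset.mem_univ,
    if_true, singularMatrix, Fin.val_castLE, Matrix.diagonal_apply]
  by_cases hij : i = j
  · subst hij
    simp
  · simp [hij, Fin.val_ne_of_ne hij]

/-- The image at the receive antennas of the difference vector `ψ`. -/
def receivedDifference (H : Matrix (Fin Nr) (Fin Nt) ℂ) (U : Matrix (Fin Nr) (Fin Nr) ℂ)
    (ψ : Fin (min Nt Nr) → ℂ) : Fin Nr → ℂ :=
  leftPart U *ᵥ fun m => ((√(orderedEigenvalues H m) : ℝ) : ℂ) * ψ m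

/-- The squared length of the image of `ψ` under `Λ^(1/2)`. -/
def energy (ψ : Fin (min Nt Nr) → ℂ) (lam : Fin (min Nt Nr) → ℝ) : ℝ :=
  ∑ m, ‖ψ m‖ ^ 2 * lam m

theorem measurable_energy (ψ : Fin (min Nt Nr) → ℂ) : Measurable (energy ψ) := by
  unfold energy
  fun_prop

theorem energy_nonneg (ψ : Fin (min Nt Nr) → ℂ) {lam : Fin (min Nt Nr) → ℝ} (h : ∀ m, 0 ≤ lam m) :
    0 ≤ energy ψ lam :=
  Finset.sum_nonneg fun m _ => mul_nonneg (by positivity) (h m)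

theorem energy_pos {ψ : Fin (min Nt Nr) → ℂ} (hψ : ψ ≠ 0) {lam : Fin (min Nt Nr) → ℝ}
    (h : ∀ m, 0 < lam m) : 0 < energy ψ lam := by
  obtain ⟨m, hm⟩ := Function.ne_iff.1 hψ
  refine Finset.sum_pos' (fun m _ => mul_nonneg (by positivity) (h m).le)
    ⟨m, Finset.mem_univ m, mul_pos ?_ (h m)⟩
  have := norm_pos_iff.2 hm
  positivity

theorem norm_sqrt_mul_sq {x : ℝ} (hx : 0 ≤ x) (z : ℂ) :
    ‖((√x : ℝ) : ℂ) * z‖ ^ 2 = ‖z‖ ^ 2 * x := by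
  rw [norm_mul, Complex.norm_real, Real.norm_eq_abs, abs_of_nonneg (Real.sqrt_nonneg _), mul_pow,
    Real.sq_sqrt hx, mul_comm]

theorem dotProduct_star_self_re {ι : Type*} [Fintype ι] (u : ι → ℂ) :
    (star u ⬝ᵥ u).re = ∑ i, ‖u i‖ ^ 2 := by
  rw [dotProduct, Complex.re_sum]
  refine Finset.sum_congr rfl fun i _ => ?_
  rw [Pi.star_apply, RCLike.star_def, Complex.conj_mul', ← Complex.ofReal_pow, Complex.ofReal_re]

theorem energy_eq {H : Matrix (Fin Nr) (Fin Nt) ℂ} {U : Matrix (Fin Nr) (Fin Nr) ℂ}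
    (hU : U ∈ Matrix.unitaryGroup (Fin Nr) ℂ) (ψ : Fin (min Nt Nr) → ℂ) :
    energy ψ (orderedEigenvalues H) = ∑ i, ‖receivedDifference H U ψ i‖ ^ 2 := by
  have h1 : (leftPart (Nt := Nt) U)ᴴ * leftPart (Nt := Nt) U = 1 := by
    have := congrArg (fun A => A.submatrix id (Fin.castLE (min_le_right Nt Nr)))
      (submatrix_unitary hU (f := Fin.castLE (min_le_right Nt Nr)))
    refine (Eq.trans ?_ this).trans ?_
    · rfl
    · ext i j
      simp [Matrix.one_apply, Fin.ext_iff]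
  rw [← dotProduct_star_self_re, receivedDifference, Matrix.star_mulVec, ← Matrix.dotProduct_mulVec,
    Matrix.mulVec_mulVec, h1, Matrix.one_mulVec, dotProduct_star_self_re, energy]
  exact Finset.sum_congr rfl fun m _ => (norm_sqrt_mul_sq (orderedEigenvalues_nonneg H m) _).symm

end Diagonal

/-- A wrong symbol vector `s'` can only be as good as the sent one if the noise crosses the
half-way hyperplane. -/
theorem Transmission.energy_add_le {Nt Nr L M : ℕ} {Ω : Type*} (T : Transmission Nt Nr L M Ω)
    (code : LayeredCode (min Nt Nr) L M) {ω : Ω} (h : IsOrderedSVD (T.H ω) (T.U ω) (T.V ω))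
    {s' : Fin (min Nt Nr) → ℂ} (hle : T.mlMetric code ω s' ≤ T.mlMetric code ω (T.sent code ω)) :
    energy (T.sent code ω - s') (orderedEigenvalues (T.H ω)) +
      2 * (star (receivedDifference (T.H ω) (T.U ω) (T.sent code ω - s')) ⬝ᵥ T.noise ω).re ≤ 0 := by
  generalize hs : T.sent code ω = s at *
  set lam := orderedEigenvalues (T.H ω) with hlam
  set p := (leftPart (Nt := Nt) (T.U ω))ᴴ *ᵥ T.noise ω with hp
  have hz : ∀ m, T.processed code ω m = ((√(lam m) : ℝ) : ℂ) * s m + p m := fun m => by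
    rw [Transmission.processed, Transmission.received, hs, Matrix.mulVec_add, Matrix.mulVec_mulVec,
      Matrix.mulVec_mulVec, conjTranspose_leftPart_mul h, Pi.add_apply,
      Matrix.mulVec_diagonal]
  have hdot : star (receivedDifference (T.H ω) (T.U ω) (s - s')) ⬝ᵥ T.noise ω =
      star (fun m => ((√(lam m) : ℝ) : ℂ) * (s - s') m) ⬝ᵥ p := by
    rw [receivedDifference, Matrix.star_mulVec, ← Matrix.dotProduct_mulVec]
  rw [hdot, dotProduct, Complex.re_sum, Finset.mul_sum, energy, ← Finset.sum_add_distrib]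
  unfold Transmission.mlMetric at hle
  rw [← sub_nonpos, ← Finset.sum_sub_distrib] at hle
  -- With `p` the processed noise, the sent vector has residual `p` and the rival has residual `a +
  -- p`; coordinatewise `‖a + p‖² - ‖p‖² = ‖a‖² + 2 Re (conj a * p)`.
  refine (Finset.sum_congr rfl fun m _ => ?_).trans_le hle
  rw [← norm_sqrt_mul_sq (orderedEigenvalues_nonneg (T.H ω) m), hz, add_sub_cancel_left,
    show ((√(lam m) : ℝ) : ℂ) * s m + p m - ((√(lam m) : ℝ) : ℂ) * s' m =
      ((√(lam m) : ℝ) : ℂ) * (s - s') m + p m by rw [Pi.sub_apply]; ring]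
  rw [Pi.star_apply]
  generalize ((√(lam m) : ℝ) : ℂ) * (s - s') m = a
  simp only [← Complex.normSq_eq_norm_sq, Complex.normSq_apply, RCLike.star_def, Complex.mul_re,
    Complex.conj_re, Complex.conj_im, Complex.add_re, Complex.add_im]
  ring

/-! ### The union bound for the word error probability -/

section Measurability

variable {Nt Nr : ℕ} {X : Type*} [MeasurableSpace X]

theorem measurable_orderedEigenvalues {f : X → Fin Nr → Fin Nt → ℂ} (hf : Measurable f) :
    Measurable fun x => orderedEigenvalues (Nt := Nt) (Nr := Nr) (Matrix.of (f x)) := by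
  simp_rw [orderedEigenvalues_eq]
  refine measurable_eigs_mul_conjTranspose
    (f := fun x => wideMatrix (Nt := Nt) (Nr := Nr) (Matrix.of (f x))) ?_
  refine measurable_pi_lambda _ fun i => measurable_pi_lambda _ fun j => ?_
  by_cases h : Nr < Nt
  · simp only [wideMatrix, dif_pos h, Matrix.of_apply]
    fun_prop
  · simp only [wideMatrix, dif_neg h, Matrix.of_apply]
    fun_prop

theorem measurable_receivedDifference {f : X → Fin Nr → Fin Nt → ℂ} (hf : Measurable f)
    {u : X → Fin Nr → Fin Nr → ℂ} (hu : Measurable u) (ψ : Fin (min Nt Nr) → ℂ) (i : Fin Nr) :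
    Measurable fun x => receivedDifference (Nt := Nt) (Nr := Nr) (Matrix.of (f x))
      (Matrix.of (u x)) ψ i := by
  unfold receivedDifference Matrix.mulVec dotProduct leftPart
  have h := fun m => measurable_pi_iff.1 (measurable_orderedEigenvalues hf) m
  simp only [Matrix.submatrix_apply, id_eq, Matrix.of_apply]
  refine Finset.measurable_sum _ fun m _ => Measurable.mul (by fun_prop) ?_
  exact (Complex.measurable_ofReal.comp (h m).sqrt).mul_const _

end Measurability

variable {Nt Nr L M : ℕ}

/-- Channel data and noise for which some vector of `t` is at least as good as the vector `s` that
was sent. -/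
def errorSet (s : Fin (min Nt Nr) → ℂ) (t : Finset (Fin (min Nt Nr) → ℂ)) :
    Set ((Fin Nr → Fin Nt → ℂ) × (Fin Nr → Fin Nr → ℂ) × (Fin Nt → Fin Nt → ℂ) × (Fin Nr → ℂ)) :=
  ⋃ s' ∈ t, {q | energy (s - s') (orderedEigenvalues (Nt := Nt) (Nr := Nr) (Matrix.of q.1)) +
    2 * (star (receivedDifference (Matrix.of q.1) (Matrix.of q.2.1) (s - s')) ⬝ᵥ q.2.2.2).re ≤ 0}

theorem measurableSet_errorSet (s : Fin (min Nt Nr) → ℂ) (t : Finset (Fin (min Nt Nr) → ℂ)) :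
    MeasurableSet (errorSet s t) := by
  refine t.measurableSet_biUnion fun _ _ => measurableSet_le (Measurable.add ?_ ?_)
    measurable_const
  · exact (measurable_energy _).comp (measurable_orderedEigenvalues measurable_fst)
  · refine (Complex.measurable_re.comp ?_).const_mul 2
    unfold dotProduct
    refine Finset.measurable_sum _ fun i _ => Measurable.mul ?_ (by fun_prop)
    simp only [Pi.star_apply, RCLike.star_def]
    exact Complex.continuous_conj.measurable.comp (measurable_receivedDifference
      measurable_fst (measurable_fst.comp measurable_snd) _ i)

/-- The capped sum of the pairwise error probabilities, given the eigenvalues. -/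
def cappedUnion (N₀ : ℝ) (s : Fin (min Nt Nr) → ℂ) (t : Finset (Fin (min Nt Nr) → ℂ))
    (lam : Fin (min Nt Nr) → ℝ) : ℝ :=
  min 1 (∑ s' ∈ t, craig (energy (s - s') lam / (4 * N₀)))

theorem measurable_cappedUnion (N₀ : ℝ) (s : Fin (min Nt Nr) → ℂ)
    (t : Finset (Fin (min Nt Nr) → ℂ)) : Measurable (cappedUnion N₀ s t) :=
  measurable_const.min (Finset.measurable_sum _ fun _ _ =>
    measurable_craig.comp ((measurable_energy _).div_const _))

theorem cappedUnion_nonneg (N₀ : ℝ) (s : Fin (min Nt Nr) → ℂ)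
    (t : Finset (Fin (min Nt Nr) → ℂ)) (lam : Fin (min Nt Nr) → ℝ) : 0 ≤ cappedUnion N₀ s t lam :=
  le_min zero_le_one (Finset.sum_nonneg fun _ _ => craig_nonneg _)

theorem integrable_cappedUnion {ν : Measure (Fin (min Nt Nr) → ℝ)} [IsProbabilityMeasure ν]
    (N₀ : ℝ) (s : Fin (min Nt Nr) → ℂ) (t : Finset (Fin (min Nt Nr) → ℂ)) :
    Integrable (cappedUnion N₀ s t) ν :=
  (integrable_const (1 : ℝ)).mono' (measurable_cappedUnion N₀ s t).aestronglyMeasurable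
    (ae_of_all _ fun x => by
      rw [Real.norm_eq_abs, abs_of_nonneg (cappedUnion_nonneg N₀ s t x)]
      exact min_le_left _ _)

/-- The union bound for a fixed channel, capped because it bounds a probability. Positive
eigenvalues ensure that distinct symbols have a positive received distance, as the pairwise formula
needs. -/
theorem measure_noise_le {N₀ : ℝ} (hN₀ : 0 < N₀) {H : Matrix (Fin Nr) (Fin Nt) ℂ}
    {U : Matrix (Fin Nr) (Fin Nr) ℂ} (hU : U ∈ Matrix.unitaryGroup (Fin Nr) ℂ)
    (hpos : ∀ m, 0 < orderedEigenvalues H m) (s : Fin (min Nt Nr) → ℂ)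
    {t : Finset (Fin (min Nt Nr) → ℂ)} (ht : ∀ s' ∈ t, s' ≠ s) :
    (Measure.pi fun _ : Fin Nr => complexGaussian N₀) (⋃ s' ∈ t, {n | energy (s - s')
      (orderedEigenvalues H) + 2 * (star (receivedDifference H U (s - s')) ⬝ᵥ n).re ≤ 0}) ≤
      ENNReal.ofReal (cappedUnion N₀ s t (orderedEigenvalues H)) := by
  rw [cappedUnion, ENNReal.ofReal_min, ENNReal.ofReal_one,
    ENNReal.ofReal_sum_of_nonneg fun _ _ => craig_nonneg _]
  refine le_min prob_le_one ((measure_biUnion_finset_le _ _).trans (Finset.sum_le_sum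
    fun s' hs' => ?_))
  exact (measure_re_dotProduct_le hN₀ (energy_eq hU _)
    (energy_pos (sub_ne_zero.2 (ht s' hs').symm) hpos)).le

variable {Ω : Type*} [MeasurableSpace Ω] {μ : Measure Ω}
  {T : Transmission Nt Nr L M Ω} {code : LayeredCode (min Nt Nr) L M} {N₀ : ℝ}

theorem Transmission.IsMLSystem.aemeasurable_channel (h : T.IsMLSystem code N₀ μ) :
    AEMeasurable (fun ω => ((fun i j => T.H ω i j, fun i j => T.U ω i j, fun i j => T.V ω i j) :
      (Fin Nr → Fin Nt → ℂ) × (Fin Nr → Fin Nr → ℂ) × (Fin Nt → Fin Nt → ℂ))) μ := by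
  refine AEMeasurable.prodMk ?_ (AEMeasurable.prodMk ?_ ?_)
  · exact aemeasurable_pi_lambda _ fun i => aemeasurable_pi_lambda _ fun j =>
      (h.channel.law i j).aemeasurable
  · exact (measurable_pi_lambda _ fun i => measurable_pi_lambda _ fun j =>
      h.measurable_U i j).aemeasurable
  · exact (measurable_pi_lambda _ fun i => measurable_pi_lambda _ fun j =>
      h.measurable_V i j).aemeasurable

theorem Transmission.IsMLSystem.map_noise [IsProbabilityMeasure μ]
    (h : T.IsMLSystem code N₀ μ) :
    AEMeasurable T.noise μ ∧ μ.map T.noise = Measure.pi fun _ => complexGaussian N₀ := by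
  have hm : ∀ i, AEMeasurable (fun ω => T.noise ω i) μ := fun i => (h.noise_law i).aemeasurable
  refine ⟨aemeasurable_pi_lambda _ hm, ?_⟩
  have := (iIndepFun_iff_map_fun_eq_pi_map hm).1 h.noise_iid
  simp_rw [fun i => (h.noise_law i).map_eq] at this
  exact this

/-- Independence of the noise allows conditioning on `H`, `U` and `V`. The conditional bound
involves only the ordered eigenvalues, so averaging it needs only their law and nothing about how
`U` and `V` were selected. -/
theorem Transmission.IsMLSystem.measure_errorSet_le [IsProbabilityMeasure μ]
    (h : T.IsMLSystem code N₀ μ) (hN₀ : 0 < N₀)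
    (s : Fin (min Nt Nr) → ℂ) {t : Finset (Fin (min Nt Nr) → ℂ)} (ht : ∀ s' ∈ t, s' ≠ s) :
    μ ((fun ω => ((fun i j => T.H ω i j, fun i j => T.U ω i j, fun i j => T.V ω i j, T.noise ω) :
        (Fin Nr → Fin Nt → ℂ) × (Fin Nr → Fin Nr → ℂ) × (Fin Nt → Fin Nt → ℂ) × (Fin Nr → ℂ))) ⁻¹'
      errorSet s t) ≤
      ENNReal.ofReal (∫ x, cappedUnion N₀ s t x ∂eigenvalueLaw Nt Nr) := by
  have hX := h.aemeasurable_channel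
  obtain ⟨hn, hnl⟩ := h.map_noise
  have hmap := (indepFun_iff_map_prod_eq_prod_map_map hX hn).1 h.noise_indep
  rw [hnl] at hmap
  let e : ((Fin Nr → Fin Nt → ℂ) × (Fin Nr → Fin Nr → ℂ) × (Fin Nt → Fin Nt → ℂ)) × (Fin Nr → ℂ) →
      (Fin Nr → Fin Nt → ℂ) × (Fin Nr → Fin Nr → ℂ) × (Fin Nt → Fin Nt → ℂ) × (Fin Nr → ℂ) :=
    fun p => (p.1.1, p.1.2.1, p.1.2.2, p.2)
  have he : Measurable e := by fun_prop
  have hE := he (measurableSet_errorSet s t)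
  have h1 := DFunLike.congr_fun hmap (e ⁻¹' errorSet s t)
  rw [Measure.map_apply_of_aemeasurable (hX.prodMk hn) hE, Measure.prod_apply hE,
    lintegral_map' (measurable_measure_prodMk_left hE).aemeasurable hX] at h1
  refine (le_of_eq h1).trans ?_
  have hlaw := h.channel.hasLaw_orderedEigenvalues
  have hpos : ∀ᵐ ω ∂μ, ∀ m, 0 < orderedEigenvalues (T.H ω) m := by
    have := eigenvalueLaw_ae_pos Nt Nr
    rw [← hlaw.map_eq] at this
    exact ae_of_ae_map hlaw.aemeasurable this
  rw [ofReal_integral_eq_lintegral_ofReal (integrable_cappedUnion N₀ s t)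
    (ae_of_all _ (cappedUnion_nonneg N₀ s t)), ← hlaw.map_eq,
    lintegral_map' (measurable_cappedUnion N₀ s t).ennreal_ofReal.aemeasurable hlaw.aemeasurable]
  refine lintegral_mono_ae ?_
  filter_upwards [h.svd, hpos] with ω hω hp
  refine le_trans (measure_mono ?_) (measure_noise_le hN₀ hω.1 hp s ht)
  intro n hn'
  obtain ⟨s', hs', hq⟩ := Set.mem_iUnion₂.1 hn'
  exact Set.mem_iUnion₂.2 ⟨s', hs', hq⟩

theorem Transmission.IsMLSystem.measure_msg (h : T.IsMLSystem code N₀ μ) (w : Fin L → Fin M) :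
    μ (T.msg ⁻¹' {w}) = ENNReal.ofReal (1 / (M : ℝ) ^ L) := by
  have hcard : Fintype.card (Fin L → Fin M) = M ^ L := by simp
  have hpos : 0 < M ^ L := hcard ▸ Fintype.card_pos_iff.2 ⟨w⟩
  rw [← Measure.map_apply_of_aemeasurable h.msg_law.aemeasurable (measurableSet_singleton w),
    h.msg_law.map_eq, uniformOn_univ, Measure.count_singleton, hcard,
    ENNReal.ofReal_div_of_pos (by exact_mod_cast hpos), ENNReal.ofReal_one, ← Nat.cast_pow,
    ENNReal.ofReal_natCast]

theorem LayeredCode.symbol_injective (code : LayeredCode (min Nt Nr) L M) :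
    Function.Injective code.symbol := code.superposition_injective

theorem LayeredCode.symbol_mem (code : LayeredCode (min Nt Nr) L M) (w : Fin L → Fin M) :
    code.symbol w ∈ code.symbols := by
  classical
  unfold LayeredCode.symbols
  exact Finset.mem_image_of_mem _ (Finset.mem_univ w)

theorem LayeredCode.sum_symbols (code : LayeredCode (min Nt Nr) L M)
    (f : (Fin (min Nt Nr) → ℂ) → ℝ) : ∑ s ∈ code.symbols, f s = ∑ w, f (code.symbol w) := by
  classical
  unfold LayeredCode.symbols
  rw [Finset.sum_image fun a _ b _ hab => code.symbol_injective hab]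

open Classical in
/-- The union bound, averaged over the messages and the channel. -/
theorem Transmission.IsMLSystem.awep_le [IsProbabilityMeasure μ]
    (h : T.IsMLSystem code N₀ μ) (hN₀ : 0 < N₀) :
    T.awep code μ ≤ 1 / (M : ℝ) ^ L * ∑ s ∈ code.symbols,
      ∫ x, cappedUnion N₀ s {s' ∈ code.symbols | s' ≠ s} x ∂eigenvalueLaw Nt Nr := by
  let Y : Ω → (Fin Nr → Fin Nt → ℂ) × (Fin Nr → Fin Nr → ℂ) × (Fin Nt → Fin Nt → ℂ) ×
    (Fin Nr → ℂ) := fun ω =>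
      (fun i j => T.H ω i j, fun i j => T.U ω i j, fun i j => T.V ω i j, T.noise ω)
  let t : (Fin (min Nt Nr) → ℂ) → Finset (Fin (min Nt Nr) → ℂ) := fun s =>
    {s' ∈ code.symbols | s' ≠ s}
  -- The detector's own output is the rival that crosses the half-way hyperplane. Only this
  -- inclusion is used, so `sHat` need not be measurable and the rule for ties is irrelevant.
  have hsub : {ω | T.sHat ω ≠ T.sent code ω} ≤ᵐ[μ]
      ⋃ w, T.msg ⁻¹' {w} ∩ Y ⁻¹' errorSet (code.symbol w) (t (code.symbol w)) := by
    filter_upwards [h.svd, h.detect_mem, h.detect_min] with ω hω hmem hmin hne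
    refine Set.mem_iUnion.2 ⟨T.msg ω, rfl, Set.mem_biUnion (x := T.sHat ω)
      (Finset.mem_filter.2 ⟨hmem, hne⟩) ?_⟩
    exact T.energy_add_le code hω (hmin _ (code.symbol_mem _))
  have hle : μ {ω | T.sHat ω ≠ T.sent code ω} ≤ ENNReal.ofReal (1 / (M : ℝ) ^ L *
      ∑ s ∈ code.symbols, ∫ x, cappedUnion N₀ s (t s) x ∂eigenvalueLaw Nt Nr) := by
    refine (measure_mono_ae hsub).trans ((measure_iUnion_fintype_le μ _).trans ?_)
    rw [LayeredCode.sum_symbols, Finset.mul_sum, ENNReal.ofReal_sum_of_nonneg fun w _ =>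
      mul_nonneg (by positivity) (integral_nonneg (cappedUnion_nonneg _ _ _))]
    refine Finset.sum_le_sum fun w _ => ?_
    rw [h.msg_indep.measure_inter_preimage_eq_mul _ _ (measurableSet_singleton w)
      (measurableSet_errorSet _ _), h.measure_msg, ENNReal.ofReal_mul (by positivity)]
    exact mul_le_mul_right (h.measure_errorSet_le hN₀ _ fun s' hs' => (Finset.mem_filter.1 hs').2) _
  exact ENNReal.toReal_le_of_le_ofReal (mul_nonneg (by positivity) (Finset.sum_nonneg fun s _ =>
    integral_nonneg (cappedUnion_nonneg _ _ _))) hle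

/-! ### The bound in closed form -/

variable {Nt Nr L M : ℕ}

theorem two_rpow_spectralEfficiency [Nonempty (Fin L → Fin M)] :
    (2 : ℝ) ^ spectralEfficiency L M = (M : ℝ) ^ L := by
  obtain ⟨w⟩ := ‹Nonempty (Fin L → Fin M)›
  unfold spectralEfficiency
  rcases Nat.eq_zero_or_pos L with rfl | hL
  · simp
  · have hM : (0 : ℝ) < M := by exact_mod_cast (w ⟨0, hL⟩).pos
    rw [mul_comm, Real.rpow_mul zero_le_two, Real.rpow_logb two_pos (by norm_num) hM,
      Real.rpow_natCast]

theorem laplace_energy (hNt : 0 < Nt) (hNr : 0 < Nr) (ψ : Fin (min Nt Nr) → ℂ) {s : ℝ}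
    (hs : 0 ≤ s) : laplace (eigenvalueLaw Nt Nr) (energy ψ) s =
      mgfClosedForm Nt Nr fun m => s * ‖ψ m‖ ^ 2 := by
  rw [← integral_exp_mul_eigenvalueDensity hNt hNr fun m => by positivity, ← integral_eigenvalueLaw,
    laplace]
  refine integral_congr_ae (ae_of_all _ fun x => ?_)
  beta_reduce
  rw [← Real.exp_sum, energy, Finset.mul_sum, ← Finset.sum_neg_distrib]
  congr 1
  exact Finset.sum_congr rfl fun m _ => by ring

/-- The contribution of one pair is the mean of the exponential bound. -/
theorem pairTerm_eq (hNt : 0 < Nt) (hNr : 0 < Nr) {N₀ : ℝ} (hN₀ : 0 < N₀)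
    (ψ : Fin (min Nt Nr) → ℂ) : 1 / normConst Nt Nr * pairTerm Nt Nr N₀ ψ =
      1 / 12 * laplace (eigenvalueLaw Nt Nr) (energy ψ) (1 / (4 * N₀)) +
        1 / 4 * laplace (eigenvalueLaw Nt Nr) (energy ψ) (4 / 3 * (1 / (4 * N₀))) := by
  have ha : aVec N₀ ψ = fun m => 1 / (4 * N₀) * ‖ψ m‖ ^ 2 := funext fun m => by
    rw [aVec, one_div_mul_eq_div]
  -- Since `1 / 3 = 4 / 3 * (1 / 4)`, the vector `b` is `a` with the signal-to-noise argument scaled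
  -- by `4 / 3`, the second exponent of `expBound`.
  have hb : bVec N₀ ψ = fun m => 4 / 3 * (1 / (4 * N₀)) * ‖ψ m‖ ^ 2 := funext fun m => by
    rw [bVec]
    field_simp
  rw [laplace_energy hNt hNr ψ (by positivity), laplace_energy hNt hNr ψ (by positivity), ← ha, ← hb,
    mgfClosedForm, mgfClosedForm, pairTerm]
  simp only [mul_add, Finset.mul_sum, ← Finset.sum_add_distrib]
  exact Finset.sum_congr rfl fun β _ => by ring

theorem ae_energy_nonneg (ψ : Fin (min Nt Nr) → ℂ) :
    ∀ᵐ x ∂eigenvalueLaw Nt Nr, 0 ≤ energy ψ x :=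
  (eigenvalueLaw_ae_pos Nt Nr).mono fun _ hx => energy_nonneg ψ fun m => (hx m).le

theorem integrable_expBound_energy {N₀ : ℝ} (hN₀ : 0 < N₀) (ψ : Fin (min Nt Nr) → ℂ) :
    Integrable (fun x => expBound (energy ψ x / (4 * N₀))) (eigenvalueLaw Nt Nr) ∧
    ∫ x, expBound (energy ψ x / (4 * N₀)) ∂eigenvalueLaw Nt Nr =
      1 / 12 * laplace (eigenvalueLaw Nt Nr) (energy ψ) (1 / (4 * N₀)) +
        1 / 4 * laplace (eigenvalueLaw Nt Nr) (energy ψ) (4 / 3 * (1 / (4 * N₀))) := by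
  have h1 := (integrable_laplace (measurable_energy ψ) (ae_energy_nonneg ψ)
    (s := 1 / (4 * N₀)) (by positivity)).const_mul (1 / 12)
  have h2 := (integrable_laplace (measurable_energy ψ) (ae_energy_nonneg ψ)
    (s := 4 / 3 * (1 / (4 * N₀))) (by positivity)).const_mul (1 / 4)
  have he : (fun x => expBound (energy ψ x / (4 * N₀))) = fun x =>
      1 / 12 * Real.exp (-(1 / (4 * N₀) * energy ψ x)) +
        1 / 4 * Real.exp (-(4 / 3 * (1 / (4 * N₀)) * energy ψ x)) := funext fun x => by
    rw [expBound]
    congr 4 <;> ring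
  rw [he]
  refine ⟨h1.add h2, ?_⟩
  rw [integral_add h1 h2, integral_const_mul, integral_const_mul]
  rfl

/-- At every noise level, the capped union bound is at most `1/3` more than the sum of the
contributions of the other vectors. -/
theorem integral_cappedUnion_le (hNt : 0 < Nt) (hNr : 0 < Nr) {N₀ : ℝ} (hN₀ : 0 < N₀)
    (s : Fin (min Nt Nr) → ℂ) (t : Finset (Fin (min Nt Nr) → ℂ)) :
    ∫ x, cappedUnion N₀ s t x ∂eigenvalueLaw Nt Nr ≤
      1 / 3 + ∑ s' ∈ t, 1 / normConst Nt Nr * pairTerm Nt Nr N₀ (s - s') := by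
  have hint := fun s' => integrable_expBound_energy (Nt := Nt) (Nr := Nr) hN₀ (s - s')
  have hle : ∫ x, cappedUnion N₀ s t x ∂eigenvalueLaw Nt Nr ≤
      ∫ x, (1 / 3 + ∑ s' ∈ t, expBound (energy (s - s') x / (4 * N₀))) ∂eigenvalueLaw Nt Nr := by
    refine integral_mono_ae (integrable_cappedUnion N₀ s t)
      ((integrable_const _).add (integrable_finsetSum _ fun s' _ => (hint s').1))
      ((eigenvalueLaw_ae_pos Nt Nr).mono fun x hx => ?_)
    exact min_one_sum_craig_le t _ fun s' _ =>
      div_nonneg (energy_nonneg _ fun m => (hx m).le) (by positivity)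
  refine hle.trans (le_of_eq ?_)
  rw [integral_add (integrable_const _) (integrable_finsetSum _ fun s' _ => (hint s').1),
    integral_finsetSum _ fun s' _ => (hint s').1]
  congr 1
  · simp
  · exact Finset.sum_congr rfl fun s' _ => by rw [(hint s').2, pairTerm_eq hNt hNr hN₀]

/-- For zero difference both transforms equal one, and `1 / 12 + 1 / 4 = 1 / 3`: precisely the
excess in the capped union bound. -/
theorem pairTerm_zero (hNt : 0 < Nt) (hNr : 0 < Nr) {N₀ : ℝ} (hN₀ : 0 < N₀) :
    1 / normConst Nt Nr * pairTerm Nt Nr N₀ 0 = 1 / 3 := by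
  rw [pairTerm_eq hNt hNr hN₀]
  have : ∀ s, laplace (eigenvalueLaw Nt Nr) (energy 0) s = 1 := fun s => by
    simp [laplace, energy]
  rw [this, this]
  norm_num

/-- At high signal-to-noise ratio, the mean tail function is at most the contribution of the
pair. -/
theorem exists_integral_craig_le (hNt : 0 < Nt) (hNr : 0 < Nr) {ψ : Fin (min Nt Nr) → ℂ}
    (hψ : ψ ≠ 0) : ∃ N₁ > 0, ∀ N₀, 0 < N₀ → N₀ < N₁ →
      ∫ x, craig (energy ψ x / (4 * N₀)) ∂eigenvalueLaw Nt Nr ≤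
        1 / normConst Nt Nr * pairTerm Nt Nr N₀ ψ := by
  have hr : IsRational (laplace (eigenvalueLaw Nt Nr) (energy ψ)) := by
    obtain ⟨P, Q, h⟩ := isRational_mgfClosedForm Nt Nr (w := fun m => ‖ψ m‖ ^ 2)
      fun m => by positivity
    exact ⟨P, Q, fun s hs => by rw [laplace_energy hNt hNr ψ (le_of_lt hs)]; exact h s hs⟩
  obtain ⟨S, hS⟩ := Filter.eventually_atTop.1 (eventually_integral_craig_le (measurable_energy ψ)
    ((eigenvalueLaw_ae_pos Nt Nr).mono fun x hx => energy_pos hψ hx) hr)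
  -- Noise below this threshold means `1 / (4 * N₀) > max S 1`; the maximum keeps the threshold
  -- positive whatever the sign of `S`.
  refine ⟨1 / (4 * max S 1), by positivity, fun N₀ h0 h1 => ?_⟩
  have hmax : 0 < max S 1 := by positivity
  rw [pairTerm_eq hNt hNr h0]
  refine le_trans (le_of_eq ?_) (hS (1 / (4 * N₀)) ?_)
  · refine integral_congr_ae (ae_of_all _ fun x => ?_)
    beta_reduce
    congr 1
    ring
  · refine (le_max_left S 1).trans ?_
    rw [lt_div_iff₀ (by positivity)] at h1
    rw [le_div_iff₀ (by positivity)]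
    linarith

theorem integrable_craig_energy {N₀ : ℝ} (hN₀ : 0 < N₀) (ψ : Fin (min Nt Nr) → ℂ) :
    Integrable (fun x => craig (energy ψ x / (4 * N₀))) (eigenvalueLaw Nt Nr) := by
  refine ((integrable_expBound_energy hN₀ ψ).1.const_mul (3 / 2)).mono'
    (measurable_craig.comp ((measurable_energy ψ).div_const _)).aestronglyMeasurable
    ((ae_energy_nonneg ψ).mono fun x hx => ?_)
  rw [Real.norm_eq_abs, abs_of_nonneg (craig_nonneg _)]
  exact craig_le (by positivity)

theorem integral_cappedUnion_le_sum {N₀ : ℝ} (hN₀ : 0 < N₀)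
    (s : Fin (min Nt Nr) → ℂ) (t : Finset (Fin (min Nt Nr) → ℂ)) :
    ∫ x, cappedUnion N₀ s t x ∂eigenvalueLaw Nt Nr ≤
      ∑ s' ∈ t, ∫ x, craig (energy (s - s') x / (4 * N₀)) ∂eigenvalueLaw Nt Nr := by
  rw [← integral_finsetSum _ fun s' _ => integrable_craig_energy hN₀ (s - s')]
  exact integral_mono (integrable_cappedUnion N₀ s t)
    (integrable_finsetSum _ fun s' _ => integrable_craig_energy hN₀ (s - s'))
    fun x => min_le_right _ _

/-- A threshold below which `exists_integral_craig_le` holds for all pairs of a finite set. -/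
theorem exists_integral_craig_le_finset (hNt : 0 < Nt) (hNr : 0 < Nr)
    (t : Finset (Fin (min Nt Nr) → ℂ)) : ∃ N₁ > 0, ∀ N₀, 0 < N₀ → N₀ < N₁ →
      ∀ s ∈ t, ∀ s' ∈ t, s' ≠ s → ∫ x, craig (energy (s - s') x / (4 * N₀)) ∂eigenvalueLaw Nt Nr ≤
        1 / normConst Nt Nr * pairTerm Nt Nr N₀ (s - s') := by
  have h : ∀ p ∈ t ×ˢ t, ∀ᶠ N₀ in nhdsWithin (0 : ℝ) (Set.Ioi 0), p.2 ≠ p.1 →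
      ∫ x, craig (energy (p.1 - p.2) x / (4 * N₀)) ∂eigenvalueLaw Nt Nr ≤
        1 / normConst Nt Nr * pairTerm Nt Nr N₀ (p.1 - p.2) := fun p _ => by
    by_cases hp : p.2 = p.1
    · exact Filter.Eventually.of_forall fun _ h => absurd hp h
    · obtain ⟨N₁, h1, h2⟩ := exists_integral_craig_le hNt hNr (sub_ne_zero.2 (Ne.symm hp))
      filter_upwards [Ioo_mem_nhdsGT h1] with N₀ hN _
      exact h2 N₀ hN.1 hN.2
  have h' := (Filter.eventually_all_finset _).2 h
  obtain ⟨N₁, h1, h2⟩ := (mem_nhdsGT_iff_exists_Ioo_subset).1 h'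
  exact ⟨N₁, h1, fun N₀ h0 hN s hs s' hs' hne =>
    h2 ⟨h0, hN⟩ (s, s') (Finset.mk_mem_product hs hs') hne⟩

end

end SLMIMO

/-! ### Assembly of the three claims -/

theorem mainTheorem3 (Nt Nr L M : ℕ) (hNt : 0 < Nt) (hNr : 0 < Nr) :
    -- the joint moment generating function of the ordered eigenvalues at `-a`
    (∀ (Ω : Type u) [MeasurableSpace Ω] (μ : Measure Ω) [IsProbabilityMeasure μ]
        (H : Ω → Matrix (Fin Nr) (Fin Nt) ℂ), SLMIMO.IsGaussianChannel H μ →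
        ∀ a : Fin (min Nt Nr) → ℝ, (∀ m, 0 ≤ a m) →
          ∫ ω, ∏ m, Real.exp (-a m * SLMIMO.orderedEigenvalues (H ω) m) ∂μ =
              ∫ x in SLMIMO.orderedDomain (min Nt Nr),
                (∏ m, Real.exp (-a m * x m)) * SLMIMO.eigenvalueDensity Nt Nr x ∧
          ∫ ω, ∏ m, Real.exp (-a m * SLMIMO.orderedEigenvalues (H ω) m) ∂μ =
              SLMIMO.mgfClosedForm Nt Nr a) ∧
    -- the bound, with the double sum over all pairs, at every noise level
    (∀ (code : SLMIMO.LayeredCode (min Nt Nr) L M) (N₀ : ℝ), 0 < N₀ →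
        ∀ (Ω : Type u) [MeasurableSpace Ω] (μ : Measure Ω) [IsProbabilityMeasure μ]
          (T : SLMIMO.Transmission Nt Nr L M Ω), T.IsMLSystem code N₀ μ →
          T.awep code μ ≤
            1 / ((2 : ℝ) ^ SLMIMO.spectralEfficiency L M * SLMIMO.normConst Nt Nr) *
              ∑ s ∈ code.symbols, ∑ s' ∈ code.symbols, SLMIMO.pairTerm Nt Nr N₀ (s - s')) ∧
    -- the bound, with the sum over pairs of distinct vectors, at high signal-to-noise ratio
    (∀ code : SLMIMO.LayeredCode (min Nt Nr) L M, ∃ N₁ : ℝ, 0 < N₁ ∧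
        ∀ N₀ : ℝ, 0 < N₀ → N₀ < N₁ →
        ∀ (Ω : Type u) [MeasurableSpace Ω] (μ : Measure Ω) [IsProbabilityMeasure μ]
          (T : SLMIMO.Transmission Nt Nr L M Ω), T.IsMLSystem code N₀ μ →
          T.awep code μ ≤
            1 / ((2 : ℝ) ^ SLMIMO.spectralEfficiency L M * SLMIMO.normConst Nt Nr) *
              ∑ s ∈ code.symbols, ∑ s' ∈ code.symbols with s' ≠ s,
                SLMIMO.pairTerm Nt Nr N₀ (s - s')) := by
  have hC := SLMIMO.normConst_pos Nt Nr
  -- A probability space has a point, so some message exists. This excludes `M = 0` with `L > 0`,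
  -- where `logb 2 0 = 0` would make the left side one and the right side zero.
  have hpow : ∀ {Ω : Type u} [MeasurableSpace Ω] {μ : Measure Ω} [IsProbabilityMeasure μ]
      (T : SLMIMO.Transmission Nt Nr L M Ω),
      (2 : ℝ) ^ SLMIMO.spectralEfficiency L M = (M : ℝ) ^ L := by
    intro Ω _ μ _ T
    obtain ⟨ω⟩ : Nonempty Ω := nonempty_of_isProbabilityMeasure μ
    have : Nonempty (Fin L → Fin M) := ⟨T.msg ω⟩
    exact SLMIMO.two_rpow_spectralEfficiency
  have hfactor : ∀ f : (Fin (min Nt Nr) → ℂ) → Finset (Fin (min Nt Nr) → ℂ), ∀ N₀ : ℝ,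
      ∀ S : Finset (Fin (min Nt Nr) → ℂ),
      1 / ((M : ℝ) ^ L * SLMIMO.normConst Nt Nr) *
          ∑ s ∈ S, ∑ s' ∈ f s, SLMIMO.pairTerm Nt Nr N₀ (s - s') =
        1 / (M : ℝ) ^ L * ∑ s ∈ S, ∑ s' ∈ f s,
          1 / SLMIMO.normConst Nt Nr * SLMIMO.pairTerm Nt Nr N₀ (s - s') := fun f N₀ S => by
    simp only [← Finset.mul_sum]
    rw [← mul_assoc, one_div_mul_one_div]
  refine ⟨fun Ω _ μ _ H hH a ha => ?_, fun code N₀ hN₀ Ω _ μ _ T hT => ?_, fun code => ?_⟩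
  · have h : ∫ ω, ∏ m, Real.exp (-a m * SLMIMO.orderedEigenvalues (H ω) m) ∂μ =
        ∫ x in SLMIMO.orderedDomain (min Nt Nr),
          (∏ m, Real.exp (-a m * x m)) * SLMIMO.eigenvalueDensity Nt Nr x := by
      rw [← SLMIMO.integral_eigenvalueLaw]
      exact SLMIMO.integral_orderedEigenvalues hH
        (f := fun x => ∏ m, Real.exp (-a m * x m)) (by fun_prop)
    exact ⟨h, h.trans (SLMIMO.integral_exp_mul_eigenvalueDensity hNt hNr ha)⟩
  · classical
    rw [hpow (μ := μ) T, hfactor (fun _ => code.symbols)]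
    refine (hT.awep_le hN₀).trans (mul_le_mul_of_nonneg_left
      (Finset.sum_le_sum fun s hs => ?_) (by positivity))
    refine (SLMIMO.integral_cappedUnion_le hNt hNr hN₀ s _).trans (le_of_eq ?_)
    -- The full inner sum splits into the rivals `s' ≠ s` and the single diagonal term, which equals
    -- the constant `1 / 3` of the capped bound.
    rw [← Finset.sum_filter_add_sum_filter_not code.symbols (fun s' => s' ≠ s), add_comm]
    congr 1
    simp only [not_not]
    rw [Finset.filter_eq', if_pos hs, Finset.sum_singleton, sub_self,
      SLMIMO.pairTerm_zero hNt hNr hN₀]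
  · classical
    obtain ⟨N₁, h1, h2⟩ := SLMIMO.exists_integral_craig_le_finset hNt hNr code.symbols
    refine ⟨N₁, h1, fun N₀ h0 hN Ω _ μ _ T hT => ?_⟩
    rw [hpow (μ := μ) T, hfactor]
    refine (hT.awep_le h0).trans (mul_le_mul_of_nonneg_left
      (Finset.sum_le_sum fun s hs => ?_) (by positivity))
    refine (SLMIMO.integral_cappedUnion_le_sum h0 s _).trans ?_
    convert Finset.sum_le_sum fun s' hs' => h2 N₀ h0 hN s hs s' (Finset.mem_filter.1 hs').1
      (Finset.mem_filter.1 hs').2
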